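/- Let $\Omega\subset\mathbb{R}^2$ be a bounded domain (open, connected) with Lipschitz boundary. Let $\alpha,\sigma\in[0,\infty]$, $\gamma>0$, $M\in\mathbb{R}$, $\kappa\in\mathbb{N}$ and $h_0<1$, and put $\rho=\min(1,\alpha,\sigma/2)$; for $0<h<1$ let $h^{\infty}=0$. Then there is a constant $C$, depending only on $\Omega,\alpha,\sigma,\gamma,M,\kappa,h_0$, such that the following holds. Let $\mathcal{T}_h$ be a conforming triangulation of $\overline\Omega$ (so $\Omega$ is a polygon) with mesh size $h=\max_{\tau\in\mathcal{T}_h}\operatorname{diam}\tau\le h_0$ that satisfies the following conditions. (i) (Quasi-uniformity) Every $\tau\in\mathcal{T}_h$ contains a closed disc of radius $\gamma h$. (ii) (The $(\alpha,\sigma)$-condition, interior part) The set of interior edges is a disjoint union $\mathcal{E}_1\uplus\mathcal{E}_2$ such that, for each $e\in\mathcal{E}_1$, the two triangles sharing $e$ form a quadrilateral whose opposite sides differ in length by at most $Mh^{1+\alpha}$, while $\sum_{e\in\mathcal{E}_2}(|\tau_e|+|\tau_e'|)\le Mh^{\sigma}$, where $\tau_e,\tau_e'$ are the two triangles sharing $e$.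 (iii) (The $(\alpha,\sigma)$-condition, boundary part) The set of boundary vertices is a disjoint union $\mathcal{P}_1\uplus\mathcal{P}_2$ with $|\mathcal{P}_2|\le\kappa$ such that the following holds for each $x\in\mathcal{P}_1$. Let $e,e'$ be the boundary edges that end and start at $x$ respectively, let $\tau,\tau'$ be the triangles having $e,e'$ as edges, and let $\boldsymbol t,\boldsymbol t'$ be the unit tangents to $e,e'$, all edges being oriented counterclockwise around their triangles. Going around $\tau$ and $\tau'$ counterclockwise, starting from $e$ and from $e'$, the lengths of corresponding edges differ by at most $Mh^{1+\alpha}$, and $|\boldsymbol t-\boldsymbol t'|\le Mh^{\alpha}$. Let $\boldsymbol p\in W^{2,\infty}(\Omega)^2$ (represented by a function continuous on $\overline\Omega$), let $\Pi_h\boldsymbol p$ be its lowest order Raviart--Thomas interpolant, i.e. on each $\tau\in\mathcal{T}_h$ the field of the form $\boldsymbol a+a\boldsymbol x$ ($\boldsymbol a\in\mathbb{R}^2$, $a\in\mathbb{R}$) with $\int_e\Pi_h\boldsymbol p\cdot\boldsymbol n=\int_e\boldsymbol p\cdot\boldsymbol n$ for each edge $e$ of $\tau$, and let $\boldsymbol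 q_h=(\partial w_h/\partial x_2,-\partial w_h/\partial x_1)$, where $w_h$ is continuous on $\overline\Omega$ and affine on each $\tau\in\mathcal{T}_h$. Then $$\left|\int_\Omega(\boldsymbol p-\Pi_h\boldsymbol p)\cdot\boldsymbol q_h\right|\le C\,h^{1+\rho}\,|\log h|^{1/2}\,\|\nabla\boldsymbol p\|_{1,\infty,\Omega}\,\|\boldsymbol q_h\|_{0,\Omega},$$ where $\|\nabla\boldsymbol p\|_{1,\infty,\Omega}$ is the largest of the $L^\infty(\Omega)$ norms of the first and second weak partial derivatives of the components of $\boldsymbol p$, and $\|\cdot\|_{0,\Omega}$ is the $L^2(\Omega)$ norm. -/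

import Mathlib

open MeasureTheory Set

open scoped ContDiff ENNReal

namespace MixedFEM

noncomputable section

/-- The Euclidean plane. -/
abbrev Plane : Type := EuclideanSpace ℝ (Fin 2)

/-- The boundary of `Ω` is locally, after a rigid motion `φ` of the plane, the graph of a Lipschitz
function, with `Ω` lying on one side of it. -/
def HasLipschitzBoundary (Ω : Set Plane) : Prop :=
  ∀ x ∈ frontier Ω, ∃ (φ : Plane ≃ₗᵢ[ℝ] Plane) (f : ℝ → ℝ) (L : NNReal) (r : ℝ),
    0 < r ∧ LipschitzWith L f ∧ ∀ y ∈ Metric.ball x r, (y ∈ Ω ↔ f (φ y 0) < φ y 1)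

/-! ### Triangulations -/

/-- A (conforming) triangulation of `Ω`: a finite simplicial complex in the plane which is the union
of its triangles and whose underlying set is the closure of `Ω`. The vertex sets of the closed
triangles, edges and vertices are the faces with 3, 2 and 1 elements. -/
structure Triangulation (Ω : Set Plane) where
  complex : Geometry.SimplicialComplex ℝ Plane
  finite : complex.faces.Finite
  pure : ∀ s ∈ complex.faces, ∃ t ∈ complex.faces, s ⊆ t ∧ t.card = 3
  space_eq : complex.space = closure Ω

/-- The closed triangle, or closed segment, with vertex set `s`. -/
def hull (s : Finset Plane) : Set Plane := convexHull ℝ (s : Set Plane)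

/-- The area of the triangle with vertex set `s`. -/
def area (s : Finset Plane) : ℝ := volume.real (hull s)

/-- The points `a, b, c` are the vertices of a nondegenerate triangle, in counterclockwise order. -/
def Ccw (a b c : Plane) : Prop :=
  0 < (b 0 - a 0) * (c 1 - a 1) - (b 1 - a 1) * (c 0 - a 0)

/-- The power `h ^ a` with an extended exponent `a ∈ [0, ∞]`, for `0 < h < 1`: here `h ^ ∞ = 0`. -/
def hpow (h : ℝ) (a : ℝ≥0∞) : ℝ := if a = ⊤ then 0 else h ^ a.toReal

namespace Triangulation

variable {Ω : Set Plane} (T : Triangulation Ω)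

/-- The triangles of the triangulation. -/
def triangles : Finset (Finset Plane) := T.finite.toFinset.filter fun s => s.card = 3

/-- The edges of the triangulation. -/
def edges : Finset (Finset Plane) := T.finite.toFinset.filter fun s => s.card = 2

open scoped Classical in
/-- The triangles having `e` as an edge. -/
def adjacent (e : Finset Plane) : Finset (Finset Plane) := T.triangles.filter fun t => e ⊆ t

open scoped Classical in
/-- Interior edges: those shared by two triangles. -/
def interiorEdges : Finset (Finset Plane) := T.edges.filter fun e => (T.adjacent e).card = 2

open scoped Classical in
/-- Boundary edges: those which belong to one triangle only. These are the edges contained in the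
boundary of `Ω`. -/
def boundaryEdges : Finset (Finset Plane) := T.edges.filter fun e => (T.adjacent e).card = 1

open scoped Classical in
/-- Boundary vertices: the end points of the boundary edges. -/
def boundaryVertices : Finset Plane := T.boundaryEdges.biUnion id

/-- The mesh size is the largest diameter of a triangle. -/
def IsMeshSize (h : ℝ) : Prop :=
  IsGreatest ((fun t => Metric.diam (hull t)) '' (T.triangles : Set (Finset Plane))) h

/-- Quasi-uniformity with constant `γ` of a mesh of size `h`: each triangle contains a disc of
radius `γ * h`. -/
def QuasiUniform (h γ : ℝ) : Prop :=
  ∀ t ∈ T.triangles, ∃ x : Plane, Metric.closedBall x (γ * h) ⊆ hull t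

end Triangulation

/-- The triangles `a b c` and `a b d` with common edge `a b` form an approximate parallelogram with
tolerance `ε`: opposite edges of the quadrilateral `a d b c` differ in length by at most `ε`. -/
def ApproxParallelogram (ε : ℝ) (a b c d : Plane) : Prop :=
  |dist a c - dist b d| ≤ ε ∧ |dist b c - dist a d| ≤ ε

/-- The unit vector pointing from `a` to `b`. -/
def unitTangent (a b : Plane) : Plane := (dist a b)⁻¹ • (b - a)

/-- For a boundary vertex `x`, with boundary edges `y x` and `x z` that belong to the
counterclockwise triangles `y x c` and `x z d`: going around both triangles counterclockwise,
starting with these boundary edges, the lengths of corresponding edges differ by at most `ε`, and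
the unit tangents of the two boundary edges differ by at most `δ`. -/
def ApproxBoundaryParallelogram (ε δ : ℝ) (x y c z d : Plane) : Prop :=
  |dist y x - dist x z| ≤ ε ∧ |dist x c - dist z d| ≤ ε ∧ |dist c y - dist d x| ≤ ε ∧
    ‖unitTangent y x - unitTangent x z‖ ≤ δ

open scoped Classical in
/-- The `(α, σ)`-condition for a mesh of size `h`, with the implied constants of all the `O(·)`
bounded by `M`, and with at most `κ` exceptional boundary vertices. -/
def Triangulation.AlphaSigma {Ω : Set Plane} (T : Triangulation Ω) (h : ℝ) (α σ : ℝ≥0∞)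
    (M : ℝ) (κ : ℕ) : Prop :=
  (∃ E₂ ⊆ T.interiorEdges,
    (∀ a b c d : Plane, {a, b} ∈ T.interiorEdges \ E₂ → {a, b, c} ∈ T.triangles →
      {a, b, d} ∈ T.triangles → c ≠ d → ApproxParallelogram (M * hpow h (1 + α)) a b c d) ∧
    ∑ e ∈ E₂, ∑ t ∈ T.adjacent e, area t ≤ M * hpow h σ) ∧
  ∃ P₂ ⊆ T.boundaryVertices, P₂.card ≤ κ ∧
    ∀ x ∈ T.boundaryVertices \ P₂, ∀ y c z d : Plane,
      {y, x} ∈ T.boundaryEdges → {x, z} ∈ T.boundaryEdges →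
      {y, x, c} ∈ T.triangles → {x, z, d} ∈ T.triangles → Ccw y x c → Ccw x z d →
      ApproxBoundaryParallelogram (M * hpow h (1 + α)) (M * hpow h α) x y c z d

/-- The exponent `ρ = min (1, α, σ / 2)`. -/
def rho (α σ : ℝ≥0∞) : ℝ := (min 1 (min α (σ / 2))).toReal

/-! ### Sobolev regularity -/

/-- `g` is the weak partial derivative of `u` in the direction of the `i`-th coordinate on `Ω`. -/
def HasWeakPartial (Ω : Set Plane) (i : Fin 2) (u g : Plane → ℝ) : Prop :=
  LocallyIntegrableOn u Ω ∧ LocallyIntegrableOn g Ω ∧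
    ∀ φ : Plane → ℝ, ContDiff ℝ ∞ φ → HasCompactSupport φ → tsupport φ ⊆ Ω →
      ∫ x in Ω, u x * fderiv ℝ φ x (EuclideanSpace.single i 1) = -∫ x in Ω, g x * φ x

/-- The vector field `p` is of class `W^{2,∞}(Ω)`, with weak derivatives `G i j = ∂_j p_i` and
`H i j k = ∂_k ∂_j p_i`; and `p` is the representative of its class which is continuous on the
closure of `Ω`, so that it has values on the edges of a triangulation. -/
structure IsW2Infty (Ω : Set Plane) (p : Plane → Plane) (G : Fin 2 → Fin 2 → Plane → ℝ)
    (H : Fin 2 → Fin 2 → Fin 2 → Plane → ℝ) : Prop where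
  continuousOn : ContinuousOn p (closure Ω)
  weak_grad : ∀ i j, HasWeakPartial Ω j (fun x => p x i) (G i j)
  weak_hess : ∀ i j k, HasWeakPartial Ω k (G i j) (H i j k)
  memLp_grad : ∀ i j, MemLp (G i j) ⊤ (volume.restrict Ω)
  memLp_hess : ∀ i j k, MemLp (H i j k) ⊤ (volume.restrict Ω)

/-- The norm of the gradient `G` in `W^{1,∞}(Ω)`, where `H` is the weak derivative of `G`: the
largest of the `L^∞(Ω)` norms of all the components of `G` and `H`. -/
def normW1Infty (Ω : Set Plane) (G : Fin 2 → Fin 2 → Plane → ℝ)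
    (H : Fin 2 → Fin 2 → Fin 2 → Plane → ℝ) : ℝ :=
  (⨆ i, ⨆ j, max (eLpNorm (G i j) ⊤ (volume.restrict Ω))
    (⨆ k, eLpNorm (H i j k) ⊤ (volume.restrict Ω))).toReal

/-- The `L²(Ω)` inner product of vector fields. -/
def innerL2 (Ω : Set Plane) (u v : Plane → Plane) : ℝ := ∫ x in Ω, inner ℝ (u x) (v x)

/-- The `L²(Ω)` norm of a vector field. -/
def normL2 (Ω : Set Plane) (u : Plane → Plane) : ℝ := √(∫ x in Ω, ‖u x‖ ^ 2)

/-! ### Finite elements -/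

/-- The integral over the segment from `a` to `b` of `q · n`, where the unit normal `n` is the
clockwise rotation by a right angle of the unit vector from `a` to `b`. -/
def flux (q : Plane → Plane) (a b : Plane) : ℝ :=
  ∫ s in (0 : ℝ)..1, (q (a + s • (b - a)) 0 * (b 1 - a 1) - q (a + s • (b - a)) 1 * (b 0 - a 0))

/-- `r` is the lowest order Raviart-Thomas interpolant of `p`: inside each triangle it is of the form
`x ↦ a + m x`, with the same normal flux as `p` through each edge of the triangle. (Values on the
edges, a null set, are left free.) -/
def Triangulation.IsRTInterpolant {Ω : Set Plane} (T : Triangulation Ω) (p r : Plane → Plane) :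
    Prop :=
  ∀ t ∈ T.triangles, ∃ (a : Plane) (m : ℝ), (∀ x ∈ interior (hull t), r x = a + m • x) ∧
    ∀ u ∈ t, ∀ v ∈ t, u ≠ v → flux (fun x => a + m • x) u v = flux p u v

/-- `w` is a continuous piecewise linear function on the triangulation. -/
def Triangulation.IsContinuousP1 {Ω : Set Plane} (T : Triangulation Ω) (w : Plane → ℝ) : Prop :=
  ContinuousOn w (closure Ω) ∧ ∀ t ∈ T.triangles, ∃ f : Plane →ᵃ[ℝ] ℝ, EqOn w f (hull t)

/-- The vector curl `(∂w/∂x₂, -∂w/∂x₁)`; for piecewise linear `w` this is the piecewise curl, which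
is defined up to the null set of the edges. -/
def curl (w : Plane → ℝ) (x : Plane) : Plane :=
  !₂[fderiv ℝ w x (EuclideanSpace.single 1 1), -fderiv ℝ w x (EuclideanSpace.single 0 1)]

end

end MixedFEM

open MixedFEM

namespace MixedFEM

noncomputable section

open Filter Topology

/-! On each triangle `curl w` is a constant vector, and its normal flux through an edge is the
increment of `w` along that edge. Replacing `p` on each triangle by an affine Taylor field costs
`O(h²)` pointwise, which is already within the claimed order. For an affine field the Raviart-Thomas
error, paired with a constant vector, integrates to one quadratic term per edge
(`IsAffineField.integral_sub_rtPairing`). `sum_inner_rotForm_eq` turns these terms into increments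
of `w` times coefficients `flagCoef` of size `O(h²)`. The integral is thus, up to the Taylor
remainder, a sum over triangles with a distinguished oriented edge, called flags.

An interior edge carries two flags with opposite increments, so only the difference of their
coefficients matters. The coefficient is even in the edge vectors, hence would agree for the two
halves of an exact parallelogram and a common linear part. By `edgeCoef_close` an approximate
parallelogram and nearly equal linear parts gain a factor `h ^ α + h`. On the exceptional edges
nothing is gained in the coefficient, but Cauchy-Schwarz against their total area `O(h ^ σ)` gives
the factor `h ^ (σ / 2)`.

On the boundary, summation by parts (`sum_boundaryFlags`) transfers the difference from `w` to the
coefficients of consecutive boundary edges, which are again close except at `κ` vertices. There are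
`O(1 / h)` boundary vertices, and the values of `w`, normalized by a constant, remain as factors.
The discrete Sobolev inequality (`discrete_sobolev`) bounds them by `|log h| ^ (1 / 2)` times the
`L²` norm of `curl w`; this is the only source of the logarithm. It rests on representing `w x` by
integrals of its gradient over a cone with apex `x`, and on an inverse estimate near the apex.

Two facts about `Ω` support this. Mollification provides pointwise gradients of `p` with Lipschitz
and Taylor bounds along segments inside `Ω` (`exists_gradient`), and the Lipschitz boundary gives
short paths in `Ω` between triangles sharing a vertex (`exists_short_path`). Constants depending on
`Ω`, such as the covering number of its frontier, are read off from one fixed triangulation. -/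

/-! ### Signed areas and triangles as intersections of half-planes -/

/-- Twice the signed area of the triangle `a b c`. -/
def cr (a b c : Plane) : ℝ := (b 0 - a 0) * (c 1 - a 1) - (b 1 - a 1) * (c 0 - a 0)

lemma ccw_iff {a b c : Plane} : Ccw a b c ↔ 0 < cr a b c := Iff.rfl

lemma cr_rotate (a b c : Plane) : cr b c a = cr a b c := by unfold cr; ring

lemma cr_swap (a b c : Plane) : cr b a c = -cr a b c := by unfold cr; ring

lemma plane_ext {x y : Plane} (h0 : x 0 = y 0) (h1 : x 1 = y 1) : x = y := by
  ext i; fin_cases i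
  · exact h0
  · exact h1

lemma norm_sq_plane (x : Plane) : ‖x‖ ^ 2 = x 0 ^ 2 + x 1 ^ 2 := by
  rw [EuclideanSpace.norm_sq_eq]; simp [Fin.sum_univ_two]

lemma inner_plane (x y : Plane) : inner ℝ x y = x 0 * y 0 + x 1 * y 1 := by
  simp [PiLp.inner_apply, Fin.sum_univ_two]; ring

lemma abs_coord_le (x : Plane) (i : Fin 2) : |x i| ≤ ‖x‖ := by
  have := PiLp.norm_apply_le x i
  simpa using this

lemma cr_sum (a b c z : Plane) : cr b c z + cr c a z + cr a b z = cr a b c := by unfold cr; ring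

/-- Barycentric coordinates with the denominator cleared, so that the identity also holds for
degenerate triangles, where it becomes an affine dependence of the vertices. -/
lemma barycentric_smul (a b c z : Plane) :
    cr a b c • z = cr b c z • a + cr c a z • b + cr a b z • c := by
  apply plane_ext <;> simp [cr] <;> ring

lemma cr_affine (a b x y : Plane) {s t : ℝ} (h : s + t = 1) :
    cr a b (s • x + t • y) = s * cr a b x + t * cr a b y := by
  obtain rfl : t = 1 - s := by linarith
  simp [cr]; ring

lemma continuous_cr (a b : Plane) : Continuous (cr a b) := by
  unfold cr; fun_prop

/-- The closed triangle described by inequalities. -/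
def ctri (a b c : Plane) : Set Plane := {z | 0 ≤ cr b c z ∧ 0 ≤ cr c a z ∧ 0 ≤ cr a b z}

/-- The open triangle described by inequalities. -/
def otri (a b c : Plane) : Set Plane := {z | 0 < cr b c z ∧ 0 < cr c a z ∧ 0 < cr a b z}

lemma isOpen_otri (a b c : Plane) : IsOpen (otri a b c) :=
  (isOpen_lt continuous_const (continuous_cr _ _)).inter
    ((isOpen_lt continuous_const (continuous_cr _ _)).inter
      (isOpen_lt continuous_const (continuous_cr _ _)))

lemma convex_ctri (a b c : Plane) : Convex ℝ (ctri a b c) := by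
  intro x hx y hy s t hs ht hst
  obtain ⟨h1, h2, h3⟩ := hx
  obtain ⟨k1, k2, k3⟩ := hy
  refine ⟨?_, ?_, ?_⟩ <;> rw [cr_affine _ _ _ _ hst] <;> positivity

lemma combo_mem_hull (a b c : Plane) {r s t : ℝ} (hr : 0 ≤ r) (hs : 0 ≤ s) (ht : 0 ≤ t)
    (h : r + s + t = 1) : r • a + s • b + t • c ∈ convexHull ℝ ({a, b, c} : Set Plane) := by
  have := (convex_convexHull ℝ ({a, b, c} : Set Plane)).sum_mem (t := Finset.univ)
    (w := ![r, s, t]) (z := ![a, b, c]) ?_ ?_ ?_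
  · simpa [Fin.sum_univ_three] using this
  · intro i _; fin_cases i <;> simpa
  · simpa [Fin.sum_univ_three] using h
  · intro i _; apply subset_convexHull; fin_cases i <;> simp

lemma combo_of_pos {a b c : Plane} (hD : 0 < cr a b c) (z : Plane) :
    z = (cr b c z / cr a b c) • a + (cr c a z / cr a b c) • b + (cr a b z / cr a b c) • c := by
  have h := congrArg (fun v => (cr a b c)⁻¹ • v) (barycentric_smul a b c z)
  simp only [smul_smul, smul_add, inv_mul_cancel₀ hD.ne', one_smul] at h
  simpa only [div_eq_inv_mul] using h

lemma convexHull_triple_eq {a b c : Plane} (hD : 0 < cr a b c) :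
    convexHull ℝ ({a, b, c} : Set Plane) = ctri a b c := by
  apply Subset.antisymm
  · apply convexHull_min _ (convex_ctri a b c)
    have e1 := cr_rotate a b c
    have e2 := cr_rotate b c a
    rintro z (rfl | rfl | rfl)
    · exact ⟨by rw [e1]; exact hD.le, by simp [cr]; linarith, by simp [cr]⟩
    · refine ⟨by simp [cr], by rw [e2, e1]; exact hD.le, le_of_eq ?_⟩
      simp [cr]; ring
    · exact ⟨le_of_eq (by simp [cr]; ring), by simp [cr], hD.le⟩
  · rintro z ⟨h1, h2, h3⟩
    rw [combo_of_pos hD z]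
    apply combo_mem_hull <;> try positivity
    rw [← add_div, ← add_div, cr_sum, div_self hD.ne']

lemma otri_subset_ctri (a b c : Plane) : otri a b c ⊆ ctri a b c :=
  fun _ h => ⟨h.1.le, h.2.1.le, h.2.2.le⟩

lemma segment_of_cr_eq_zero {a b c z : Plane} (hD : 0 < cr a b c) (hz : z ∈ ctri a b c)
    (h : cr a b z = 0) : z ∈ segment ℝ a b := by
  refine ⟨cr b c z / cr a b c, cr c a z / cr a b c, div_nonneg hz.1 hD.le,
    div_nonneg hz.2.1 hD.le, ?_, ?_⟩
  · have := cr_sum a b c z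
    rw [← add_div, div_eq_one_iff_eq hD.ne']; linarith
  · conv_rhs => rw [combo_of_pos hD z]
    simp [h]

lemma ctri_rotate (a b c : Plane) : ctri b c a = ctri a b c := by
  ext z; simp only [ctri, mem_ofPred_eq]; tauto

lemma ctri_diff_otri_subset {a b c : Plane} (hD : 0 < cr a b c) :
    ctri a b c \ otri a b c ⊆ segment ℝ a b ∪ segment ℝ b c ∪ segment ℝ c a := by
  rintro z ⟨hz, hz'⟩
  by_cases h1 : cr a b z = 0
  · exact .inl (.inl (segment_of_cr_eq_zero hD hz h1))
  by_cases h2 : cr b c z = 0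
  · exact .inl (.inr (segment_of_cr_eq_zero (c := a) (by rwa [cr_rotate])
      (by rwa [ctri_rotate]) h2))
  by_cases h3 : cr c a z = 0
  · refine .inr (segment_of_cr_eq_zero (c := b) (by rwa [cr_rotate, cr_rotate])
      (by rwa [ctri_rotate, ctri_rotate]) h3)
  · exact absurd ⟨lt_of_le_of_ne hz.1 (Ne.symm h2), lt_of_le_of_ne hz.2.1 (Ne.symm h3),
      lt_of_le_of_ne hz.2.2 (Ne.symm h1)⟩ hz'

lemma segment_eq_affine (a b : Plane) :
    segment ℝ a b ⊆ (AffineSubspace.mk' a (Submodule.span ℝ {b - a}) : Set Plane) := by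
  rw [segment_eq_image']
  rintro _ ⟨t, _, rfl⟩
  rw [SetLike.mem_coe, AffineSubspace.mem_mk']
  simpa using Submodule.smul_mem _ t (Submodule.mem_span_singleton_self (b - a))

lemma volume_segment (a b : Plane) : volume (segment ℝ a b) = 0 := by
  refine measure_mono_null (segment_eq_affine a b) (Measure.addHaar_affineSubspace _ _ ?_)
  intro h
  have h1 : Submodule.span ℝ {b - a} = ⊤ := by
    rw [← AffineSubspace.direction_mk' a (Submodule.span ℝ {b - a}), h,
      AffineSubspace.direction_top]
  have h2 := finrank_span_le_card (R := ℝ) ({b - a} : Set Plane)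
  rw [h1, finrank_top] at h2
  simp at h2

lemma ctri_ae_eq_otri {a b c : Plane} (hD : 0 < cr a b c) :
    ctri a b c =ᵐ[volume] otri a b c := by
  refine (ae_eq_set).2 ⟨measure_mono_null (ctri_diff_otri_subset hD) ?_, ?_⟩
  · simp [measure_union_null_iff, volume_segment]
  · rw [sdiff_eq_empty.2 (otri_subset_ctri a b c)]; simp

/-! ### Integration over a triangle -/

/-- The measure preserving identification of `ℝ × ℝ` with the plane. -/
def planeOfProd : ℝ × ℝ ≃ᵐ Plane :=
  (MeasurableEquiv.finTwoArrow (α := ℝ)).symm.trans (MeasurableEquiv.toLp 2 (Fin 2 → ℝ))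

lemma planeOfProd_apply (p : ℝ × ℝ) : planeOfProd p = !₂[p.1, p.2] := rfl

lemma measurePreserving_planeOfProd : MeasurePreserving planeOfProd :=
  (volume_preserving_finTwoArrow ℝ).symm.trans (PiLp.volume_preserving_toLp (Fin 2))

/-- The parametrization of the triangle `x a b` by the unit square, with `x` blown up. -/
def cone (x a b : Plane) (p : ℝ × ℝ) : Plane :=
  x + p.1 • ((1 - p.2) • (a - x) + p.2 • (b - x))

/-- The map `cone` in coordinates. -/
def coneProd (x a b : Plane) (p : ℝ × ℝ) : ℝ × ℝ :=
  (x 0 + p.1 * ((1 - p.2) * (a 0 - x 0) + p.2 * (b 0 - x 0)),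
    x 1 + p.1 * ((1 - p.2) * (a 1 - x 1) + p.2 * (b 1 - x 1)))

lemma planeOfProd_coneProd (x a b : Plane) (p : ℝ × ℝ) :
    planeOfProd (coneProd x a b p) = cone x a b p := by
  rw [planeOfProd_apply]
  apply plane_ext <;> simp [coneProd, cone] <;> ring

lemma continuous_cone (x a b : Plane) : Continuous (cone x a b) := by
  unfold cone; fun_prop

/-- The open unit square. -/
def unitSq : Set (ℝ × ℝ) := Ioo 0 1 ×ˢ Ioo 0 1

lemma measurableSet_unitSq : MeasurableSet unitSq := measurableSet_Ioo.prod measurableSet_Ioo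

lemma cr_cone (x a b : Plane) (p : ℝ × ℝ) : cr a b (cone x a b p) = (1 - p.1) * cr x a b ∧
    cr b x (cone x a b p) = p.1 * (1 - p.2) * cr x a b ∧
    cr x a (cone x a b p) = p.1 * p.2 * cr x a b := by
  refine ⟨?_, ?_, ?_⟩ <;> simp [cone, cr] <;> ring

lemma image_cone {x a b : Plane} (hD : 0 < cr x a b) : cone x a b '' unitSq = otri x a b := by
  ext z
  constructor
  · rintro ⟨p, ⟨⟨h1, h2⟩, h3, h4⟩, rfl⟩
    obtain ⟨e1, e2, e3⟩ := cr_cone x a b p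
    have := sub_pos.2 h2
    have := sub_pos.2 h4
    refine ⟨?_, ?_, ?_⟩
    · rw [e1]; positivity
    · rw [e2]; positivity
    · rw [e3]; positivity
  · rintro ⟨h1, h2, h3⟩
    have hs := cr_sum x a b z
    have hp : 0 < cr b x z + cr x a z := by positivity
    -- The first parameter is the total barycentric weight of `a` and `b`, the second the share of
    -- `b` in it.
    refine ⟨((cr b x z + cr x a z) / cr x a b, cr x a z / (cr b x z + cr x a z)),
      ⟨⟨by positivity, ?_⟩, by positivity, ?_⟩, ?_⟩
    · rw [div_lt_one hD]; linarith
    · rw [div_lt_one hp]; linarith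
    · have hz := combo_of_pos hD z
      conv_rhs => rw [hz]
      have e : cr a b z = cr x a b - (cr b x z + cr x a z) := by linarith
      rw [e]
      set D := cr x a b
      set β := cr b x z
      set δ := cr x a z
      apply plane_ext <;> simp [cone] <;> field_simp <;> ring

lemma injOn_cone {x a b : Plane} (hD : 0 < cr x a b) : InjOn (cone x a b) unitSq := by
  rintro p ⟨⟨h1, h2⟩, h3, h4⟩ q ⟨⟨k1, k2⟩, k3, k4⟩ h
  obtain ⟨e1, e2, e3⟩ := cr_cone x a b p
  obtain ⟨f1, f2, f3⟩ := cr_cone x a b q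
  rw [h] at e1 e3
  have g1 : p.1 = q.1 := by
    have := mul_right_cancel₀ hD.ne' (e1.symm.trans f1); linarith
  have g2 := mul_right_cancel₀ hD.ne' (e3.symm.trans f3)
  rw [g1] at g2
  exact Prod.ext g1 (mul_left_cancel₀ k1.ne' g2)

/-- The derivative of `coneProd`. -/
def fderivConeProd (x a b : Plane) (p : ℝ × ℝ) : ℝ × ℝ →L[ℝ] ℝ × ℝ :=
  LinearMap.toContinuousLinearMap
    (Matrix.toLin (Module.Basis.finTwoProd ℝ) (Module.Basis.finTwoProd ℝ)
      !![(1 - p.2) * (a 0 - x 0) + p.2 * (b 0 - x 0), p.1 * (b 0 - a 0);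
        (1 - p.2) * (a 1 - x 1) + p.2 * (b 1 - x 1), p.1 * (b 1 - a 1)])

lemma hasFDerivAt_coneProd (x a b : Plane) (p : ℝ × ℝ) :
    HasFDerivAt (coneProd x a b) (fderivConeProd x a b p) p := by
  unfold fderivConeProd
  rw [Matrix.toLin_finTwoProd_toContinuousLinearMap]
  have key : ∀ i : Fin 2, HasFDerivAt
      (fun p : ℝ × ℝ => x i + p.1 * ((1 - p.2) * (a i - x i) + p.2 * (b i - x i)))
      (((1 - p.2) * (a i - x i) + p.2 * (b i - x i)) • ContinuousLinearMap.fst ℝ ℝ ℝ +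
        (p.1 * (b i - a i)) • ContinuousLinearMap.snd ℝ ℝ ℝ) p := by
    intro i
    have h1 : HasFDerivAt (fun p : ℝ × ℝ => p.1) (ContinuousLinearMap.fst ℝ ℝ ℝ) p :=
      hasFDerivAt_fst
    have h2 : HasFDerivAt (fun p : ℝ × ℝ => p.2) (ContinuousLinearMap.snd ℝ ℝ ℝ) p :=
      hasFDerivAt_snd
    have := (h1.mul (((h2.const_sub 1).mul_const (a i - x i)).add
      (h2.mul_const (b i - x i)))).const_add (x i)
    refine this.congr_fderiv ?_
    ext <;> simp
    ring
  exact (key 0).prodMk (key 1)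

lemma det_fderivConeProd (x a b : Plane) (p : ℝ × ℝ) :
    (fderivConeProd x a b p).det = p.1 * cr x a b := by
  conv_lhs => rw [fderivConeProd, LinearMap.det_toContinuousLinearMap, LinearMap.det_toLin,
    Matrix.det_fin_two_of]
  unfold cr; ring

lemma injOn_coneProd {x a b : Plane} (hD : 0 < cr x a b) : InjOn (coneProd x a b) unitSq := by
  intro p hp q hq h
  exact injOn_cone hD hp hq (by rw [← planeOfProd_coneProd, h, planeOfProd_coneProd])

lemma preimage_otri {x a b : Plane} (hD : 0 < cr x a b) :
    planeOfProd ⁻¹' otri x a b = coneProd x a b '' unitSq := by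
  rw [← image_cone hD]
  have : cone x a b = planeOfProd ∘ coneProd x a b := by
    ext1 p; exact (planeOfProd_coneProd x a b p).symm
  rw [this, image_comp, preimage_image_eq _ planeOfProd.injective]

/-- The Jacobian of the cone map is `p.1 * cr x a b`. Its vanishing at the apex is what later
produces the logarithm in the discrete Sobolev inequality. -/
lemma setIntegral_otri {x a b : Plane} (hD : 0 < cr x a b) (f : Plane → ℝ) :
    ∫ z in otri x a b, f z = ∫ p in unitSq, p.1 * cr x a b * f (cone x a b p) := by
  rw [← measurePreserving_planeOfProd.setIntegral_preimage_emb
    planeOfProd.measurableEmbedding, preimage_otri hD,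
    integral_image_eq_integral_abs_det_fderiv_smul volume measurableSet_unitSq
      (fun p _ => (hasFDerivAt_coneProd x a b p).hasFDerivWithinAt) (injOn_coneProd hD)]
  refine setIntegral_congr_fun measurableSet_unitSq fun p hp => ?_
  simp only [det_fderivConeProd, planeOfProd_coneProd, smul_eq_mul]
  rw [abs_of_pos (mul_pos hp.1.1 hD)]

lemma integrableOn_otri {x a b : Plane} (hD : 0 < cr x a b) (f : Plane → ℝ) :
    IntegrableOn f (otri x a b) ↔
      IntegrableOn (fun p => p.1 * cr x a b * f (cone x a b p)) unitSq := by
  rw [← measurePreserving_planeOfProd.integrableOn_comp_preimage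
    planeOfProd.measurableEmbedding, preimage_otri hD,
    integrableOn_image_iff_integrableOn_abs_det_fderiv_smul volume measurableSet_unitSq
      (fun p _ => (hasFDerivAt_coneProd x a b p).hasFDerivWithinAt) (injOn_coneProd hD)]
  refine integrableOn_congr_fun (fun p hp => ?_) measurableSet_unitSq
  simp only [det_fderivConeProd, Function.comp, planeOfProd_coneProd, smul_eq_mul]
  rw [abs_of_pos (mul_pos hp.1.1 hD)]

lemma setIntegral_unitSq_mul (f g : ℝ → ℝ) :
    ∫ p in unitSq, f p.1 * g p.2 = (∫ s in (0 : ℝ)..1, f s) * ∫ t in (0 : ℝ)..1, g t := by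
  rw [intervalIntegral.integral_of_le zero_le_one, intervalIntegral.integral_of_le zero_le_one,
    integral_Ioc_eq_integral_Ioo, integral_Ioc_eq_integral_Ioo, unitSq, Measure.volume_eq_prod]
  exact setIntegral_prod_mul (μ := volume) (ν := volume) f g (Ioo 0 1) (Ioo 0 1)

lemma volume_otri {a b c : Plane} (hD : 0 < cr a b c) :
    volume.real (otri a b c) = cr a b c / 2 := by
  have h := setIntegral_otri hD (fun _ => 1)
  rw [setIntegral_const] at h
  have h2 := setIntegral_unitSq_mul (fun s => s * cr a b c) (fun _ => 1)
  simp only [mul_one] at h2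
  simp only [smul_eq_mul, mul_one] at h
  rw [h, h2]
  simp
  ring

lemma isCompact_ctri {a b c : Plane} (hD : 0 < cr a b c) : IsCompact (ctri a b c) := by
  rw [← convexHull_triple_eq hD]
  exact Set.Finite.isCompact_convexHull (𝕜 := ℝ) (Set.toFinite _)

/-- The centroid of a triangle. -/
def centroid3 (a b c : Plane) : Plane := (1 / 3 : ℝ) • (a + b + c)

/-- The integral of an affine function over a triangle. -/
lemma setIntegral_affine {a b c : Plane} (hD : 0 < cr a b c) (k l m : ℝ) :
    ∫ z in otri a b c, (k + l * z 0 + m * z 1) =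
      cr a b c / 2 * (k + l * centroid3 a b c 0 + m * centroid3 a b c 1) := by
  rw [setIntegral_otri hD]
  set D := cr a b c
  have e : ∀ p : ℝ × ℝ, p.1 * D * (k + l * cone a b c p 0 + m * cone a b c p 1) =
      (p.1 * (D * (k + l * a 0 + m * a 1))) * 1 +
      (p.1 ^ 2 * D) * (l * (b 0 - a 0) + m * (b 1 - a 1)
        + p.2 * (l * (c 0 - b 0) + m * (c 1 - b 1))) := by
    intro p; simp [cone]; ring
  simp_rw [e]
  have hc : ∀ F : ℝ × ℝ → ℝ, Continuous F → IntegrableOn F unitSq := fun F hF =>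
    (hF.continuousOn.integrableOn_compact (isCompact_Icc.prod isCompact_Icc)).mono_set
      (prod_mono Ioo_subset_Icc_self Ioo_subset_Icc_self)
  rw [integral_add (hc _ (by fun_prop)) (hc _ (by fun_prop)),
    setIntegral_unitSq_mul (fun s => s * (D * (k + l * a 0 + m * a 1))) (fun _ => 1),
    setIntegral_unitSq_mul (fun s => s ^ 2 * D) (fun t => l * (b 0 - a 0) + m * (b 1 - a 1)
        + t * (l * (c 0 - b 0) + m * (c 1 - b 1)))]
  rw [intervalIntegral.integral_mul_const, intervalIntegral.integral_mul_const,
    intervalIntegral.integral_add (by simp) (by apply Continuous.intervalIntegrable; fun_prop),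
    intervalIntegral.integral_mul_const]
  simp [centroid3]
  ring

/-- The disc has area `π r²`, the triangle `cr a b c / 2`, and `π ≥ 3`. -/
lemma disc_le_cr {a b c x : Plane} {r : ℝ} (hD : 0 < cr a b c) (hr : 0 ≤ r)
    (h : Metric.closedBall x r ⊆ ctri a b c) : 6 * r ^ 2 ≤ cr a b c := by
  have h1 : volume.real (Metric.closedBall x r) ≤ volume.real (ctri a b c) :=
    measureReal_mono h (isCompact_ctri hD).measure_lt_top.ne
  rw [measureReal_congr (ctri_ae_eq_otri hD), volume_otri hD, measureReal_def,
    EuclideanSpace.volume_closedBall_fin_two, ENNReal.toReal_mul, ENNReal.toReal_pow,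
    ENNReal.toReal_ofReal hr] at h1
  have h2 : 3 ≤ Real.pi := Real.pi_gt_three.le
  rw [ENNReal.toReal_ofReal Real.pi_pos.le] at h1
  nlinarith [sq_nonneg r]

/-! ### Mollification -/

/-- Bump functions supported in balls of radius `1 / (n + 1)`. -/
def bump (n : ℕ) : ContDiffBump (0 : Plane) where
  rIn := 1 / (n + 2)
  rOut := 1 / (n + 1)
  rIn_pos := by positivity
  rIn_lt_rOut := by
    apply one_div_lt_one_div_of_lt <;> linarith [(Nat.cast_nonneg n : (0 : ℝ) ≤ n)]

/-- The mollification of `v` on `Ω`, extended by zero. -/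
def moll (n : ℕ) (Ω : Set Plane) (v : Plane → ℝ) (x : Plane) : ℝ :=
  ∫ t in Ω, (bump n).normed volume (x - t) * v t

lemma moll_eq_convolution (n : ℕ) {Ω : Set Plane} (hΩ : MeasurableSet Ω) (v : Plane → ℝ) :
    moll n Ω v = (convolution (indicator Ω v) ((bump n).normed volume)
      (ContinuousLinearMap.mul ℝ ℝ) volume) := by
  ext x
  rw [moll, ← integral_indicator hΩ, convolution_def]
  congr 1; ext t
  by_cases h : t ∈ Ω <;> simp [h, mul_comm]

lemma moll_hasFDerivAt (n : ℕ) {Ω : Set Plane} (hΩ : MeasurableSet Ω) {v : Plane → ℝ}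
    (hv : IntegrableOn v Ω) (x : Plane) :
    ∃ F : Plane →L[ℝ] ℝ, HasFDerivAt (moll n Ω v) F x ∧
      ∀ e, F e = ∫ t in Ω, fderiv ℝ ((bump n).normed volume) (x - t) e * v t := by
  have hv' : LocallyIntegrable (indicator Ω v) :=
    ((integrable_indicator_iff hΩ).2 hv).locallyIntegrable
  have hK : ContDiff ℝ 1 ((bump n).normed (volume : Measure Plane)) :=
    (bump n).contDiff_normed
  have hc := (bump n).hasCompactSupport_normed (μ := (volume : Measure Plane))
  have h := hc.hasFDerivAt_convolution_right (ContinuousLinearMap.mul ℝ ℝ) hv' hK x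
  rw [← moll_eq_convolution n hΩ] at h
  refine ⟨_, h, fun e => ?_⟩
  rw [convolution_precompR_apply _ hv' (hc.fderiv ℝ) (hK.continuous_fderiv one_ne_zero),
    convolution_def, ← integral_indicator hΩ]
  congr 1; ext t
  by_cases h : t ∈ Ω <;> simp [h, mul_comm]

/-- The translated kernel `t ↦ K (x - t)` is an admissible test function because its support stays
in `Ω`. The sign from differentiating the reflection cancels the sign of the integration by parts.
-/
lemma moll_weakPartial (n : ℕ) {Ω : Set Plane} {v g : Plane → ℝ} {j : Fin 2}
    (h : HasWeakPartial Ω j v g) {x : Plane} (hx : Metric.closedBall x (bump n).rOut ⊆ Ω) :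
    ∫ t in Ω, fderiv ℝ ((bump n).normed volume) (x - t) (EuclideanSpace.single j 1) * v t =
      moll n Ω g x := by
  set K := (bump n).normed (volume : Measure Plane) with hK
  have hKs : ContDiff ℝ ∞ K := (bump n).contDiff_normed
  have hs : tsupport (fun t => K (x - t)) ⊆ Metric.closedBall x (bump n).rOut := by
    apply closure_minimal _ Metric.isClosed_closedBall
    intro t ht
    have : x - t ∈ Function.support K := ht
    rw [hK, ContDiffBump.support_normed_eq, mem_ball_zero_iff] at this
    rw [Metric.mem_closedBall, dist_comm, dist_eq_norm]
    exact this.le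
  have h2 := h.2.2 (fun t => K (x - t)) (hKs.comp (contDiff_const.sub contDiff_id))
    ((isCompact_closedBall x _).of_isClosed_subset (isClosed_tsupport _) hs) (hs.trans hx)
  have hd : ∀ t, fderiv ℝ (fun t => K (x - t)) t (EuclideanSpace.single j 1) =
      -fderiv ℝ K (x - t) (EuclideanSpace.single j 1) := by
    intro t
    have h1 : HasFDerivAt K (fderiv ℝ K (x - t)) (x - t) :=
      (hKs.differentiable (by simp) _).hasFDerivAt
    have h3 : HasFDerivAt (fun t => K (x - t)) _ t :=
      h1.comp t ((hasFDerivAt_id t).const_sub x)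
    rw [h3.fderiv]; simp
  simp only [hd, mul_neg, integral_neg, neg_inj] at h2
  rw [moll]
  simpa only [mul_comm] using h2

lemma moll_hasFDerivAt_weak (n : ℕ) {Ω : Set Plane} (hΩ : MeasurableSet Ω) {v : Plane → ℝ}
    {g : Fin 2 → Plane → ℝ} (hv : IntegrableOn v Ω) (h : ∀ j, HasWeakPartial Ω j v (g j))
    {x : Plane} (hx : Metric.closedBall x (bump n).rOut ⊆ Ω) :
    ∃ F : Plane →L[ℝ] ℝ, HasFDerivAt (moll n Ω v) F x ∧
      ∀ e, F e = moll n Ω (g 0) x * e 0 + moll n Ω (g 1) x * e 1 := by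
  obtain ⟨F, hF, he⟩ := moll_hasFDerivAt n hΩ hv x
  refine ⟨F, hF, fun e => ?_⟩
  have e1 : e = e 0 • EuclideanSpace.single 0 1 + e 1 • EuclideanSpace.single 1 1 := by
    apply plane_ext <;> simp
  conv_lhs => rw [e1]
  rw [map_add, map_smul, map_smul, he, he, moll_weakPartial n (h 0) hx,
    moll_weakPartial n (h 1) hx]
  simp [mul_comm]

lemma integrable_bump_sub (n : ℕ) (x : Plane) :
    Integrable (fun t => (bump n).normed volume (x - t)) (volume : Measure Plane) :=
  ((bump n).integrable_normed (μ := volume)).comp_sub_left x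

lemma abs_moll_le (n : ℕ) {Ω : Set Plane} {v : Plane → ℝ} {N : ℝ}
    (hv : ∀ᵐ x ∂volume.restrict Ω, |v x| ≤ N) (hN : 0 ≤ N) (x : Plane) :
    |moll n Ω v x| ≤ N := by
  have hi := (integrable_bump_sub n x)
  calc |moll n Ω v x| ≤ ∫ t in Ω, N * (bump n).normed volume (x - t) := by
        rw [← Real.norm_eq_abs, moll]
        apply norm_integral_le_of_norm_le (hi.integrableOn.const_mul N)
        filter_upwards [hv] with t ht
        rw [norm_mul, Real.norm_of_nonneg ((bump n).nonneg_normed _), mul_comm]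
        exact mul_le_mul_of_nonneg_right ht ((bump n).nonneg_normed _)
    _ = N * ∫ t in Ω, (bump n).normed volume (x - t) := integral_const_mul _ _
    _ ≤ N * ∫ t, (bump n).normed volume (x - t) :=
        mul_le_mul_of_nonneg_left (setIntegral_le_integral hi
          (.of_forall fun t => (bump n).nonneg_normed _)) hN
    _ = N := by rw [integral_sub_left_eq_self (fun t => (bump n).normed volume t) volume x,
          ContDiffBump.integral_normed, mul_one]

lemma tendsto_rOut_bump : Tendsto (fun n => (bump n).rOut) atTop (𝓝 0) :=
  tendsto_one_div_add_atTop_nhds_zero_nat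

lemma tendsto_moll {Ω : Set Plane} (hΩ : IsOpen Ω) {v : Plane → ℝ} (hv : IntegrableOn v Ω)
    (hc : ContinuousOn v Ω) {x : Plane} (hx : x ∈ Ω) :
    Tendsto (fun n => moll n Ω v x) atTop (𝓝 (v x)) := by
  have h := ContDiffBump.convolution_tendsto_right (μ := volume) (φ := bump)
    (g := fun _ => indicator Ω v) (k := fun _ => x) (x₀ := x) (z₀ := v x) tendsto_rOut_bump
    (.of_forall fun _ => ((integrable_indicator_iff hΩ.measurableSet).2 hv).aestronglyMeasurable)
    ?_ tendsto_const_nhds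
  · refine h.congr fun n => ?_
    rw [convolution_lsmul_swap, moll, ← integral_indicator hΩ.measurableSet]
    congr 1; ext t
    by_cases h : t ∈ Ω <;> simp [h]
  · have h1 : Tendsto (indicator Ω v) (𝓝 x) (𝓝 (v x)) := by
      refine ((hc.continuousAt (hΩ.mem_nhds hx)).tendsto).congr' ?_
      filter_upwards [hΩ.mem_nhds hx] with y hy using (indicator_of_mem hy v).symm
    exact h1.comp tendsto_snd

lemma abs_two_mul_le {m₀ m₁ N : ℝ} (h0 : |m₀| ≤ N) (h1 : |m₁| ≤ N) (e : Plane) :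
    |m₀ * e 0 + m₁ * e 1| ≤ 2 * N * ‖e‖ := by
  have a0 := abs_coord_le e 0
  have a1 := abs_coord_le e 1
  have := mul_le_mul h0 a0 (abs_nonneg _) ((abs_nonneg _).trans h0)
  have := mul_le_mul h1 a1 (abs_nonneg _) ((abs_nonneg _).trans h1)
  refine (abs_add_le _ _).trans ?_
  rw [abs_mul, abs_mul]; linarith

lemma moll_lipschitz (n : ℕ) {Ω : Set Plane} (hΩ : MeasurableSet Ω) {v : Plane → ℝ}
    {g : Fin 2 → Plane → ℝ} {N : ℝ} (hN : 0 ≤ N) (hv : IntegrableOn v Ω)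
    (h : ∀ j, HasWeakPartial Ω j v (g j))
    (hg : ∀ j, ∀ᵐ x ∂volume.restrict Ω, |g j x| ≤ N) {S : Set Plane} (hS : Convex ℝ S)
    (hx : ∀ x ∈ S, Metric.closedBall x (bump n).rOut ⊆ Ω) {a b : Plane} (ha : a ∈ S)
    (hb : b ∈ S) : |moll n Ω v b - moll n Ω v a| ≤ 2 * N * ‖b - a‖ := by
  choose! F hF he using fun x hx' => moll_hasFDerivAt_weak n hΩ hv h (hx x hx')
  refine hS.norm_image_sub_le_of_norm_hasFDerivWithin_le (𝕜 := ℝ) (f' := F)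
    (fun x hx => (hF x hx).hasFDerivWithinAt) (fun x hx => ?_) ha hb
  refine ContinuousLinearMap.opNorm_le_bound _ (by positivity) fun e => ?_
  rw [he x hx, Real.norm_eq_abs]
  exact abs_two_mul_le (abs_moll_le n (hg 0) hN x) (abs_moll_le n (hg 1) hN x) e

lemma moll_taylor (n : ℕ) {Ω : Set Plane} (hΩ : MeasurableSet Ω) {u : Plane → ℝ}
    {G : Fin 2 → Plane → ℝ} {H : Fin 2 → Fin 2 → Plane → ℝ} {N : ℝ} (hN : 0 ≤ N)
    (hu : IntegrableOn u Ω) (hGi : ∀ j, IntegrableOn (G j) Ω)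
    (hG : ∀ j, HasWeakPartial Ω j u (G j))
    (hH : ∀ j k, HasWeakPartial Ω k (G j) (H j k))
    (bH : ∀ j k, ∀ᵐ x ∂volume.restrict Ω, |H j k x| ≤ N) {a b : Plane}
    (hx : ∀ x ∈ segment ℝ a b, Metric.closedBall x (bump n).rOut ⊆ Ω) :
    |moll n Ω u b - moll n Ω u a - (moll n Ω (G 0) a * (b 0 - a 0) +
      moll n Ω (G 1) a * (b 1 - a 1))| ≤ 4 * N * ‖b - a‖ ^ 2 := by
  choose! F hF he using fun x hx' => moll_hasFDerivAt_weak n hΩ hu hG (hx x hx')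
  have ha := left_mem_segment ℝ a b
  -- Subtracting the linear map `F a` leaves a function whose derivative `F x - F a` is `O(‖b - a‖)`
  -- on the segment, so the mean value inequality gives a second order bound.
  have key := (convex_segment a b).norm_image_sub_le_of_norm_hasFDerivWithin_le (𝕜 := ℝ)
    (f := fun x => moll n Ω u x - F a x) (f' := fun x => F x - F a)
    (C := 4 * N * ‖b - a‖)
    (fun x hx => ((hF x hx).sub (F a).hasFDerivAt).hasFDerivWithinAt) (fun x hx' => ?_)
    ha (right_mem_segment ℝ a b)
  · have e : moll n Ω u b - F a b - (moll n Ω u a - F a a) =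
      moll n Ω u b - moll n Ω u a - (moll n Ω (G 0) a * (b 0 - a 0) +
      moll n Ω (G 1) a * (b 1 - a 1)) := by
      rw [he a ha, he a ha]; ring
    rw [← e]
    calc _ ≤ _ := key
      _ = _ := by ring
  · refine ContinuousLinearMap.opNorm_le_bound _ (by positivity) fun e => ?_
    have hxa : ‖x - a‖ ≤ ‖b - a‖ := norm_sub_le_of_mem_segment hx'
    have l : ∀ j, |moll n Ω (G j) x - moll n Ω (G j) a| ≤ 2 * N * ‖b - a‖ := fun j =>
      (moll_lipschitz n hΩ hN (hGi j) (hH j) (bH j) (convex_segment a b) hx ha hx').trans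
        (by gcongr)
    rw [sub_apply, he x hx', he a ha, Real.norm_eq_abs]
    have := abs_two_mul_le (l 0) (l 1) e
    calc _ = _ := by congr 1; ring
      _ ≤ _ := this
      _ = _ := by ring

/-! ### Pointwise gradients for functions with bounded second weak derivatives -/

/-- A function with bounded first and second weak derivatives has a gradient field which is bounded
and Lipschitz continuous along segments, with second order Taylor bounds. -/
theorem exists_gradient {Ω : Set Plane} (hΩ : IsOpen Ω) (hbdd : Bornology.IsBounded Ω)
    {u : Plane → ℝ} {G : Fin 2 → Plane → ℝ} {H : Fin 2 → Fin 2 → Plane → ℝ} {N : ℝ}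
    (hN : 0 ≤ N) (hu : ContinuousOn u (closure Ω)) (hG : ∀ j, HasWeakPartial Ω j u (G j))
    (hH : ∀ j k, HasWeakPartial Ω k (G j) (H j k)) (hGi : ∀ j, IntegrableOn (G j) Ω)
    (bG : ∀ j, ∀ᵐ x ∂volume.restrict Ω, |G j x| ≤ N)
    (bH : ∀ j k, ∀ᵐ x ∂volume.restrict Ω, |H j k x| ≤ N) :
    ∃ g : Fin 2 → Plane → ℝ, (∀ j a, |g j a| ≤ N) ∧ ∀ a b, segment ℝ a b ⊆ Ω →
      (∀ j, |g j b - g j a| ≤ 2 * N * ‖b - a‖) ∧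
      |u b - u a - (g 0 a * (b 0 - a 0) + g 1 a * (b 1 - a 1))| ≤ 4 * N * ‖b - a‖ ^ 2 := by
  have hui : IntegrableOn u Ω :=
    (hu.integrableOn_compact (hbdd.isCompact_closure)).mono_set subset_closure
  -- The weak gradient is only defined almost everywhere. Its mollifications are bounded by `N` at
  -- every point, so they converge along an ultrafilter, simultaneously at all points and without
  -- passing to subsequences.
  have hlim : ∀ j a, ∃ l ∈ Icc (-N) N,
      Tendsto (fun n => moll n Ω (G j) a) (hyperfilter ℕ) (𝓝 l) := by
    intro j a
    refine isCompact_iff_ultrafilter_le_nhds.1 (isCompact_Icc (a := -N) (b := N))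
      ((hyperfilter ℕ).map fun n => moll n Ω (G j) a) ?_
    rw [le_principal_iff]
    exact Filter.mem_map.2 (Filter.univ_mem' fun n => abs_le.1 (abs_moll_le n (bG j) hN a))
  choose g hg hgl using hlim
  refine ⟨g, fun j a => abs_le.2 (hg j a), fun a b hab => ?_⟩
  -- A whole neighbourhood of the compact segment lies in `Ω`, so the mollified estimates hold along
  -- it once the kernel radius is below `δ`.
  obtain ⟨δ, hδ, hδΩ⟩ := (show IsCompact (segment ℝ a b) by
    rw [segment_eq_image']
    exact isCompact_Icc.image (by fun_prop)).exists_cthickening_subset_open hΩ hab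
  have hev : ∀ᶠ n in (hyperfilter ℕ : Filter ℕ), ∀ x ∈ segment ℝ a b,
      Metric.closedBall x (bump n).rOut ⊆ Ω := by
    apply Nat.hyperfilter_le_atTop
    filter_upwards [tendsto_rOut_bump.eventually_lt_const hδ] with n hn x hx
    exact ((Metric.closedBall_subset_closedBall hn.le).trans
      (Metric.closedBall_subset_cthickening hx δ)).trans hδΩ
  have hm := hΩ.measurableSet
  constructor
  · intro j
    refine le_of_tendsto ((hgl j b).sub (hgl j a)).abs ?_
    filter_upwards [hev] with n hn
    exact moll_lipschitz n hm hN (hGi j) (hH j) (bH j) (convex_segment a b) hn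
      (left_mem_segment ℝ a b) (right_mem_segment ℝ a b)
  · have hu' : ∀ x ∈ Ω, Tendsto (fun n => moll n Ω u x) (hyperfilter ℕ) (𝓝 (u x)) :=
      fun x hx => (tendsto_moll hΩ hui (hu.mono subset_closure) hx).mono_left
        Nat.hyperfilter_le_atTop
    refine le_of_tendsto (((hu' b (hab (right_mem_segment ℝ a b))).sub
      (hu' a (hab (left_mem_segment ℝ a b)))).sub (((hgl 0 a).mul_const _).add
      ((hgl 1 a).mul_const _))).abs ?_
    filter_upwards [hev] with n hn
    exact moll_taylor n hm hN hui hGi hG hH bH hn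

lemma ae_abs_le_toReal {Ω : Set Plane} {f : Plane → ℝ} {X : ℝ≥0∞} (hX : X ≠ ⊤)
    (h : eLpNorm f ⊤ (volume.restrict Ω) ≤ X) : ∀ᵐ x ∂volume.restrict Ω, |f x| ≤ X.toReal := by
  filter_upwards [ae_le_eLpNormEssSup (f := f) (μ := volume.restrict Ω)] with x hx
  rw [eLpNorm_exponent_top] at h
  have := ENNReal.toReal_mono hX (hx.trans h)
  simpa using this

lemma normW1Infty_nonneg (Ω : Set Plane) (G : Fin 2 → Fin 2 → Plane → ℝ)
    (H : Fin 2 → Fin 2 → Fin 2 → Plane → ℝ) : 0 ≤ normW1Infty Ω G H := ENNReal.toReal_nonneg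

lemma iSup_fin_lt_top {n : ℕ} {f : Fin n → ℝ≥0∞} (h : ∀ i, f i < ⊤) : ⨆ i, f i < ⊤ := by
  rw [← Finset.sup_univ_eq_iSup, Finset.sup_lt_iff (by simp)]
  exact fun i _ => h i

/-- The Jacobian matrix of a vector field of class `W^{2,∞}`. -/
theorem IsW2Infty.exists_jacobian {Ω : Set Plane} (hΩ : IsOpen Ω)
    (hbdd : Bornology.IsBounded Ω) {p : Plane → Plane} {G : Fin 2 → Fin 2 → Plane → ℝ}
    {H : Fin 2 → Fin 2 → Fin 2 → Plane → ℝ} (hp : IsW2Infty Ω p G H) :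
    ∃ g : Fin 2 → Fin 2 → Plane → ℝ, (∀ i j a, |g i j a| ≤ normW1Infty Ω G H) ∧
      ∀ a b, segment ℝ a b ⊆ Ω → (∀ i j, |g i j b - g i j a| ≤
        2 * normW1Infty Ω G H * ‖b - a‖) ∧
      ∀ i, |p b i - p a i - (g i 0 a * (b 0 - a 0) + g i 1 a * (b 1 - a 1))| ≤
        4 * normW1Infty Ω G H * ‖b - a‖ ^ 2 := by
  set X := ⨆ i, ⨆ j, max (eLpNorm (G i j) ⊤ (volume.restrict Ω))
    (⨆ k, eLpNorm (H i j k) ⊤ (volume.restrict Ω)) with hX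
  have hXt : X ≠ ⊤ := by
    rw [← lt_top_iff_ne_top]
    exact iSup_fin_lt_top fun i => iSup_fin_lt_top fun j => max_lt (hp.memLp_grad i j).2
      (iSup_fin_lt_top fun k => (hp.memLp_hess i j k).2)
  have bG : ∀ i j, ∀ᵐ x ∂volume.restrict Ω, |G i j x| ≤ normW1Infty Ω G H := fun i j =>
    ae_abs_le_toReal hXt ((le_max_left _ _).trans (le_iSup₂_of_le i j le_rfl))
  have bH : ∀ i j k, ∀ᵐ x ∂volume.restrict Ω, |H i j k x| ≤ normW1Infty Ω G H := fun i j k =>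
    ae_abs_le_toReal hXt (((le_iSup (fun k => eLpNorm (H i j k) ⊤ (volume.restrict Ω)) k).trans
      (le_max_right _ _)).trans (le_iSup₂_of_le i j le_rfl))
  have : IsFiniteMeasure (volume.restrict Ω) :=
    ⟨by rw [Measure.restrict_apply_univ]; exact hbdd.measure_lt_top⟩
  have key := fun i => exists_gradient hΩ hbdd (normW1Infty_nonneg Ω G H)
    (u := fun x => p x i) (by have := hp.continuousOn; fun_prop)
    (hp.weak_grad i) (hp.weak_hess i) (fun j => (hp.memLp_grad i j).integrable le_top) (bG i) (bH i)
  choose g hg1 hg2 using key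
  exact ⟨g, hg1, fun a b hab => ⟨fun i => (hg2 i a b hab).1, fun i => (hg2 i a b hab).2⟩⟩

open scoped Classical

/-! ### Geometry of triangulations -/

lemma exists_cr_ne_zero {a b : Plane} (h : a ≠ b) : ∃ z, cr a b z ≠ 0 := by
  refine ⟨!₂[a 0 - (b 1 - a 1), a 1 + (b 0 - a 0)], fun h0 => h ?_⟩
  simp [cr] at h0
  have h1 : b 0 - a 0 = 0 := by nlinarith [sq_nonneg (b 0 - a 0), sq_nonneg (b 1 - a 1)]
  have h2 : b 1 - a 1 = 0 := by nlinarith [sq_nonneg (b 0 - a 0), sq_nonneg (b 1 - a 1)]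
  exact plane_ext (by linarith) (by linarith)

/-- If the area vanished, `barycentric_smul` would be an affine dependence of `a`, `b`, `c`, with a
nonzero weight at `c` as soon as `z` is off the line `a b`. -/
lemma cr_ne_zero_of_affineIndependent {a b c : Plane} (hab : a ≠ b)
    (h : AffineIndependent ℝ ![a, b, c]) : cr a b c ≠ 0 := by
  intro h0
  obtain ⟨z, hz⟩ := exists_cr_ne_zero hab
  rw [affineIndependent_iff] at h
  have := h Finset.univ ![cr b c z, cr c a z, cr a b z] ?_ ?_ 2 (Finset.mem_univ _)
  · exact hz (by simpa using this)
  · simp [Fin.sum_univ_three, cr_sum, h0]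
  · have := barycentric_smul a b c z
    rw [h0, zero_smul] at this
    simp [Fin.sum_univ_three, ← this]

lemma injective_triple {α : Type*} {a b c : α} (hab : a ≠ b) (hac : a ≠ c) (hbc : b ≠ c) :
    Function.Injective ![a, b, c] := by
  intro i j hij
  fin_cases i <;> fin_cases j <;> first | rfl | skip
  · exact absurd hij hab
  · exact absurd hij hac
  · exact absurd hij hab.symm
  · exact absurd hij hbc
  · exact absurd hij hac.symm
  · exact absurd hij hbc.symm

lemma affineIndependent_of_mem {V : Type*} [AddCommGroup V] [Module ℝ V] {t : Finset V}
    (hi : AffineIndependent ℝ ((↑) : t → V)) {q : Fin 3 → V} (hq : Function.Injective q)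
    (hm : ∀ i, q i ∈ t) : AffineIndependent ℝ q := by
  let e : Fin 3 ↪ t := ⟨fun i => ⟨q i, hm i⟩, fun i j hij => hq (congrArg Subtype.val hij)⟩
  exact hi.comp_embedding e

lemma Ccw.ne {a b c : Plane} (h : Ccw a b c) : a ≠ b ∧ b ≠ c ∧ c ≠ a := by
  rw [ccw_iff] at h
  refine ⟨?_, ?_, ?_⟩ <;> rintro rfl <;> simp [cr] at h
  linarith [mul_comm (b 0 - a 0) (b 1 - a 1)]

lemma Ccw.rotate {a b c : Plane} (h : Ccw a b c) : Ccw b c a := by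
  rw [ccw_iff] at *; rwa [cr_rotate]

lemma hull_triple {a b c : Plane} (h : Ccw a b c) : hull {a, b, c} = ctri a b c := by
  rw [← convexHull_triple_eq h, hull]; simp

/-- If `z` were on the line `a b`, moving it slightly away from `c` would make `cr a b` negative and
so leave the triangle. -/
lemma interior_ctri_subset {a b c z : Plane} (h : Ccw a b c) (hz : z ∈ interior (ctri a b c)) :
    0 < cr a b z := by
  have hz0 := (interior_subset hz).2.2
  refine lt_of_le_of_ne hz0 fun h0 => ?_
  have h1 : Tendsto (fun ε : ℝ => z + ε • (z - c)) (𝓝[>] 0) (𝓝 z) := by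
    have : Continuous fun ε : ℝ => z + ε • (z - c) := by fun_prop
    simpa using this.tendsto 0 |>.mono_left nhdsWithin_le_nhds
  obtain ⟨ε, hε, hε0⟩ := ((h1.eventually_mem (mem_interior_iff_mem_nhds.1 hz)).and
    self_mem_nhdsWithin).exists
  have h2 := hε.2.2
  have e : cr a b (z + ε • (z - c)) = (1 + ε) * cr a b z - ε * cr a b c := by
    simp [cr]; ring
  rw [e, ← h0] at h2
  have := mul_pos (show 0 < ε from hε0) h
  rw [ccw_iff] at h
  nlinarith

lemma interior_ctri {a b c : Plane} (h : Ccw a b c) : interior (ctri a b c) = otri a b c := by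
  apply Subset.antisymm
  · intro z hz
    refine ⟨interior_ctri_subset h.rotate ?_, interior_ctri_subset h.rotate.rotate ?_,
      interior_ctri_subset h hz⟩
    · rwa [ctri_rotate]
    · rwa [ctri_rotate, ctri_rotate]
  · exact interior_maximal (otri_subset_ctri a b c) (isOpen_otri a b c)

lemma cr_eq_zero_of_mem_segment {a b z : Plane} (h : z ∈ segment ℝ a b) : cr a b z = 0 := by
  rw [segment_eq_image'] at h
  obtain ⟨t, _, rfl⟩ := h
  simp [cr]; ring

lemma mem_segment_of_subset {s : Finset Plane} {a b z : Plane} (hs : (s : Set Plane) ⊆ {a, b})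
    (hz : z ∈ convexHull ℝ (s : Set Plane)) : z ∈ segment ℝ a b := by
  rw [← convexHull_pair]; exact convexHull_mono hs hz

/-! ### Flags, edges and conformity -/

namespace Triangulation

variable {Ω : Set Plane} (T : Triangulation Ω)

lemma mem_triangles {t : Finset Plane} :
    t ∈ T.triangles ↔ t ∈ T.complex.faces ∧ t.card = 3 := by
  simp [triangles]

lemma exists_ccw {t : Finset Plane} (ht : t ∈ T.triangles) :
    ∃ a b c, t = {a, b, c} ∧ Ccw a b c := by
  obtain ⟨hf, hc⟩ := T.mem_triangles.1 ht
  obtain ⟨a, b, c, hab, hac, hbc, rfl⟩ := Finset.card_eq_three.1 hc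
  have hi := T.complex.indep hf
  have hm : ∀ i, ![a, b, c] i ∈ ({a, b, c} : Finset Plane) := by
    intro i; fin_cases i <;> simp
  have h4 : AffineIndependent ℝ ![a, b, c] := 
    affineIndependent_of_mem hi (injective_triple hab hac hbc) hm
  rcases (cr_ne_zero_of_affineIndependent hab h4).lt_or_gt with h | h
  · refine ⟨b, a, c, Finset.insert_comm _ _ _, ?_⟩
    rw [ccw_iff, cr_swap]; linarith
  · exact ⟨a, b, c, rfl, h⟩

/-- The vertices of a triangulation. -/
def verts : Finset Plane := T.triangles.biUnion id

/-- The triangles with a distinguished edge, oriented counterclockwise: `(u, v, c)` stands for the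
edge from `u` to `v` of the triangle `u v c`. -/
def flags : Finset (Plane × Plane × Plane) :=
  (T.verts ×ˢ T.verts ×ˢ T.verts).filter fun f =>
    ({f.1, f.2.1, f.2.2} : Finset Plane) ∈ T.triangles ∧ Ccw f.1 f.2.1 f.2.2

lemma mem_flags {u v c : Plane} :
    (u, v, c) ∈ T.flags ↔ ({u, v, c} : Finset Plane) ∈ T.triangles ∧ Ccw u v c := by
  simp only [flags, Finset.mem_filter, Finset.mem_product, and_iff_right_iff_imp]
  intro h
  have : ∀ x ∈ ({u, v, c} : Finset Plane), x ∈ T.verts := fun x hx =>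
    Finset.mem_biUnion.2 ⟨_, h.1, hx⟩
  exact ⟨this u (by simp), this v (by simp), this c (by simp)⟩

lemma flag_rotate {u v c : Plane} (h : (u, v, c) ∈ T.flags) : (v, c, u) ∈ T.flags := by
  rw [mem_flags] at *
  refine ⟨?_, h.2.rotate⟩
  convert h.1 using 1
  ext; simp; tauto

/-- Two triangles on the same side of `u v` overlap near the midpoint of that edge. If `c ≠ c'`,
conformity forces the overlap into the edge itself, yet it contains points with `cr u v z > 0`. -/
lemma flag_opposite_unique {u v c c' : Plane} (h : (u, v, c) ∈ T.flags)
    (h' : (u, v, c') ∈ T.flags) : c = c' := by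
  rw [mem_flags] at *
  obtain ⟨ht, hD⟩ := h
  obtain ⟨ht', hD'⟩ := h'
  by_contra hne
  have hD0 := hD
  have hD0' := hD'
  rw [ccw_iff] at hD hD'
  set B := cr v c' c
  set B' := cr c' u c
  set A := cr u v c' / 2
  have hA : 0 < A := by positivity
  set S := A + |B| + |B'| + 1
  have hS : 0 < S := by positivity
  -- With this choice `(1 - ε) * A = ε * (|B| + |B'| + 1)`, so the term from near the midpoint
  -- outweighs the possibly negative `ε * B` and `ε * B'`.
  set ε := A / S
  have hε : 0 < ε := by positivity
  have h1ε : 1 - ε = (|B| + |B'| + 1) / S := by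
    simp only [ε]; field_simp; simp only [S]; ring
  set z : Plane := ((1 - ε) / 2) • u + ((1 - ε) / 2) • v + ε • c with hz
  have e1 : cr v c z = (1 - ε) / 2 * cr u v c := by simp [hz, cr]; ring
  have e2 : cr c u z = (1 - ε) / 2 * cr u v c := by simp [hz, cr]; ring
  have e3 : cr u v z = ε * cr u v c := by simp [hz, cr]; ring
  have f1 : cr v c' z = (1 - ε) * A + ε * B := by simp [hz, cr, A, B]; ring
  have f2 : cr c' u z = (1 - ε) * A + ε * B' := by simp [hz, cr, A, B']; ring
  have hp : 0 ≤ 1 - ε := by rw [h1ε]; positivity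
  have hm : z ∈ hull {u, v, c} := by
    rw [hull_triple hD0]
    refine ⟨by rw [e1]; positivity, by rw [e2]; positivity, by rw [e3]; positivity⟩
  have key : ∀ b : ℝ, |b| ≤ |B| + |B'| → 0 ≤ (1 - ε) * A + ε * b := by
    intro b hb
    have : (1 - ε) * A + ε * b = A / S * (|B| + |B'| + 1 + b) := by
      rw [h1ε]; simp only [ε]; ring
    rw [this]
    have := neg_abs_le b
    apply mul_nonneg hε.le; linarith
  have hm' : z ∈ hull {u, v, c'} := by
    rw [hull_triple hD0']
    refine ⟨?_, ?_, by rw [e3]; positivity⟩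
    · rw [f1]; exact key B (by linarith [abs_nonneg B'])
    · rw [f2]; exact key B' (by linarith [abs_nonneg B])
  have hi := T.complex.inter_subset_convexHull (T.mem_triangles.1 ht).1
    (T.mem_triangles.1 ht').1 ⟨hm, hm'⟩
  have hs : z ∈ segment ℝ u v := by
    rw [← convexHull_pair]
    refine convexHull_mono ?_ hi
    rintro x ⟨hx, hx'⟩
    simp at hx hx' ⊢
    obtain ⟨_, h2, h3⟩ := hD0.ne
    rcases hx with rfl | rfl | rfl
    · simp
    · simp
    · rcases hx' with h | h | h
      · exact absurd h h3
      · exact absurd h.symm h2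
      · exact absurd h hne
  rw [cr_eq_zero_of_mem_segment hs] at e3
  have := mul_pos hε hD
  linarith

lemma pair_mem_edges {u v c : Plane} (h : (u, v, c) ∈ T.flags) :
    ({u, v} : Finset Plane) ∈ T.edges := by
  rw [mem_flags] at h
  simp only [edges, Finset.mem_filter, Set.Finite.mem_toFinset]
  refine ⟨T.complex.down_closed (T.mem_triangles.1 h.1).1 ?_ (by simp),
    Finset.card_pair h.2.ne.1⟩
  intro x; simp; tauto

lemma mem_adjacent {t e : Finset Plane} : t ∈ T.adjacent e ↔ t ∈ T.triangles ∧ e ⊆ t := by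
  simp [adjacent]

lemma exists_flag_of_subset {t : Finset Plane} (ht : t ∈ T.triangles) {u v : Plane} (huv : u ≠ v)
    (hu : u ∈ t) (hv : v ∈ t) : ∃ c, ((u, v, c) ∈ T.flags ∧ t = {u, v, c}) ∨
      ((v, u, c) ∈ T.flags ∧ t = {v, u, c}) := by
  obtain ⟨a, b, c, rfl, h⟩ := T.exists_ccw ht
  have h1 : (a, b, c) ∈ T.flags := T.mem_flags.2 ⟨ht, h⟩
  have h2 := T.flag_rotate h1
  have h3 := T.flag_rotate h2
  have e2 : ({a, b, c} : Finset Plane) = {b, c, a} := by ext; simp; tauto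
  have e3 : ({a, b, c} : Finset Plane) = {c, a, b} := by ext; simp; tauto
  simp only [Finset.mem_insert, Finset.mem_singleton] at hu hv
  rcases hu with rfl | rfl | rfl <;> rcases hv with rfl | rfl | rfl
  · exact absurd rfl huv
  · exact ⟨c, .inl ⟨h1, rfl⟩⟩
  · exact ⟨b, .inr ⟨h3, e3⟩⟩
  · exact ⟨c, .inr ⟨h1, rfl⟩⟩
  · exact absurd rfl huv
  · exact ⟨a, .inl ⟨h2, e2⟩⟩
  · exact ⟨b, .inl ⟨h3, e3⟩⟩
  · exact ⟨a, .inr ⟨h2, e2⟩⟩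
  · exact absurd rfl huv

/-- By `flag_opposite_unique` each orientation of an edge is taken by at most one triangle. Hence an
edge lies in two triangles exactly when both orientations occur, which makes `card = 2` and `card =
1` statements about flags. -/
lemma adjacent_of_opposite {u v c c' : Plane} (h : (u, v, c) ∈ T.flags)
    (h' : (v, u, c') ∈ T.flags) : T.adjacent {u, v} = {{u, v, c}, {v, u, c'}} ∧
      ({u, v, c} : Finset Plane) ≠ {v, u, c'} ∧ c ≠ c' := by
  have hf := T.mem_flags.1 h
  have hf' := T.mem_flags.1 h'
  have hne : c ≠ c' := by
    rintro rfl
    have h1 := hf.2; have h2 := hf'.2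
    rw [ccw_iff] at h1 h2
    rw [cr_swap] at h2; linarith
  refine ⟨?_, fun h0 => ?_, hne⟩
  · ext t
    simp only [mem_adjacent, Finset.mem_insert, Finset.mem_singleton]
    constructor
    · rintro ⟨ht, hs⟩
      obtain ⟨d, ⟨hd, rfl⟩ | ⟨hd, rfl⟩⟩ := T.exists_flag_of_subset ht hf.2.ne.1
        (hs (by simp)) (hs (by simp))
      · left; rw [T.flag_opposite_unique h hd]
      · right; rw [T.flag_opposite_unique h' hd]
    · rintro (rfl | rfl)
      · exact ⟨hf.1, by intro x; simp; tauto⟩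
      · exact ⟨hf'.1, by intro x; simp; tauto⟩
  · have : c ∈ ({v, u, c'} : Finset Plane) := h0 ▸ (by simp)
    obtain ⟨_, h2, h3⟩ := hf.2.ne
    simp at this
    rcases this with h | h | h
    · exact h2 h.symm
    · exact h3 h
    · exact hne h

lemma adjacent_of_not_opposite {u v c : Plane} (h : (u, v, c) ∈ T.flags)
    (h' : ∀ c', (v, u, c') ∉ T.flags) : T.adjacent {u, v} = {{u, v, c}} := by
  have hf := T.mem_flags.1 h
  ext t
  simp only [mem_adjacent, Finset.mem_singleton]
  constructor
  · rintro ⟨ht, hs⟩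
    obtain ⟨d, ⟨hd, rfl⟩ | ⟨hd, rfl⟩⟩ := T.exists_flag_of_subset ht hf.2.ne.1
      (hs (by simp)) (hs (by simp))
    · rw [T.flag_opposite_unique h hd]
    · exact absurd hd (h' d)
  · rintro rfl
    exact ⟨hf.1, by intro x; simp; tauto⟩

lemma mem_interiorEdges_iff {u v c : Plane} (h : (u, v, c) ∈ T.flags) :
    ({u, v} : Finset Plane) ∈ T.interiorEdges ↔ ∃ c', (v, u, c') ∈ T.flags := by
  simp only [interiorEdges, Finset.mem_filter, T.pair_mem_edges h, true_and]
  constructor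
  · intro h2
    by_contra! h0
    rw [T.adjacent_of_not_opposite h h0] at h2; simp at h2
  · rintro ⟨c', h'⟩
    obtain ⟨h1, h2, _⟩ := T.adjacent_of_opposite h h'
    rw [h1, Finset.card_pair h2]

lemma mem_boundaryEdges_iff {u v c : Plane} (h : (u, v, c) ∈ T.flags) :
    ({u, v} : Finset Plane) ∈ T.boundaryEdges ↔ ∀ c', (v, u, c') ∉ T.flags := by
  simp only [boundaryEdges, Finset.mem_filter, T.pair_mem_edges h, true_and]
  constructor
  · rintro h2 c' h'
    obtain ⟨h1, h3, _⟩ := T.adjacent_of_opposite h h'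
    rw [h1, Finset.card_pair h3] at h2; simp at h2
  · intro h'
    rw [T.adjacent_of_not_opposite h h']; simp

lemma exists_flag_of_boundaryEdge {e : Finset Plane} (he : e ∈ T.boundaryEdges) :
    ∃ u v c, (u, v, c) ∈ T.flags ∧ e = {u, v} := by
  simp only [boundaryEdges, edges, Finset.mem_filter] at he
  obtain ⟨⟨_, h2⟩, h1⟩ := he
  obtain ⟨u, v, huv, rfl⟩ := Finset.card_eq_two.1 h2
  obtain ⟨t, ht⟩ := Finset.card_pos.1 (h1 ▸ one_pos)
  rw [mem_adjacent] at ht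
  obtain ⟨c, ⟨h, _⟩ | ⟨h, _⟩⟩ := T.exists_flag_of_subset ht.1 huv (ht.2 (by simp))
    (ht.2 (by simp))
  · exact ⟨u, v, c, h, rfl⟩
  · exact ⟨v, u, c, h, Finset.pair_comm _ _⟩

lemma closure_eq : closure Ω = ⋃ t ∈ T.triangles, hull t := by
  rw [← T.space_eq]
  ext x
  simp only [Geometry.SimplicialComplex.mem_space_iff, mem_iUnion, exists_prop]
  constructor
  · rintro ⟨s, hs, hx⟩
    obtain ⟨t, ht, hst, hc⟩ := T.pure s hs
    exact ⟨t, T.mem_triangles.2 ⟨ht, hc⟩, convexHull_mono (by exact_mod_cast hst) hx⟩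
  · rintro ⟨t, ht, hx⟩
    exact ⟨t, (T.mem_triangles.1 ht).1, hx⟩

/-- Some vertex of `t` is missing from `t'`, so by conformity a common point lies on the opposite
edge of `t`, where one barycentric coordinate vanishes. -/
lemma disjoint_interior {t t' : Finset Plane} (ht : t ∈ T.triangles) (ht' : t' ∈ T.triangles)
    (hne : t ≠ t') : Disjoint (interior (hull t)) (hull t') := by
  rw [Set.disjoint_left]
  intro z hz hz'
  have hc : ¬ t ⊆ t' := fun h => hne (Finset.eq_of_subset_of_card_le h
    (by rw [(T.mem_triangles.1 ht).2, (T.mem_triangles.1 ht').2]))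
  have hi := T.complex.inter_subset_convexHull (T.mem_triangles.1 ht).1
    (T.mem_triangles.1 ht').1 ⟨interior_subset hz, hz'⟩
  obtain ⟨a, b, c, rfl, h⟩ := T.exists_ccw ht
  rw [hull_triple h, interior_ctri h] at hz
  rw [← Finset.coe_inter] at hi
  have hcases : a ∉ t' ∨ b ∉ t' ∨ c ∉ t' := by
    by_contra! h0
    apply hc; intro x; simp; rintro (rfl | rfl | rfl) <;> tauto
  rcases hcases with hc | hc | hc
  · have : z ∈ segment ℝ b c := mem_segment_of_subset (by
      intro x hx; simp at hx ⊢; rcases hx with ⟨rfl | rfl | rfl, h⟩ <;> tauto) hi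
    exact hz.1.ne' (cr_eq_zero_of_mem_segment this)
  · have : z ∈ segment ℝ c a := mem_segment_of_subset (by
      intro x hx; simp at hx ⊢; rcases hx with ⟨rfl | rfl | rfl, h⟩ <;> tauto) hi
    exact hz.2.1.ne' (cr_eq_zero_of_mem_segment this)
  · have : z ∈ segment ℝ a b := mem_segment_of_subset (by
      intro x hx; simp at hx ⊢; rcases hx with ⟨rfl | rfl | rfl, h⟩ <;> tauto) hi
    exact hz.2.2.ne' (cr_eq_zero_of_mem_segment this)

lemma hull_subset_closure {t : Finset Plane} (ht : t ∈ T.triangles) : hull t ⊆ closure Ω := by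
  rw [T.closure_eq]; exact subset_biUnion_of_mem (u := fun t => hull t) ht

end Triangulation

/-! ### Lipschitz domains, boundary vertices and coverings of the frontier -/

/-- Arbitrarily close to a boundary point there are points strictly below the local graph, and these
have neighbourhoods free of `Ω`. This excludes slits, and so puts the open triangles inside `Ω`. -/
lemma interior_closure_of_lipschitz {Ω : Set Plane} (hopen : IsOpen Ω)
    (hlip : HasLipschitzBoundary Ω) : interior (closure Ω) = Ω := by
  refine Subset.antisymm (fun x hx => ?_) (interior_maximal subset_closure hopen)
  by_contra hxΩ
  obtain ⟨φ, f, L, r, hr, hf, h⟩ := hlip x (by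
    rw [hopen.frontier_eq]; exact ⟨interior_subset hx, hxΩ⟩)
  set e : Plane := φ.symm (EuclideanSpace.single 1 1)
  have hφ : ∀ t : ℝ, φ (x + t • e) = φ x + t • EuclideanSpace.single 1 1 := by
    intro t; simp [e]
  have hx' : φ x 1 ≤ f (φ x 0) := not_lt.1 fun h0 => hxΩ ((h x (Metric.mem_ball_self hr)).2 h0)
  have h1 : Tendsto (fun t : ℝ => x + t • e) (𝓝[<] 0) (𝓝 x) := by
    have : Continuous fun t : ℝ => x + t • e := by fun_prop
    simpa using this.tendsto 0 |>.mono_left nhdsWithin_le_nhds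
  obtain ⟨t, ⟨ht1, ht2⟩, ht0⟩ := ((h1.eventually_mem (inter_mem (mem_interior_iff_mem_nhds.1 hx)
    (Metric.ball_mem_nhds x hr))).and self_mem_nhdsWithin).exists
  -- near `x + t • e` there are no points of `Ω`
  have hV : IsOpen {y : Plane | φ y 1 < f (φ y 0)} := by
    have := hf.continuous
    have h2 : Continuous φ := φ.continuous
    exact isOpen_lt (by fun_prop) (by fun_prop)
  have hmem : x + t • e ∈ {y : Plane | φ y 1 < f (φ y 0)} := by
    have ht0' : t < 0 := ht0
    simp only [mem_ofPred_eq, hφ]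
    simp
    linarith
  obtain ⟨y, ⟨hy1, hy2⟩, hyΩ⟩ := mem_closure_iff.1 ht1 _ (hV.inter Metric.isOpen_ball) ⟨hmem, ht2⟩
  exact lt_asymm hy1 ((h y hy2).1 hyΩ)

namespace Triangulation

variable {Ω : Set Plane} (T : Triangulation Ω)

lemma isCompact_hull (t : Finset Plane) : IsCompact (hull t) :=
  Set.Finite.isCompact_convexHull (𝕜 := ℝ) t.finite_toSet

lemma interior_hull_subset (hΩ : interior (closure Ω) = Ω) {t : Finset Plane}
    (ht : t ∈ T.triangles) : interior (hull t) ⊆ Ω := by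
  rw [← hΩ]; exact interior_mono (T.hull_subset_closure ht)

/-- A boundary edge has a triangle on one side only, so a point inside the edge pushed across it,
away from `c`, leaves all triangles and thus `closure Ω`. As `Ω` is open, neither such edge points
nor, in the limit, the end points can belong to it. -/
lemma boundaryVertices_subset_frontier (hopen : IsOpen Ω) :
    (T.boundaryVertices : Set Plane) ⊆ frontier Ω := by
  intro x hx
  rw [boundaryVertices, Finset.mem_coe, Finset.mem_biUnion] at hx
  obtain ⟨e, he, hxe⟩ := hx
  obtain ⟨u, v, c, hf, rfl⟩ := T.exists_flag_of_boundaryEdge he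
  have had := T.adjacent_of_not_opposite hf ((T.mem_boundaryEdges_iff hf).1 he)
  obtain ⟨ht, hD⟩ := T.mem_flags.1 hf
  have huv : segment ℝ u v ⊆ hull {u, v, c} := by
    rw [← convexHull_pair]
    apply convexHull_mono; intro y; simp; tauto
  -- points in the relative interior of the edge are not in `Ω`
  have key : ∀ z ∈ segment ℝ u v, z ≠ u → z ≠ v → z ∉ Ω := by
    intro z hz hzu hzv hzΩ
    -- Conformity keeps `z`, which is not an end point, away from every triangle that does not have
    -- the whole edge, and these finitely many triangles form a closed set.
    set U : Set Plane := ⋃ t ∈ T.triangles.filter (fun t => ¬ ({u, v} : Finset Plane) ⊆ t), hull t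
    have hU : IsClosed U := isClosed_biUnion_finset fun t _ => (isCompact_hull t).isClosed
    have hzU : z ∉ U := by
      intro h
      simp only [U, mem_iUnion, Finset.mem_filter, exists_prop] at h
      obtain ⟨t', ⟨ht', hns⟩, hzt'⟩ := h
      have hef : ({u, v} : Finset Plane) ∈ T.complex.faces := by
        have := T.pair_mem_edges hf
        simp only [edges, Finset.mem_filter, Set.Finite.mem_toFinset] at this
        exact this.1
      have hi := T.complex.inter_subset_convexHull hef (T.mem_triangles.1 ht').1
        ⟨by simpa [convexHull_pair] using hz, hzt'⟩
      have hsub : ∃ w, w ≠ z ∧ (({u, v} : Finset Plane) ∩ t' : Set Plane) ⊆ {w} := by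
        by_cases hu : u ∈ t'
        · have hv : v ∉ t' := fun hv => hns (by intro y; simp; rintro (rfl | rfl) <;> assumption)
          refine ⟨u, hzu.symm, ?_⟩
          rintro y ⟨hy, hy'⟩
          simp at hy hy'
          rcases hy with rfl | rfl
          · rfl
          · exact absurd hy' hv
        · refine ⟨v, hzv.symm, ?_⟩
          rintro y ⟨hy, hy'⟩
          simp at hy hy'
          rcases hy with rfl | rfl
          · exact absurd hy' hu
          · rfl
      obtain ⟨w, hw, hsub⟩ := hsub
      have := convexHull_mono hsub hi
      rw [convexHull_singleton] at this
      exact hw this.symm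
    have h1 : Tendsto (fun ε : ℝ => z + ε • (z - c)) (𝓝[>] 0) (𝓝 z) := by
      have : Continuous fun ε : ℝ => z + ε • (z - c) := by fun_prop
      simpa using this.tendsto 0 |>.mono_left nhdsWithin_le_nhds
    obtain ⟨ε, ⟨hε1, hε2⟩, hε0⟩ := ((h1.eventually_mem (inter_mem (hopen.mem_nhds hzΩ)
      (hU.isOpen_compl.mem_nhds hzU))).and self_mem_nhdsWithin).exists
    have hε : 0 < ε := hε0
    have h2 := subset_closure hε1
    rw [T.closure_eq] at h2
    simp only [mem_iUnion, exists_prop] at h2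
    obtain ⟨t', ht', hzt'⟩ := h2
    have h3 : ({u, v} : Finset Plane) ⊆ t' := by
      by_contra h
      apply hε2
      simp only [U, mem_iUnion, Finset.mem_filter, exists_prop]
      exact ⟨t', ⟨ht', h⟩, hzt'⟩
    have h4 : t' ∈ T.adjacent {u, v} := T.mem_adjacent.2 ⟨ht', h3⟩
    rw [had, Finset.mem_singleton] at h4
    rw [h4, hull_triple hD] at hzt'
    have h5 := hzt'.2.2
    have e : cr u v (z + ε • (z - c)) = (1 + ε) * cr u v z - ε * cr u v c := by
      simp [cr]; ring
    rw [e, cr_eq_zero_of_mem_segment hz] at h5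
    have := mul_pos hε hD
    rw [ccw_iff] at hD
    nlinarith
  have hcl : segment ℝ u v ⊆ closure Ω := huv.trans (T.hull_subset_closure ht)
  rw [hopen.frontier_eq]
  have hlim : ∀ a b : Plane, a ≠ b → (∀ z ∈ segment ℝ a b, z ≠ a → z ≠ b → z ∉ Ω) → a ∉ Ω := by
    intro a b hab hk ha
    have h1 : Tendsto (fun s : ℝ => a + s • (b - a)) (𝓝[>] 0) (𝓝 a) := by
      have : Continuous fun s : ℝ => a + s • (b - a) := by fun_prop
      simpa using this.tendsto 0 |>.mono_left nhdsWithin_le_nhds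
    obtain ⟨s, hs, hs0, hs1⟩ := ((h1.eventually_mem (hopen.mem_nhds ha)).and
      (Ioo_mem_nhdsGT (zero_lt_one (α := ℝ)))).exists
    refine hk _ ?_ ?_ ?_ hs
    · rw [segment_eq_image']; exact ⟨s, ⟨hs0.le, hs1.le⟩, rfl⟩
    · simp [sub_eq_zero, hs0.ne', hab.symm]
    · intro h
      have : (1 - s) • (b - a) = 0 := by
        rw [sub_smul, one_smul, sub_eq_zero, sub_eq_iff_eq_add, add_comm]; exact h.symm
      rw [smul_eq_zero, sub_eq_zero, sub_eq_zero] at this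
      rcases this with h | h
      · exact hs1.ne h.symm
      · exact hab h.symm
  have huv' := hD.ne.1
  simp at hxe
  rcases hxe with rfl | rfl
  · exact ⟨hcl (left_mem_segment ℝ _ _), hlim _ _ huv' key⟩
  · refine ⟨hcl (right_mem_segment ℝ _ _), hlim _ _ huv'.symm fun z hz h1 h2 => ?_⟩
    rw [segment_symm] at hz
    exact key z hz h2 h1

/-- The frontier of `Ω` is covered by the edges of a triangulation. -/
lemma frontier_subset (hopen : IsOpen Ω) (hΩ : interior (closure Ω) = Ω) :
    frontier Ω ⊆ ⋃ f ∈ T.flags, segment ℝ f.1 f.2.1 := by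
  intro x hx
  rw [hopen.frontier_eq] at hx
  obtain ⟨h1, h2⟩ := hx
  rw [T.closure_eq] at h1
  simp only [mem_iUnion, exists_prop] at h1
  obtain ⟨t, ht, hxt⟩ := h1
  have hxi : x ∉ interior (hull t) := fun h => h2 (T.interior_hull_subset hΩ ht h)
  obtain ⟨a, b, c, rfl, hD⟩ := T.exists_ccw ht
  rw [hull_triple hD] at hxt hxi
  rw [interior_ctri hD] at hxi
  have hf := T.mem_flags.2 ⟨ht, hD⟩
  simp only [mem_iUnion, exists_prop]
  rcases ctri_diff_otri_subset hD ⟨hxt, hxi⟩ with (h | h) | h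
  · exact ⟨_, hf, h⟩
  · exact ⟨_, T.flag_rotate hf, h⟩
  · exact ⟨_, T.flag_rotate (T.flag_rotate hf), h⟩

end Triangulation

lemma segment_cover (u v : Plane) {h : ℝ} (hh : 0 < h) (h1 : h ≤ 1) :
    ∃ S : Finset Plane, (S.card : ℝ) ≤ (‖v - u‖ + 2) / h ∧
      segment ℝ u v ⊆ ⋃ s ∈ S, Metric.closedBall s h := by
  set n : ℕ := ⌊‖v - u‖ / h⌋₊ + 1 with hn
  have hn0 : (0 : ℝ) < n := by rw [hn]; positivity
  have hn1 : ‖v - u‖ ≤ h * n := by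
    have := Nat.lt_floor_add_one (‖v - u‖ / h)
    rw [div_lt_iff₀ hh] at this
    rw [hn]; push_cast; linarith
  refine ⟨(Finset.range (n + 1)).image fun k : ℕ => u + ((k : ℝ) / n) • (v - u), ?_, ?_⟩
  · calc _ ≤ ((n + 1 : ℕ) : ℝ) := by
          exact_mod_cast Finset.card_image_le.trans (by simp)
      _ ≤ ‖v - u‖ / h + 2 := by
          have := Nat.floor_le (show 0 ≤ ‖v - u‖ / h by positivity)
          rw [hn]; push_cast; linarith
      _ ≤ _ := by
          rw [add_div]
          have : 2 ≤ 2 / h := by rw [le_div_iff₀ hh]; linarith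
          linarith
  · rw [segment_eq_image']
    rintro _ ⟨θ, ⟨hθ0, hθ1⟩, rfl⟩
    simp only [mem_iUnion, exists_prop, Finset.mem_image, Finset.mem_range]
    refine ⟨_, ⟨⌊θ * n⌋₊, ?_, rfl⟩, ?_⟩
    · have := Nat.floor_le (show 0 ≤ θ * n by positivity)
      have h2 : (⌊θ * n⌋₊ : ℝ) ≤ n := by nlinarith
      have h3 : ⌊θ * n⌋₊ ≤ n := by exact_mod_cast h2
      omega
    · rw [Metric.mem_closedBall, dist_eq_norm]
      have e : u + θ • (v - u) - (u + ((⌊θ * n⌋₊ : ℝ) / n) • (v - u)) =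
          (θ - (⌊θ * n⌋₊ : ℝ) / n) • (v - u) := by rw [sub_smul]; abel
      rw [e, norm_smul, Real.norm_eq_abs]
      have h1 := Nat.floor_le (show 0 ≤ θ * n by positivity)
      have h2 := Nat.lt_floor_add_one (θ * n)
      have h3 : θ - (⌊θ * n⌋₊ : ℝ) / n = (θ * n - ⌊θ * n⌋₊) / n := by field_simp
      have h4 : |θ - (⌊θ * n⌋₊ : ℝ) / n| ≤ 1 / n := by
        rw [h3, abs_of_nonneg (by apply div_nonneg <;> linarith)]
        gcongr; linarith
      calc _ ≤ 1 / n * (h * n) := by gcongr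
        _ = h := by field_simp

/-- This is applied to one fixed triangulation, while `h` is the size of another one: the constant
`K` thus depends on `Ω` only. -/
lemma Triangulation.frontier_cover {Ω : Set Plane} (T : Triangulation Ω) (hopen : IsOpen Ω)
    (hΩ : interior (closure Ω) = Ω) : ∃ K : ℝ, 0 ≤ K ∧ ∀ h : ℝ, 0 < h → h ≤ 1 →
      ∃ S : Finset Plane, (S.card : ℝ) ≤ K / h ∧ frontier Ω ⊆ ⋃ s ∈ S, Metric.closedBall s h := by
  refine ⟨∑ f ∈ T.flags, (‖f.2.1 - f.1‖ + 2), by positivity, fun h hh h1 => ?_⟩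
  choose S hS hc using fun f : Plane × Plane × Plane => segment_cover f.1 f.2.1 hh h1
  refine ⟨T.flags.biUnion S, ?_, ?_⟩
  · rw [Finset.sum_div]
    calc (((T.flags.biUnion S).card : ℕ) : ℝ) ≤ ((∑ f ∈ T.flags, (S f).card : ℕ) : ℝ) := by
          exact_mod_cast Finset.card_biUnion_le
      _ ≤ _ := by push_cast; exact Finset.sum_le_sum fun f _ => hS f
  · intro x hx
    have := T.frontier_subset hopen hΩ hx
    simp only [mem_iUnion, exists_prop] at this
    obtain ⟨f, hf, hxf⟩ := this
    have := hc f hxf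
    simp only [mem_iUnion, exists_prop, Finset.mem_biUnion] at this ⊢
    obtain ⟨s, hs, hxs⟩ := this
    exact ⟨s, ⟨f, hf, hs⟩, hxs⟩

/-! ### Joining points near the boundary -/

/-- At a boundary point, both points are lifted by `t = 2 (L + 1) η` in the graph direction and then
joined. Along the segment from `a` to `b`, of length less than `2 η`, the graph rises by at most `2
L η` and the height drops by at most `2 η`, so the lifted segment stays in `Ω`. The choice of `η`
makes `t = ρ / 4`, and the total length `2 t + 2 η` is less than `δ`. -/
lemma exists_short_path {Ω : Set Plane} (hopen : IsOpen Ω) (hlip : HasLipschitzBoundary Ω)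
    {x : Plane} (hx : x ∈ closure Ω) {δ : ℝ} (hδ : 0 < δ) :
    ∃ η > 0, ∀ a ∈ Ω ∩ Metric.ball x η, ∀ b ∈ Ω ∩ Metric.ball x η, ∃ c d,
      segment ℝ a c ⊆ Ω ∧ segment ℝ c d ⊆ Ω ∧ segment ℝ d b ⊆ Ω ∧
        ‖c - a‖ + ‖d - c‖ + ‖b - d‖ ≤ δ := by
  by_cases hxΩ : x ∈ Ω
  · obtain ⟨r, hr, hball⟩ := Metric.isOpen_iff.1 hopen x hxΩ
    refine ⟨min r (δ / 2), by positivity, fun a ha b hb => ⟨a, b, ?_, ?_, ?_, ?_⟩⟩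
    · rw [segment_same]; simpa using ha.1
    · exact (((convex_ball x _).segment_subset ha.2 hb.2).trans
        (Metric.ball_subset_ball (min_le_left _ _))).trans hball
    · rw [segment_same]; simpa using hb.1
    · have h1 := Metric.mem_ball.1 ha.2
      have h2 := Metric.mem_ball.1 hb.2
      have h3 := dist_triangle_right b a x
      have := min_le_right r (δ / 2)
      rw [dist_eq_norm b a] at h3
      simp; linarith
  · obtain ⟨φ, f, L, r, hr, hf, h⟩ := hlip x (by rw [hopen.frontier_eq]; exact ⟨hx, hxΩ⟩)
    set e : Plane := φ.symm (EuclideanSpace.single 1 1)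
    have he : ‖e‖ = 1 := by simp [e]
    have hφ : ∀ (y : Plane) (t : ℝ), φ (y + t • e) = φ y + t • EuclideanSpace.single 1 1 := by
      intro y t; simp [e]
    have hL : (0 : ℝ) ≤ L := L.2
    set ρ := min r δ
    have hρ : 0 < ρ := by positivity
    -- `t` is the height by which we climb
    set η := ρ / (8 * (L + 1))
    have hη : 0 < η := by positivity
    set t := 2 * (L + 1) * η with ht
    have ht4 : t = ρ / 4 := by simp only [ht, η]; field_simp; ring
    have hη8 : η ≤ ρ / 8 := by
      simp only [η]; gcongr; linarith
    have hup : ∀ a ∈ Ω ∩ Metric.ball x η, segment ℝ a (a + t • e) ⊆ Ω := by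
      rintro a ⟨haΩ, ha⟩ y hy
      rw [segment_eq_image'] at hy
      obtain ⟨s, ⟨hs0, hs1⟩, rfl⟩ := hy
      have e1 : a + s • (a + t • e - a) = a + (s * t) • e := by
        rw [add_sub_cancel_left, smul_smul]
      have hst : 0 ≤ s * t := by positivity
      have hst' : s * t ≤ t := by nlinarith [show 0 ≤ t by positivity]
      beta_reduce
      rw [e1]
      have ha' := Metric.mem_ball.1 ha
      have hmem : a ∈ Metric.ball x r := Metric.mem_ball.2 (by
        linarith [min_le_left r δ])
      have h1 := (h a hmem).1 haΩ
      refine (h _ ?_).2 ?_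
      · rw [Metric.mem_ball]
        calc dist (a + (s * t) • e) x ≤ dist (a + (s * t) • e) a + dist a x := dist_triangle _ _ _
          _ = s * t + dist a x := by
              rw [dist_eq_norm, add_sub_cancel_left, norm_smul, he, mul_one, Real.norm_of_nonneg hst]
          _ < r := by linarith [min_le_left r δ]
      · rw [hφ]
        simp
        linarith
    refine ⟨η, hη, fun a ha b hb => ⟨a + t • e, b + t • e, hup a ha, ?_, ?_, ?_⟩⟩
    · intro y hy
      rw [segment_eq_image'] at hy
      obtain ⟨s, ⟨hs0, hs1⟩, rfl⟩ := hy
      have e1 : a + t • e + s • (b + t • e - (a + t • e)) = a + s • (b - a) + t • e := by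
        rw [add_sub_add_right_eq_sub]; abel
      beta_reduce
      rw [e1]
      have ha' := Metric.mem_ball.1 ha.2
      have hb' := Metric.mem_ball.1 hb.2
      have hab : ‖b - a‖ < 2 * η := by
        rw [← dist_eq_norm]; linarith [dist_triangle_right b a x]
      have hmem : a ∈ Metric.ball x r := Metric.mem_ball.2 (by linarith [min_le_left r δ])
      have h1 := (h a hmem).1 ha.1
      have hz : a + s • (b - a) ∈ Metric.ball x η :=
        (convex_ball x η).segment_subset ha.2 hb.2
          (by rw [segment_eq_image']; exact ⟨s, ⟨hs0, hs1⟩, rfl⟩)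
      have hz' := Metric.mem_ball.1 hz
      refine (h _ ?_).2 ?_
      · rw [Metric.mem_ball]
        calc dist (a + s • (b - a) + t • e) x
            ≤ dist (a + s • (b - a) + t • e) (a + s • (b - a)) + dist (a + s • (b - a)) x :=
              dist_triangle _ _ _
          _ = t + dist (a + s • (b - a)) x := by
              rw [dist_eq_norm, add_sub_cancel_left, norm_smul, he, mul_one,
                Real.norm_of_nonneg (by positivity)]
          _ < r := by linarith [min_le_left r δ]
      · have hd : ‖φ (a + s • (b - a)) - φ a‖ ≤ 2 * η := by
          rw [← map_sub, φ.norm_map, add_sub_cancel_left, norm_smul, Real.norm_of_nonneg hs0]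
          nlinarith [norm_nonneg (b - a)]
        have c0 := (abs_coord_le (φ (a + s • (b - a)) - φ a) 0).trans hd
        have c1 := (abs_coord_le (φ (a + s • (b - a)) - φ a) 1).trans hd
        rw [PiLp.sub_apply] at c0 c1
        have hLip := hf.dist_le_mul (φ (a + s • (b - a)) 0) (φ a 0)
        rw [Real.dist_eq, Real.dist_eq] at hLip
        have c2 := (abs_le.1 (hLip.trans (mul_le_mul_of_nonneg_left c0 hL))).2
        have c3 := (abs_le.1 c1).1
        rw [hφ]
        generalize φ (a + s • (b - a)) = q at *
        simp
        linarith
    · rw [segment_symm]; exact hup b hb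
    · have ha' := Metric.mem_ball.1 ha.2
      have hb' := Metric.mem_ball.1 hb.2
      have hab : ‖b - a‖ < 2 * η := by
        rw [← dist_eq_norm]; linarith [dist_triangle_right b a x]
      rw [add_sub_cancel_left, add_sub_add_right_eq_sub, sub_add_cancel_left, norm_neg, norm_smul,
        he, mul_one, Real.norm_of_nonneg (by positivity)]
      linarith [min_le_right r δ]

namespace Triangulation

variable {Ω : Set Plane} (T : Triangulation Ω)

/-! ### Sums over flags -/

/-- The triangle of a flag. -/
def flagTri (f : Plane × Plane × Plane) : Finset Plane := {f.1, f.2.1, f.2.2}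

/-- Sums over triangles are converted into sums over flags through this: a triangle has one flag per
edge, its three cyclic rotations, and the reversed orientations are not counterclockwise. -/
lemma flags_filter_eq {a b c : Plane} (h : (a, b, c) ∈ T.flags) :
    T.flags.filter (fun f => flagTri f = {a, b, c}) = {(a, b, c), (b, c, a), (c, a, b)} := by
  have h2 := T.flag_rotate h
  have h3 := T.flag_rotate h2
  ext ⟨u, v, d⟩
  simp only [Finset.mem_filter, Finset.mem_insert, Finset.mem_singleton]
  constructor
  · rintro ⟨hf, he⟩
    have key : ∀ x y z : Plane, (x, y, z) ∈ T.flags → (x, y, d) ∈ T.flags → z = d :=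
      fun x y z h1 h2 => T.flag_opposite_unique h1 h2
    have hne : ∀ x y z z' : Plane, (x, y, z) ∈ T.flags → (y, x, z') ∈ T.flags → z ≠ z' :=
      fun x y z z' h1 h2 => (T.adjacent_of_opposite h1 h2).2.2
    have hd := (T.mem_flags.1 hf).2.ne
    have hu : u ∈ ({a, b, c} : Finset Plane) := he ▸ (by simp [flagTri])
    have hv : v ∈ ({a, b, c} : Finset Plane) := he ▸ (by simp [flagTri])
    have hd' : d ∈ ({a, b, c} : Finset Plane) := he ▸ (by simp [flagTri])
    simp only [Finset.mem_insert, Finset.mem_singleton] at hu hv hd'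
    rcases hu with rfl | rfl | rfl <;> rcases hv with rfl | rfl | rfl <;>
      rcases hd' with rfl | rfl | rfl <;> first | (simp at hd; done) | skip
    · simp
    · exact absurd rfl (hne _ _ _ _ hf h3)
    · exact absurd rfl (hne _ _ _ _ hf h)
    · simp
    · simp
    · exact absurd rfl (hne _ _ _ _ hf h2)
  · have e2 : ({b, c, a} : Finset Plane) = {a, b, c} := by ext; simp; tauto
    have e3 : ({c, a, b} : Finset Plane) = {a, b, c} := by ext; simp; tauto
    rintro (h0 | h0 | h0) <;> obtain ⟨rfl, rfl, rfl⟩ := (by simpa using h0 : u = _ ∧ v = _ ∧ d = _)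
    · exact ⟨h, rfl⟩
    · exact ⟨h2, e2⟩
    · exact ⟨h3, e3⟩

lemma sum_flags_filter {a b c : Plane} (h : (a, b, c) ∈ T.flags)
    (F : Plane × Plane × Plane → ℝ) :
    ∑ f ∈ T.flags.filter (fun f => flagTri f = {a, b, c}), F f =
      F (a, b, c) + F (b, c, a) + F (c, a, b) := by
  obtain ⟨h1, h2, h3⟩ := (T.mem_flags.1 h).2.ne
  rw [T.flags_filter_eq h, Finset.sum_insert, Finset.sum_insert, Finset.sum_singleton, add_assoc]
  · simp; intro h; exact absurd h h2
  · simp; exact ⟨fun h => absurd h h1, fun h => absurd h.symm h3⟩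

lemma flagTri_mem {f : Plane × Plane × Plane} (h : f ∈ T.flags) : flagTri f ∈ T.triangles :=
  (T.mem_flags.1 h).1

lemma sum_triangles_eq_sum_flags (Φ : Finset Plane → ℝ) (F : Plane × Plane × Plane → ℝ)
    (h : ∀ a b c, (a, b, c) ∈ T.flags → Φ {a, b, c} = F (a, b, c) + F (b, c, a) + F (c, a, b)) :
    ∑ t ∈ T.triangles, Φ t = ∑ f ∈ T.flags, F f := by
  rw [← Finset.sum_fiberwise_of_maps_to (fun f hf => T.flagTri_mem hf) F]
  refine Finset.sum_congr rfl fun t ht => ?_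
  obtain ⟨a, b, c, rfl, hD⟩ := T.exists_ccw ht
  have hf := T.mem_flags.2 ⟨ht, hD⟩
  rw [T.sum_flags_filter hf, h a b c hf]

lemma sum_flags_tri (X : Finset Plane → ℝ) :
    ∑ f ∈ T.flags, X (flagTri f) = 3 * ∑ t ∈ T.triangles, X t := by
  rw [Finset.mul_sum]
  symm
  refine T.sum_triangles_eq_sum_flags _ _ fun a b c h => ?_
  have e2 : flagTri (b, c, a) = {a, b, c} := by ext; simp [flagTri]; tauto
  have e3 : flagTri (c, a, b) = {a, b, c} := by ext; simp [flagTri]; tauto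
  rw [e2, e3]
  simp only [flagTri]; ring

lemma card_flags_le {P : Finset (Finset Plane)} {S : Finset (Plane × Plane × Plane)}
    (hS : S ⊆ T.flags) (hP : ∀ f ∈ S, flagTri f ∈ P) : S.card ≤ 3 * P.card := by
  rw [mul_comm]
  refine (Finset.card_le_mul_card_image_of_maps_to hP 3 fun t _ => ?_).trans (by rw [mul_comm])
  by_cases h : ∃ f ∈ S, flagTri f = t
  · obtain ⟨⟨a, b, c⟩, hf, rfl⟩ := h
    refine (Finset.card_le_card (Finset.filter_subset_filter _ hS)).trans ?_
    rw [show flagTri (a, b, c) = {a, b, c} from rfl, T.flags_filter_eq (hS hf)]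
    exact Finset.card_le_three
  · push Not at h
    rw [Finset.filter_eq_empty_iff.2 fun {f} hf => h f hf]; simp

/-! ### Size estimates -/

lemma dist_le_meshSize {h : ℝ} (hm : T.IsMeshSize h) {t : Finset Plane} (ht : t ∈ T.triangles)
    {x y : Plane} (hx : x ∈ hull t) (hy : y ∈ hull t) : ‖x - y‖ ≤ h := by
  rw [← dist_eq_norm]
  exact (Metric.dist_le_diam_of_mem (isCompact_hull t).isBounded hx hy).trans
    (hm.2 ⟨t, ht, rfl⟩)

lemma mem_hull_of_mem {t : Finset Plane} {x : Plane} (h : x ∈ t) : x ∈ hull t :=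
  subset_convexHull ℝ _ h

lemma meshSize_pos {h : ℝ} (hm : T.IsMeshSize h) : 0 < h := by
  obtain ⟨t, ht, _⟩ := hm.1
  obtain ⟨a, b, c, rfl, hD⟩ := T.exists_ccw ht
  have := T.dist_le_meshSize hm ht (mem_hull_of_mem (x := a) (by simp))
    (mem_hull_of_mem (x := b) (by simp))
  exact (norm_pos_iff.2 (sub_ne_zero.2 hD.ne.1)).trans_le this

lemma cr_lower {h γ : ℝ} (hm : T.IsMeshSize h) (hγ : 0 < γ) (hq : T.QuasiUniform h γ)
    {u v c : Plane} (hf : (u, v, c) ∈ T.flags) : 6 * γ ^ 2 * h ^ 2 ≤ cr u v c := by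
  obtain ⟨ht, hD⟩ := T.mem_flags.1 hf
  obtain ⟨x, hx⟩ := hq _ ht
  rw [hull_triple hD] at hx
  have := disc_le_cr hD (mul_nonneg hγ.le (T.meshSize_pos hm).le) hx
  linarith [this, mul_pow γ h 2]

lemma area_triple {u v c : Plane} (h : Ccw u v c) : area {u, v, c} = cr u v c / 2 := by
  rw [area, hull_triple h, measureReal_congr (ctri_ae_eq_otri h), volume_otri h]

lemma volume_interior_hull {t : Finset Plane} (ht : t ∈ T.triangles) :
    volume.real (interior (hull t)) = area t := by
  obtain ⟨a, b, c, rfl, hD⟩ := T.exists_ccw ht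
  rw [area_triple hD, hull_triple hD, interior_ctri hD, volume_otri hD]

lemma area_lower {h γ : ℝ} (hm : T.IsMeshSize h) (hγ : 0 < γ) (hq : T.QuasiUniform h γ)
    {t : Finset Plane} (ht : t ∈ T.triangles) : 3 * γ ^ 2 * h ^ 2 ≤ area t := by
  obtain ⟨a, b, c, rfl, hD⟩ := T.exists_ccw ht
  have := T.cr_lower hm hγ hq (T.mem_flags.2 ⟨ht, hD⟩)
  rw [area_triple hD]; linarith

lemma pairwiseDisjoint_interior :
    (T.triangles : Set (Finset Plane)).PairwiseDisjoint fun t => interior (hull t) :=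
  fun _ ht _ ht' hne => (T.disjoint_interior ht ht' hne).mono_right interior_subset

/-- The triangles have disjoint interiors of area at least `3 γ² h²`, all inside a disc of area `π
R² ≤ 4 R²`. -/
lemma packing {h γ : ℝ} (hm : T.IsMeshSize h) (hγ : 0 < γ) (hq : T.QuasiUniform h γ)
    {P : Finset (Finset Plane)} (hP : P ⊆ T.triangles) {x : Plane} {R : ℝ} (hR : 0 ≤ R)
    (hPR : ∀ t ∈ P, hull t ⊆ Metric.closedBall x R) :
    (P.card : ℝ) * (3 * γ ^ 2 * h ^ 2) ≤ 4 * R ^ 2 := by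
  have h1 : volume.real (⋃ t ∈ P, interior (hull t)) = ∑ t ∈ P, volume.real (interior (hull t)) :=
    measureReal_biUnion_finset (T.pairwiseDisjoint_interior.subset (by exact_mod_cast hP))
      (fun t _ => isOpen_interior.measurableSet)
      (fun t _ => ((measure_mono interior_subset).trans_lt (isCompact_hull t).measure_lt_top).ne)
  have h2 : volume.real (⋃ t ∈ P, interior (hull t)) ≤ volume.real (Metric.closedBall x R) :=
    measureReal_mono (iUnion₂_subset fun t ht => interior_subset.trans (hPR t ht))
      (isCompact_closedBall x R).measure_lt_top.ne
  rw [h1, measureReal_def, EuclideanSpace.volume_closedBall_fin_two, ENNReal.toReal_mul,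
    ENNReal.toReal_pow, ENNReal.toReal_ofReal hR, ENNReal.toReal_ofReal Real.pi_pos.le] at h2
  have h3 : (P.card : ℝ) * (3 * γ ^ 2 * h ^ 2) ≤ ∑ t ∈ P, volume.real (interior (hull t)) := by
    rw [← nsmul_eq_mul]
    refine Finset.card_nsmul_le_sum _ _ _ fun t ht => ?_
    rw [T.volume_interior_hull (hP ht)]
    exact T.area_lower hm hγ hq (hP ht)
  have h4 := Real.pi_lt_four
  nlinarith [sq_nonneg R]

lemma card_flags_at_vertex {h γ : ℝ} (hm : T.IsMeshSize h) (hγ : 0 < γ)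
    (hq : T.QuasiUniform h γ) (x : Plane) :
    ((T.flags.filter fun f => f.2.1 = x).card : ℝ) ≤ 4 / γ ^ 2 := by
  have hh := T.meshSize_pos hm
  set P := T.triangles.filter fun t => x ∈ t
  have h1 := T.packing hm hγ hq (Finset.filter_subset _ _ : P ⊆ _) (x := x) hh.le fun t ht => by
    rw [Finset.mem_filter] at ht
    intro y hy
    rw [Metric.mem_closedBall, dist_eq_norm]
    exact T.dist_le_meshSize hm ht.1 hy (mem_hull_of_mem ht.2)
  have h2 : (T.flags.filter fun f => f.2.1 = x).card ≤ 3 * P.card := by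
    refine T.card_flags_le (Finset.filter_subset _ _) fun f hf => ?_
    obtain ⟨hf', rfl⟩ := Finset.mem_filter.1 hf
    exact Finset.mem_filter.2 ⟨T.flagTri_mem hf', by simp [flagTri]⟩
  have h3 : ((T.flags.filter fun f => f.2.1 = x).card : ℝ) ≤ 3 * P.card := by exact_mod_cast h2
  rw [le_div_iff₀ (by positivity)]
  have h4 : (P.card : ℝ) * (3 * γ ^ 2) ≤ 4 := by
    have : ((P.card : ℝ) * (3 * γ ^ 2)) * h ^ 2 ≤ 4 * h ^ 2 := by linarith
    exact le_of_mul_le_mul_right this (by positivity)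
  nlinarith [sq_nonneg γ]

lemma exists_triangle_of_boundaryVertex {x : Plane} (hx : x ∈ T.boundaryVertices) :
    ∃ t ∈ T.triangles, x ∈ t := by
  rw [boundaryVertices, Finset.mem_biUnion] at hx
  obtain ⟨e, he, hxe⟩ := hx
  obtain ⟨u, v, c, hf, rfl⟩ := T.exists_flag_of_boundaryEdge he
  refine ⟨_, (T.mem_flags.1 hf).1, ?_⟩
  simp at hxe ⊢; tauto

/-- A triangle meeting a ball of radius `h` lies in the concentric ball of radius `2 h`. So
`packing` allows `16 / (3 γ²)` triangles, with three vertices each, per ball of the cover of the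
frontier. -/
lemma card_boundaryVertices {h γ K : ℝ} (hm : T.IsMeshSize h) (hγ : 0 < γ)
    (hq : T.QuasiUniform h γ) (hopen : IsOpen Ω) {S : Finset Plane} (hK : (S.card : ℝ) ≤ K / h)
    (hS : frontier Ω ⊆ ⋃ s ∈ S, Metric.closedBall s h) :
    (T.boundaryVertices.card : ℝ) ≤ K * (16 / γ ^ 2) / h := by
  have hh := T.meshSize_pos hm
  set P : Plane → Finset (Finset Plane) := fun s =>
    T.triangles.filter fun t => ∃ x ∈ t, x ∈ Metric.closedBall s h with hPdef
  have hP : ∀ s, ((P s).card : ℝ) ≤ 16 / (3 * γ ^ 2) := by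
    intro s
    have h1 := T.packing hm hγ hq (Finset.filter_subset _ _ : P s ⊆ _) (x := s) (R := 2 * h)
      (by positivity) fun t ht => by
        obtain ⟨ht, x, hxt, hx⟩ := Finset.mem_filter.1 ht
        intro y hy
        have := T.dist_le_meshSize hm ht hy (mem_hull_of_mem hxt)
        rw [← dist_eq_norm] at this
        rw [Metric.mem_closedBall] at hx ⊢
        linarith [dist_triangle y x s]
    rw [le_div_iff₀ (by positivity)]
    have : ((P s).card * (3 * γ ^ 2) : ℝ) * h ^ 2 ≤ 16 * h ^ 2 := by linarith
    exact le_of_mul_le_mul_right this (by positivity)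
  have hsub : T.boundaryVertices ⊆ S.biUnion fun s => (P s).biUnion id := by
    intro x hx
    have h1 := hS (T.boundaryVertices_subset_frontier hopen hx)
    simp only [mem_iUnion, exists_prop] at h1
    obtain ⟨s, hs, hxs⟩ := h1
    obtain ⟨t, ht, hxt⟩ := T.exists_triangle_of_boundaryVertex hx
    refine Finset.mem_biUnion.2 ⟨s, hs, Finset.mem_biUnion.2 ⟨t, ?_, hxt⟩⟩
    exact Finset.mem_filter.2 ⟨ht, x, hxt, hxs⟩
  have hc : ∀ s, (((P s).biUnion id).card : ℝ) ≤ 16 / γ ^ 2 := by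
    intro s
    have : ((P s).biUnion id).card ≤ (P s).card * 3 :=
      Finset.card_biUnion_le_card_mul _ _ _ fun t ht =>
        (T.mem_triangles.1 (Finset.mem_filter.1 ht).1).2.le
    calc (((P s).biUnion id).card : ℝ) ≤ (P s).card * 3 := by exact_mod_cast this
      _ ≤ 16 / (3 * γ ^ 2) * 3 := by gcongr; exact hP s
      _ = 16 / γ ^ 2 := by field_simp
  calc (T.boundaryVertices.card : ℝ) ≤ ((S.biUnion fun s => (P s).biUnion id).card : ℝ) := by
        exact_mod_cast Finset.card_le_card hsub
    _ ≤ ((∑ s ∈ S, ((P s).biUnion id).card : ℕ) : ℝ) := by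
        exact_mod_cast Finset.card_biUnion_le
    _ ≤ ∑ s ∈ S, 16 / γ ^ 2 := by push_cast; exact Finset.sum_le_sum fun s _ => hc s
    _ = S.card * (16 / γ ^ 2) := by simp
    _ ≤ K / h * (16 / γ ^ 2) := by gcongr
    _ = _ := by ring

end Triangulation

/-! ### Estimates for the geometric coefficients -/

/-- The cross product of two plane vectors. -/
def cross (d e : Plane) : ℝ := d 0 * e 1 - d 1 * e 0

/-- The quadratic form `d ↦ B d · rot d`, with the clockwise rotation `rot`. -/
def rotForm (B : Fin 2 → Fin 2 → ℝ) (d : Plane) : ℝ :=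
  (B 0 0 * d 0 + B 0 1 * d 1) * d 1 - (B 1 0 * d 0 + B 1 1 * d 1) * d 0

/-- The coefficient of the increment along an edge in the element integral of the interpolation
error of a linear field with matrix `B`; here `d`, `e` are the other two edge vectors. -/
def edgeCoef (B : Fin 2 → Fin 2 → ℝ) (d e : Plane) : ℝ :=
  (d 0 * e 0 + d 1 * e 1) * (rotForm B d - rotForm B e) / (12 * cross d e)

/-- The two halves of a parallelogram are exchanged by a point reflection. This evenness is what
makes their coefficients at the common edge cancel. -/
lemma edgeCoef_neg (B : Fin 2 → Fin 2 → ℝ) (d e : Plane) :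
    edgeCoef B (-d) (-e) = edgeCoef B d e := by
  simp [edgeCoef, rotForm, cross]
  ring

lemma abs_mul_sub_mul_le {x y x' y' h ε : ℝ} (hx : |x| ≤ h) (hy' : |y'| ≤ h) (h1 : |x - x'| ≤ ε)
    (h2 : |y - y'| ≤ ε) : |x * y - x' * y'| ≤ 2 * h * ε := by
  have e : x * y - x' * y' = x * (y - y') + y' * (x - x') := by ring
  have hh := (abs_nonneg _).trans hx
  rw [e]
  refine (abs_add_le _ _).trans ?_
  rw [abs_mul, abs_mul]
  have := mul_le_mul hx h2 (abs_nonneg _) hh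
  have := mul_le_mul hy' h1 (abs_nonneg _) hh
  linarith

lemma abs_mul_le_of {x y a b : ℝ} (hx : |x| ≤ a) (hy : |y| ≤ b) : |x * y| ≤ a * b := by
  rw [abs_mul]; exact mul_le_mul hx hy (abs_nonneg _) ((abs_nonneg _).trans hx)

lemma cross_self_sq (d e : Plane) :
    cross d e ^ 2 = ‖d‖ ^ 2 * ‖e‖ ^ 2 - (d 0 * e 0 + d 1 * e 1) ^ 2 := by
  rw [norm_sq_plane, norm_sq_plane, cross]; ring

lemma abs_cross_le (d e : Plane) : |cross d e| ≤ ‖d‖ * ‖e‖ := by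
  apply abs_le_of_sq_le_sq _ (by positivity)
  rw [cross_self_sq, mul_pow]; nlinarith [sq_nonneg (d 0 * e 0 + d 1 * e 1)]

lemma abs_dot_le (d e : Plane) : |d 0 * e 0 + d 1 * e 1| ≤ ‖d‖ * ‖e‖ := by
  rw [← inner_plane]; exact abs_real_inner_le_norm d e

lemma abs_sq_sub_sq_le {x y h ε : ℝ} (hx : |x| ≤ h) (hy : |y| ≤ h) (hxy : |x - y| ≤ ε) :
    |x ^ 2 - y ^ 2| ≤ 2 * h * ε := by
  rw [pow_two, pow_two]; exact abs_mul_sub_mul_le hx hy hxy hxy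

lemma dot_eq_norm (d e : Plane) :
    d 0 * e 0 + d 1 * e 1 = (‖d + e‖ ^ 2 - ‖d‖ ^ 2 - ‖e‖ ^ 2) / 2 := by
  rw [norm_sq_plane, norm_sq_plane, norm_sq_plane]; simp; ring

/-- By polarization the inner product of two sides is a function of the three squared side lengths;
each contributes `2 h ε`, and the sum is halved. -/
lemma abs_dot_sub_le {h ε : ℝ} {d₁ d₂ e₁ e₂ : Plane}
    (nd1 : ‖d₁‖ ≤ h) (nd2 : ‖d₂‖ ≤ h) (nd3 : ‖d₁ + d₂‖ ≤ h)
    (ne1 : ‖e₁‖ ≤ h) (ne2 : ‖e₂‖ ≤ h) (ne3 : ‖e₁ + e₂‖ ≤ h) (h1 : |‖d₁‖ - ‖e₁‖| ≤ ε)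
    (h2 : |‖d₂‖ - ‖e₂‖| ≤ ε) (h3 : |‖d₁ + d₂‖ - ‖e₁ + e₂‖| ≤ ε) :
    |(d₁ 0 * d₂ 0 + d₁ 1 * d₂ 1) - (e₁ 0 * e₂ 0 + e₁ 1 * e₂ 1)| ≤ 3 * h * ε := by
  have q1 := abs_le.1 (abs_sq_sub_sq_le (h := h) (by rwa [abs_norm]) (by rwa [abs_norm]) h1)
  have q2 := abs_le.1 (abs_sq_sub_sq_le (h := h) (by rwa [abs_norm]) (by rwa [abs_norm]) h2)
  have q3 := abs_le.1 (abs_sq_sub_sq_le (h := h) (by rwa [abs_norm]) (by rwa [abs_norm]) h3)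
  rw [dot_eq_norm, dot_eq_norm, abs_le]
  constructor <;> linarith [q1.1, q1.2, q2.1, q2.2, q3.1, q3.2]

/-- The square of the area is a polynomial in the squared sides and their inner product. The
difference of the squares is divided by `D + D' ≥ 2 κ h²`, which is where nondegeneracy and the
common orientation enter. -/
lemma abs_cross_sub_le {κ : ℝ} (hκ : 0 < κ) {h ε : ℝ} (hh : 0 < h) {d₁ d₂ e₁ e₂ : Plane}
    (hd : κ * h ^ 2 ≤ cross d₁ d₂) (he : κ * h ^ 2 ≤ cross e₁ e₂)
    (nd1 : ‖d₁‖ ≤ h) (nd2 : ‖d₂‖ ≤ h) (ne1 : ‖e₁‖ ≤ h) (ne2 : ‖e₂‖ ≤ h)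
    (h1 : |‖d₁‖ - ‖e₁‖| ≤ ε) (h2 : |‖d₂‖ - ‖e₂‖| ≤ ε)
    (hs : |(d₁ 0 * d₂ 0 + d₁ 1 * d₂ 1) - (e₁ 0 * e₂ 0 + e₁ 1 * e₂ 1)| ≤ 3 * h * ε) :
    |cross d₁ d₂ - cross e₁ e₂| ≤ 5 * h * ε / κ := by
  have q1 := abs_sq_sub_sq_le (h := h) (by rwa [abs_norm]) (by rwa [abs_norm]) h1
  have q2 := abs_sq_sub_sq_le (h := h) (by rwa [abs_norm]) (by rwa [abs_norm]) h2
  have bs := (abs_dot_le d₁ d₂).trans (mul_le_mul nd1 nd2 (norm_nonneg _) hh.le)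
  have bs' := (abs_dot_le e₁ e₂).trans (mul_le_mul ne1 ne2 (norm_nonneg _) hh.le)
  have c1 := cross_self_sq d₁ d₂
  have c2 := cross_self_sq e₁ e₂
  generalize d₁ 0 * d₂ 0 + d₁ 1 * d₂ 1 = s at *
  generalize e₁ 0 * e₂ 0 + e₁ 1 * e₂ 1 = s' at *
  generalize cross d₁ d₂ = D at *
  generalize cross e₁ e₂ = D' at *
  have n1 : |‖d₁‖ ^ 2| ≤ h ^ 2 := by rw [abs_of_nonneg (by positivity)]; gcongr
  have n2 : |‖e₂‖ ^ 2| ≤ h ^ 2 := by rw [abs_of_nonneg (by positivity)]; gcongr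
  have n3 : |s + s'| ≤ 2 * h ^ 2 := (abs_add_le _ _).trans (by linarith)
  have m1 := abs_mul_le_of n1 q2
  have m2 := abs_mul_le_of q1 n2
  have m3 := abs_mul_le_of hs n3
  have k1 : (D - D') * (D + D') = ‖d₁‖ ^ 2 * (‖d₂‖ ^ 2 - ‖e₂‖ ^ 2) +
      (‖d₁‖ ^ 2 - ‖e₁‖ ^ 2) * ‖e₂‖ ^ 2 - (s - s') * (s + s') := by linear_combination c1 - c2
  have hk : 0 < κ * h ^ 2 := by positivity
  have k2 : |D - D'| * (D + D') ≤ 10 * h ^ 3 * ε := by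
    have : |D - D'| * (D + D') = |(D - D') * (D + D')| := by
      rw [abs_mul, abs_of_nonneg (show 0 ≤ D + D' by linarith)]
    rw [this, k1]
    refine (abs_sub _ _).trans ((add_le_add_left (abs_add_le _ _) _).trans ?_)
    calc _ ≤ h ^ 2 * (2 * h * ε) + 2 * h * ε * h ^ 2 + 3 * h * ε * (2 * h ^ 2) := by gcongr
      _ = _ := by ring
  have k3 : |D - D'| * (2 * (κ * h ^ 2)) ≤ 10 * h ^ 3 * ε :=
    (mul_le_mul_of_nonneg_left (by linarith) (abs_nonneg _)).trans k2
  rw [le_div_iff₀ hκ]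
  have : (|D - D'| * κ) * (2 * h ^ 2) ≤ (5 * h * ε) * (2 * h ^ 2) := by linarith
  exact le_of_mul_le_mul_right this (by positivity)

/-- The counterclockwise rotation by a right angle. -/
def ccwRot (d : Plane) : Plane := !₂[-d 1, d 0]

lemma norm_ccwRot (d : Plane) : ‖ccwRot d‖ = ‖d‖ := by
  rw [← sq_eq_sq₀ (norm_nonneg _) (norm_nonneg _), norm_sq_plane, norm_sq_plane]
  simp [ccwRot]; ring

/-- Two triangles with nearly the same edge vector and nearly the same side lengths have nearly the
same edge vectors. -/
lemma edge_sub_le {κ : ℝ} (hκ : 0 < κ) {h ε : ℝ} (hh : 0 < h) {d₁ d₂ e₁ e₂ : Plane}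
    (hd : κ * h ^ 2 ≤ cross d₁ d₂) (he : κ * h ^ 2 ≤ cross e₁ e₂)
    (nd1 : ‖d₁‖ ≤ h) (nd2 : ‖d₂‖ ≤ h) (nd3 : ‖d₁ + d₂‖ ≤ h)
    (ne1 : ‖e₁‖ ≤ h) (ne2 : ‖e₂‖ ≤ h) (ne3 : ‖e₁ + e₂‖ ≤ h) (h1 : ‖d₁ - e₁‖ ≤ ε)
    (h2 : |‖d₂‖ - ‖e₂‖| ≤ ε) (h3 : |‖d₁ + d₂‖ - ‖e₁ + e₂‖| ≤ ε) :
    ‖d₂ - e₂‖ ≤ (7 + 5 / κ) / κ ^ 2 * ε := by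
  have hε : 0 ≤ ε := (norm_nonneg _).trans h1
  have h1' : |‖d₁‖ - ‖e₁‖| ≤ ε := (abs_norm_sub_norm_le _ _).trans h1
  have q1 := abs_sq_sub_sq_le (h := h) (by rwa [abs_norm]) (by rwa [abs_norm]) h1'
  have hss := abs_dot_sub_le nd1 nd2 nd3 ne1 ne2 ne3 h1' h2 h3
  have hDD := abs_cross_sub_le hκ hh hd he nd1 nd2 ne1 ne2 h1' h2 hss
  have bs' := (abs_dot_le e₁ e₂).trans (mul_le_mul ne1 ne2 (norm_nonneg _) hh.le)
  have bD' := (abs_cross_le e₁ e₂).trans (mul_le_mul ne1 ne2 (norm_nonneg _) hh.le)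
  have hd1 : κ * h ≤ ‖d₁‖ := by
    have := (hd.trans (le_abs_self _)).trans (abs_cross_le _ _)
    have h5 : (κ * h) * h ≤ ‖d₁‖ * h := by
      linarith [mul_le_mul_of_nonneg_left nd2 (norm_nonneg d₁)]
    exact le_of_mul_le_mul_right h5 hh
  -- Expansion of `d₂` in the orthogonal frame of `d₁` and its rotation, with coefficients the inner
  -- and cross products, compared with the same expansion for `e₂`. Division by `‖d₁‖² ≥ (κ h)²`
  -- follows.
  have key : ‖d₁‖ ^ 2 • (d₂ - e₂) =
      ((d₁ 0 * d₂ 0 + d₁ 1 * d₂ 1) - (e₁ 0 * e₂ 0 + e₁ 1 * e₂ 1)) • d₁ +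
      (e₁ 0 * e₂ 0 + e₁ 1 * e₂ 1) • (d₁ - e₁) + (cross d₁ d₂ - cross e₁ e₂) • ccwRot d₁ +
      cross e₁ e₂ • ccwRot (d₁ - e₁) - (‖d₁‖ ^ 2 - ‖e₁‖ ^ 2) • e₂ := by
    rw [norm_sq_plane, norm_sq_plane]
    apply plane_ext <;> simp [ccwRot, cross] <;> ring
  have e1 : ‖d₁‖ ^ 2 * ‖d₂ - e₂‖ = ‖‖d₁‖ ^ 2 • (d₂ - e₂)‖ := by
    rw [norm_smul, Real.norm_of_nonneg (by positivity)]
  rw [key] at e1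
  generalize (d₁ 0 * d₂ 0 + d₁ 1 * d₂ 1) - (e₁ 0 * e₂ 0 + e₁ 1 * e₂ 1) = x1 at *
  generalize (e₁ 0 * e₂ 0 + e₁ 1 * e₂ 1) = x2 at *
  generalize cross d₁ d₂ - cross e₁ e₂ = x3 at *
  generalize ‖d₁‖ ^ 2 - ‖e₁‖ ^ 2 = x5 at *
  have tot : ‖d₁‖ ^ 2 * ‖d₂ - e₂‖ ≤ (7 + 5 / κ) * h ^ 2 * ε := by
    rw [e1]
    refine (norm_sub_le _ _).trans ((add_le_add_left norm_add₄_le _).trans ?_)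
    simp only [norm_smul, norm_ccwRot, Real.norm_eq_abs]
    calc _ ≤ 3 * h * ε * h + h * h * ε + 5 * h * ε / κ * h + h * h * ε + 2 * h * ε * h := by
          gcongr
      _ = _ := by ring
  have low : (κ * h) ^ 2 * ‖d₂ - e₂‖ ≤ ‖d₁‖ ^ 2 * ‖d₂ - e₂‖ := by gcongr
  have fin : (κ ^ 2 * ‖d₂ - e₂‖) * h ^ 2 ≤ ((7 + 5 / κ) * ε) * h ^ 2 := by linarith
  have fin2 := le_of_mul_le_mul_right fin (by positivity)
  rw [div_mul_eq_mul_div, le_div_iff₀ (by positivity)]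
  linarith

lemma abs_rotForm_le {B : Fin 2 → Fin 2 → ℝ} {N h : ℝ} (hB : ∀ i j, |B i j| ≤ N) {d : Plane}
    (hd : ‖d‖ ≤ h) : |rotForm B d| ≤ 4 * N * h ^ 2 := by
  have c := fun i => (abs_coord_le d i).trans hd
  have m := fun i j k l => abs_mul_le_of (abs_mul_le_of (hB i j) (c k)) (c l)
  have m1 := m 0 0 0 1
  have m2 := m 0 1 1 1
  have m3 := m 1 0 0 0
  have m4 := m 1 1 1 0
  rw [rotForm]
  rw [abs_le] at *
  constructor <;> nlinarith

lemma abs_rotForm_sub_le {B B' : Fin 2 → Fin 2 → ℝ} {N h ε β : ℝ}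
    (hB' : ∀ i j, |B' i j| ≤ N) (hβ : ∀ i j, |B i j - B' i j| ≤ β) {d e : Plane}
    (hd : ‖d‖ ≤ h) (he : ‖e‖ ≤ h) (hde : ‖d - e‖ ≤ ε) :
    |rotForm B d - rotForm B' e| ≤ 4 * β * h ^ 2 + 8 * N * h * ε := by
  have hs := abs_rotForm_le hβ hd
  have cd := fun i => (abs_coord_le d i).trans hd
  have ce := fun i => (abs_coord_le e i).trans he
  have cde : ∀ i, |d i - e i| ≤ ε := fun i => by
    rw [← PiLp.sub_apply]; exact (abs_coord_le _ i).trans hde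
  have m := fun i j k l => abs_mul_le_of (hB' i j)
    (abs_mul_sub_mul_le (cd k) (ce l) (cde k) (cde l))
  have m1 := m 0 0 0 1
  have m2 := m 0 1 1 1
  have m3 := m 1 0 0 0
  have m4 := m 1 1 1 0
  have e1 : rotForm B d - rotForm B' e = rotForm (fun i j => B i j - B' i j) d +
      (B' 0 0 * (d 0 * d 1 - e 0 * e 1) + B' 0 1 * (d 1 * d 1 - e 1 * e 1) -
      B' 1 0 * (d 0 * d 0 - e 0 * e 0) - B' 1 1 * (d 1 * d 0 - e 1 * e 0)) := by
    simp only [rotForm]; ring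
  rw [e1]
  rw [abs_le] at *
  constructor <;> linarith

lemma abs_edgeCoef_le {κ : ℝ} (hκ : 0 < κ) {B : Fin 2 → Fin 2 → ℝ} {N h : ℝ} (hh : 0 < h)
    (hB : ∀ i j, |B i j| ≤ N) {d e : Plane} (hde : κ * h ^ 2 ≤ cross d e) (hd : ‖d‖ ≤ h)
    (he : ‖e‖ ≤ h) : |edgeCoef B d e| ≤ 1 / κ * N * h ^ 2 := by
  have hN : 0 ≤ N := (abs_nonneg _).trans (hB 0 0)
  have hp : 0 < cross d e := lt_of_lt_of_le (by positivity) hde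
  have b1 : |d 0 * e 0 + d 1 * e 1| ≤ h * h :=
    (abs_dot_le d e).trans (mul_le_mul hd he (norm_nonneg _) hh.le)
  have b2 : |rotForm B d - rotForm B e| ≤ 8 * N * h ^ 2 := by
    have := abs_rotForm_le hB hd
    have := abs_rotForm_le hB he
    rw [abs_le] at *
    constructor <;> linarith
  have b3 := abs_mul_le_of b1 b2
  rw [edgeCoef, abs_div, abs_of_pos (show 0 < 12 * cross d e by positivity),
    div_le_iff₀ (by positivity)]
  have : 1 / κ * N * h ^ 2 * (12 * (κ * h ^ 2)) = 12 * N * h ^ 4 := by field_simp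
  have h4 : 1 / κ * N * h ^ 2 * (12 * (κ * h ^ 2)) ≤ 1 / κ * N * h ^ 2 * (12 * cross d e) := by
    gcongr
  have : 0 ≤ N * h ^ 4 := by positivity
  nlinarith

/-- The edge coefficients depend Lipschitz continuously on the edges and the matrix. -/
lemma abs_edgeCoef_sub_le {κ : ℝ} (hκ : 0 < κ) {B B' : Fin 2 → Fin 2 → ℝ} {N h ε β : ℝ}
    (hh : 0 < h) (hB : ∀ i j, |B i j| ≤ N) (hB' : ∀ i j, |B' i j| ≤ N)
    (hβ : ∀ i j, |B i j - B' i j| ≤ β) {d₂ d₃ e₂ e₃ : Plane}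
    (hd : κ * h ^ 2 ≤ cross d₂ d₃) (he : κ * h ^ 2 ≤ cross e₂ e₃)
    (nd2 : ‖d₂‖ ≤ h) (nd3 : ‖d₃‖ ≤ h) (ne2 : ‖e₂‖ ≤ h) (ne3 : ‖e₃‖ ≤ h)
    (h2 : ‖d₂ - e₂‖ ≤ ε) (h3 : ‖d₃ - e₃‖ ≤ ε) :
    |edgeCoef B d₂ d₃ - edgeCoef B' e₂ e₃| ≤
      (4 / κ + 3 / κ ^ 2) * (N * h * ε + β * h ^ 2) := by
  have hN : 0 ≤ N := (abs_nonneg _).trans (hB 0 0)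
  have hβ0 : 0 ≤ β := (abs_nonneg _).trans (hβ 0 0)
  have hε : 0 ≤ ε := (norm_nonneg _).trans h2
  have hp : 0 < cross d₂ d₃ := lt_of_lt_of_le (by positivity) hd
  have hp' : 0 < cross e₂ e₃ := lt_of_lt_of_le (by positivity) he
  have cd2 := fun i => (abs_coord_le d₂ i).trans nd2
  have cd3 := fun i => (abs_coord_le d₃ i).trans nd3
  have ce2 := fun i => (abs_coord_le e₂ i).trans ne2
  have ce3 := fun i => (abs_coord_le e₃ i).trans ne3
  have c2 : ∀ i, |d₂ i - e₂ i| ≤ ε := fun i => by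
    rw [← PiLp.sub_apply]; exact (abs_coord_le _ i).trans h2
  have c3 : ∀ i, |d₃ i - e₃ i| ≤ ε := fun i => by
    rw [← PiLp.sub_apply]; exact (abs_coord_le _ i).trans h3
  have m := fun i j => abs_mul_sub_mul_le (cd2 i) (ce3 j) (c2 i) (c3 j)
  have hcr : |cross d₂ d₃ - cross e₂ e₃| ≤ 4 * h * ε := by
    have m1 := m 0 1
    have m2 := m 1 0
    rw [cross, cross]
    rw [abs_le] at *
    constructor <;> linarith
  set a := d₂ 0 * d₃ 0 + d₂ 1 * d₃ 1 with ha
  set a' := e₂ 0 * e₃ 0 + e₂ 1 * e₃ 1 with ha'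
  have haa : |a - a'| ≤ 4 * h * ε := by
    have m1 := m 0 0
    have m2 := m 1 1
    rw [ha, ha']
    rw [abs_le] at *
    constructor <;> linarith
  have ba' : |a'| ≤ h * h := (abs_dot_le _ _).trans (mul_le_mul ne2 ne3 (norm_nonneg _) hh.le)
  set q := rotForm B d₂ - rotForm B d₃ with hq
  set q' := rotForm B' e₂ - rotForm B' e₃ with hq'
  have bq : |q| ≤ 8 * N * h ^ 2 := by
    have := abs_rotForm_le hB nd2
    have := abs_rotForm_le hB nd3
    rw [hq]
    rw [abs_le] at *
    constructor <;> linarith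
  have bq' : |q'| ≤ 8 * N * h ^ 2 := by
    have := abs_rotForm_le hB' ne2
    have := abs_rotForm_le hB' ne3
    rw [hq']
    rw [abs_le] at *
    constructor <;> linarith
  have hqq : |q - q'| ≤ 8 * β * h ^ 2 + 16 * N * h * ε := by
    have r2 := abs_rotForm_sub_le hB' hβ nd2 ne2 h2
    have r3 := abs_rotForm_sub_le hB' hβ nd3 ne3 h3
    rw [hq, hq']
    rw [abs_le] at *
    constructor <;> linarith
  set D := cross d₂ d₃
  set D' := cross e₂ e₃
  have hn : |a * q - a' * q'| ≤ 48 * N * h ^ 3 * ε + 8 * β * h ^ 4 := by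
    have e1 : a * q - a' * q' = (a - a') * q + a' * (q - q') := by ring
    have m1 := abs_mul_le_of haa bq
    have m2 := abs_mul_le_of ba' hqq
    rw [e1]
    rw [abs_le] at *
    constructor <;> linarith
  have hn' : |a' * q' * (D - D')| ≤ 32 * N * h ^ 5 * ε :=
    (abs_mul_le_of (abs_mul_le_of ba' bq') hcr).trans (le_of_eq (by ring))
  have e1 : edgeCoef B d₂ d₃ - edgeCoef B' e₂ e₃ =
      (a * q - a' * q') / (12 * D) - a' * q' * (D - D') / (12 * D * D') := by
    simp only [edgeCoef]
    change a * q / (12 * D) - a' * q' / (12 * D') = _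
    field_simp; ring
  have b1 : |(a * q - a' * q') / (12 * D)| ≤
      (48 * N * h ^ 3 * ε + 8 * β * h ^ 4) / (12 * (κ * h ^ 2)) := by
    rw [abs_div, abs_of_pos (show 0 < 12 * D by positivity)]
    gcongr
  have b2 : |a' * q' * (D - D') / (12 * D * D')| ≤
      (32 * N * h ^ 5 * ε) / (12 * (κ * h ^ 2) * (κ * h ^ 2)) := by
    rw [abs_div, abs_of_pos (show 0 < 12 * D * D' by positivity)]
    gcongr
  rw [e1]
  refine (abs_sub _ _).trans ((add_le_add b1 b2).trans ?_)
  have e2 : (48 * N * h ^ 3 * ε + 8 * β * h ^ 4) / (12 * (κ * h ^ 2)) =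
      (4 * (N * h * ε) + 2 / 3 * (β * h ^ 2)) / κ := by field_simp; ring
  have e3 : (32 * N * h ^ 5 * ε) / (12 * (κ * h ^ 2) * (κ * h ^ 2)) =
      (8 / 3 * (N * h * ε)) / κ ^ 2 := by field_simp; ring
  have e4 : (4 / κ + 3 / κ ^ 2) * (N * h * ε + β * h ^ 2) =
      (4 * (N * h * ε) + 4 * (β * h ^ 2)) / κ + (3 * (N * h * ε) + 3 * (β * h ^ 2)) / κ ^ 2 := by
    ring
  have p1 : 0 ≤ N * h * ε := by positivity
  have p2 : 0 ≤ β * h ^ 2 := by positivity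
  rw [e2, e3, e4]
  gcongr <;> linarith

/-! ### The interpolation error on one triangle -/

/-- `P` is an affine vector field with linear part `B`. -/
def IsAffineField (P : Plane → Plane) (k : Fin 2 → ℝ) (B : Fin 2 → Fin 2 → ℝ) : Prop :=
  ∀ y i, P y i = k i + B i 0 * y 0 + B i 1 * y 1

lemma IsAffineField.flux_eq {P : Plane → Plane} {k : Fin 2 → ℝ} {B : Fin 2 → Fin 2 → ℝ}
    (hP : IsAffineField P k B) (u v : Plane) :
    flux P u v = (k 0 + B 0 0 * ((u 0 + v 0) / 2) + B 0 1 * ((u 1 + v 1) / 2)) * (v 1 - u 1) -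
      (k 1 + B 1 0 * ((u 0 + v 0) / 2) + B 1 1 * ((u 1 + v 1) / 2)) * (v 0 - u 0) := by
  have e : ∀ s : ℝ, P (u + s • (v - u)) 0 * (v 1 - u 1) - P (u + s • (v - u)) 1 * (v 0 - u 0) =
      ((k 0 + B 0 0 * u 0 + B 0 1 * u 1) * (v 1 - u 1) -
        (k 1 + B 1 0 * u 0 + B 1 1 * u 1) * (v 0 - u 0)) +
      s * ((B 0 0 * (v 0 - u 0) + B 0 1 * (v 1 - u 1)) * (v 1 - u 1) -
        (B 1 0 * (v 0 - u 0) + B 1 1 * (v 1 - u 1)) * (v 0 - u 0)) := by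
    intro s; rw [hP, hP]; simp; ring
  simp only [flux, e]
  rw [intervalIntegral.integral_add (by simp)
    (by apply Continuous.intervalIntegrable; fun_prop), intervalIntegral.integral_mul_const]
  simp
  ring

lemma IsAffineField.integral_inner {P : Plane → Plane} {k : Fin 2 → ℝ} {B : Fin 2 → Fin 2 → ℝ}
    (hP : IsAffineField P k B) {a b c : Plane} (hD : 0 < cr a b c) (q : Plane) :
    ∫ z in otri a b c, inner ℝ (P z) q = cr a b c / 2 *
      ((k 0 + B 0 0 * centroid3 a b c 0 + B 0 1 * centroid3 a b c 1) * q 0 +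
        (k 1 + B 1 0 * centroid3 a b c 0 + B 1 1 * centroid3 a b c 1) * q 1) := by
  have e : ∀ z, inner ℝ (P z) q = (k 0 * q 0 + k 1 * q 1) + (B 0 0 * q 0 + B 1 0 * q 1) * z 0 +
      (B 0 1 * q 0 + B 1 1 * q 1) * z 1 := by
    intro z; rw [inner_plane, hP, hP]; ring
  simp only [e]
  rw [setIntegral_affine hD]
  ring

lemma IsAffineField.continuous {P : Plane → Plane} {k : Fin 2 → ℝ} {B : Fin 2 → Fin 2 → ℝ}
    (hP : IsAffineField P k B) : Continuous P := by
  have : P = fun y => !₂[k 0 + B 0 0 * y 0 + B 0 1 * y 1, k 1 + B 1 0 * y 0 + B 1 1 * y 1] := by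
    ext1 y; apply plane_ext <;> simp [hP y]
  rw [this]; fun_prop

/-- The pairing of `q` with the integral of the Raviart-Thomas field with the given normal fluxes of
`p` through the edges of the triangle `a b c`. -/
def rtPairing (p : Plane → Plane) (a b c q : Plane) : ℝ :=
  (flux p a b * inner ℝ (centroid3 a b c - c) q + flux p b c * inner ℝ (centroid3 a b c - a) q +
    flux p c a * inner ℝ (centroid3 a b c - b) q) / 2

/-- The basis field with unit flux through `a b` and none through the other edges is `(z - c) / cr a
b c`, whose integral is half of the centroid minus `c`. So the interpolant enters the error only
through the fluxes of `p`. -/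
lemma integral_inner_rt {a b c : Plane} (hD : 0 < cr a b c) (v : Plane) (m : ℝ) (q : Plane) :
    ∫ z in otri a b c, inner ℝ (v + m • z) q = rtPairing (fun z => v + m • z) a b c q := by
  have hP : IsAffineField (fun z : Plane => v + m • z) (fun i => v i) ![![m, 0], ![0, m]] := by
    intro y i; fin_cases i <;> simp
  rw [hP.integral_inner hD, rtPairing, hP.flux_eq, hP.flux_eq, hP.flux_eq, inner_plane, inner_plane,
    inner_plane]
  simp [cr, centroid3]
  ring

/-- The flux of an affine field through an edge uses its value at the midpoint, and its integral
uses the value at the centroid. Constants are reproduced, so `k` drops out and each edge leaves a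
term quadratic in its edge vector. -/
lemma IsAffineField.integral_sub_rtPairing {P : Plane → Plane} {k : Fin 2 → ℝ}
    {B : Fin 2 → Fin 2 → ℝ} (hP : IsAffineField P k B) {a b c : Plane} (hD : 0 < cr a b c)
    (q : Plane) :
    (∫ z in otri a b c, inner ℝ (P z) q) - rtPairing P a b c q =
      (inner ℝ q (b - a) * rotForm B (b - a) + inner ℝ q (c - b) * rotForm B (c - b) +
        inner ℝ q (a - c) * rotForm B (a - c)) / 12 := by
  rw [hP.integral_inner hD, rtPairing, hP.flux_eq, hP.flux_eq, hP.flux_eq]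
  simp only [inner_plane]
  simp [cr, centroid3, rotForm]
  ring

/-- The coefficient of the increment along the edge `u v` of the triangle `u v c`. -/
def flagCoef (B : Fin 2 → Fin 2 → ℝ) (u v c : Plane) : ℝ := edgeCoef B (c - v) (u - c)

lemma cross_eq_cr (u v c : Plane) : cross (c - v) (u - c) = cr u v c := by
  simp [cross, cr]; ring

/-- The tangential component `q · (b - a)` may jump across an edge. The rotated products on the
right are normal fluxes of `q`, that is, increments of `w` when `q` is its curl, and up to sign do
not depend on the triangle; this is what permits cancellation between neighbours. -/
lemma sum_inner_rotForm_eq {a b c : Plane} (hD : 0 < cr a b c) (B : Fin 2 → Fin 2 → ℝ)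
    (q : Plane) :
    (inner ℝ q (b - a) * rotForm B (b - a) + inner ℝ q (c - b) * rotForm B (c - b) +
        inner ℝ q (a - c) * rotForm B (a - c)) / 12 =
      (q 0 * (b 1 - a 1) - q 1 * (b 0 - a 0)) * flagCoef B a b c +
      (q 0 * (c 1 - b 1) - q 1 * (c 0 - b 0)) * flagCoef B b c a +
      (q 0 * (a 1 - c 1) - q 1 * (a 0 - c 0)) * flagCoef B c a b := by
  have e1 := cr_rotate a b c
  have e2 := cr_rotate b c a
  simp only [flagCoef, edgeCoef, cross_eq_cr, e2, e1, inner_plane]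
  generalize rotForm B (b - a) = x
  generalize rotForm B (c - b) = y
  generalize rotForm B (a - c) = z
  have hD' := hD.ne'
  field_simp
  simp [cr]
  ring

lemma flux_sub_le {p P : Plane → Plane} {u v : Plane} {E h : ℝ}
    (hp : ContinuousOn p (segment ℝ u v)) (hP : Continuous P)
    (hE : ∀ y ∈ segment ℝ u v, ∀ i, |p y i - P y i| ≤ E) (huv : ‖v - u‖ ≤ h) :
    |flux p u v - flux P u v| ≤ 2 * E * h := by
  have hmem : ∀ s ∈ Icc (0 : ℝ) 1, u + s • (v - u) ∈ segment ℝ u v := by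
    intro s hs; rw [segment_eq_image']; exact ⟨s, hs, rfl⟩
  have hl : Continuous fun s : ℝ => u + s • (v - u) := by fun_prop
  have hpc : ContinuousOn (fun s : ℝ => p (u + s • (v - u))) (Icc 0 1) :=
    hp.comp hl.continuousOn hmem
  have hPc : Continuous (fun s : ℝ => P (u + s • (v - u))) := hP.comp hl
  have hE0 : 0 ≤ E := (abs_nonneg _).trans (hE u (left_mem_segment ℝ u v) 0)
  rw [flux, flux, ← intervalIntegral.integral_sub]
  · have := intervalIntegral.norm_integral_le_of_norm_le_const (a := 0) (b := 1) (C := 2 * E * h)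
      (f := fun s : ℝ => p (u + s • (v - u)) 0 * (v 1 - u 1) - p (u + s • (v - u)) 1 * (v 0 - u 0) -
        (P (u + s • (v - u)) 0 * (v 1 - u 1) - P (u + s • (v - u)) 1 * (v 0 - u 0))) ?_
    · simpa using this
    · intro s hs
      rw [uIoc_of_le zero_le_one] at hs
      have hm := hmem s ⟨hs.1.le, hs.2⟩
      have c := fun i => (abs_coord_le (v - u) i).trans huv
      have m0 := abs_mul_le_of (hE _ hm 0) (c 1)
      have m1 := abs_mul_le_of (hE _ hm 1) (c 0)
      rw [PiLp.sub_apply] at m0 m1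
      rw [Real.norm_eq_abs]
      rw [abs_le] at *
      constructor <;> linarith
  · apply ContinuousOn.intervalIntegrable
    rw [uIcc_of_le zero_le_one]
    have hpc' : ∀ i : Fin 2, ContinuousOn (fun s : ℝ => p (u + s • (v - u)) i) (Icc 0 1) :=
      fun i => (EuclideanSpace.proj (𝕜 := ℝ) i).continuous.comp_continuousOn hpc
    exact ((hpc' 0).mul continuousOn_const).sub ((hpc' 1).mul continuousOn_const)
  · have hPc' : ∀ i : Fin 2, Continuous (fun s : ℝ => P (u + s • (v - u)) i) :=
      fun i => (EuclideanSpace.proj (𝕜 := ℝ) i).continuous.comp hPc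
    exact (((hPc' 0).mul continuous_const).sub ((hPc' 1).mul continuous_const)).intervalIntegrable
      _ _

/-- The interpolation error on a triangle, for a field which is nearly affine. -/
lemma element_estimate {a b c : Plane} (hD : 0 < cr a b c) {h E : ℝ} (hab : ‖b - a‖ ≤ h)
    (hbc : ‖c - b‖ ≤ h) (hca : ‖a - c‖ ≤ h) {p P : Plane → Plane}
    (hp : ContinuousOn p (ctri a b c)) {k : Fin 2 → ℝ} {B : Fin 2 → Fin 2 → ℝ}
    (hP : IsAffineField P k B) (hE : ∀ y ∈ ctri a b c, ∀ i, |p y i - P y i| ≤ E)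
    {r : Plane → Plane} {v : Plane} {m : ℝ} (hr : ∀ x ∈ otri a b c, r x = v + m • x)
    (f1 : flux (fun x => v + m • x) a b = flux p a b)
    (f2 : flux (fun x => v + m • x) b c = flux p b c)
    (f3 : flux (fun x => v + m • x) c a = flux p c a) (q : Plane) :
    |(∫ z in otri a b c, inner ℝ (p z - r z) q) -
      ((q 0 * (b 1 - a 1) - q 1 * (b 0 - a 0)) * flagCoef B a b c +
      (q 0 * (c 1 - b 1) - q 1 * (c 0 - b 0)) * flagCoef B b c a +
      (q 0 * (a 1 - c 1) - q 1 * (a 0 - c 0)) * flagCoef B c a b)| ≤ 4 * E * h ^ 2 * ‖q‖ := by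
  have hh : 0 ≤ h := (norm_nonneg _).trans hab
  have hsub := otri_subset_ctri a b c
  have hmo := (isOpen_otri a b c).measurableSet
  have hva : a ∈ ctri a b c := by
    rw [← convexHull_triple_eq hD]; exact subset_convexHull ℝ _ (by simp)
  have hvb : b ∈ ctri a b c := by
    rw [← convexHull_triple_eq hD]; exact subset_convexHull ℝ _ (by simp)
  have hvc : c ∈ ctri a b c := by
    rw [← convexHull_triple_eq hD]; exact subset_convexHull ℝ _ (by simp)
  have hE0 : 0 ≤ E := (abs_nonneg _).trans (hE a hva 0)
  have hint : ∀ g : Plane → Plane, ContinuousOn g (ctri a b c) →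
      IntegrableOn (fun z => inner ℝ (g z) q) (otri a b c) := fun g hg =>
    ((hg.inner continuousOn_const).integrableOn_compact (isCompact_ctri hD)).mono_set hsub
  have i1 : ∫ z in otri a b c, inner ℝ (p z - r z) q =
      (∫ z in otri a b c, inner ℝ (p z) q) - rtPairing p a b c q := by
    have : ∫ z in otri a b c, inner ℝ (p z - r z) q =
        ∫ z in otri a b c, (inner ℝ (p z) q - inner ℝ (v + m • z) q) :=
      setIntegral_congr_fun hmo fun z hz => by
        simp only [hr z hz, inner_sub_left]
    rw [this, integral_sub (hint p hp) (hint _ (by fun_prop)), integral_inner_rt hD]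
    simp only [rtPairing, f1, f2, f3]
  have i2 := hP.integral_sub_rtPairing hD q
  rw [sum_inner_rotForm_eq hD] at i2
  rw [i1, ← i2]
  -- The integrand is at most `2 E ‖q‖` and the area at most `h² / 2`.
  have b1 : |(∫ z in otri a b c, inner ℝ (p z) q) - ∫ z in otri a b c, inner ℝ (P z) q| ≤
      E * h ^ 2 * ‖q‖ := by
    rw [← integral_sub (hint p hp) (hint _ hP.continuous.continuousOn), ← Real.norm_eq_abs]
    have hvol : volume (otri a b c) < ⊤ :=
      (measure_mono hsub).trans_lt (isCompact_ctri hD).measure_lt_top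
    refine (norm_setIntegral_le_of_norm_le_const (C := 2 * E * ‖q‖) hvol fun z hz => ?_).trans ?_
    · have c := fun i => abs_coord_le q i
      have m0 := abs_mul_le_of (hE z (hsub hz) 0) (c 0)
      have m1 := abs_mul_le_of (hE z (hsub hz) 1) (c 1)
      rw [Real.norm_eq_abs, inner_plane, inner_plane]
      rw [abs_le] at *
      constructor <;> linarith
    · rw [volume_otri hD]
      have : cr a b c ≤ h ^ 2 := by
        rw [← cross_eq_cr]
        calc _ ≤ _ := le_abs_self _
          _ ≤ _ := abs_cross_le _ _
          _ ≤ h * h := by gcongr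
          _ = _ := by ring
      calc _ = E * cr a b c * ‖q‖ := by ring
        _ ≤ _ := by gcongr
  have hseg : ∀ x ∈ ctri a b c, ∀ y ∈ ctri a b c, segment ℝ x y ⊆ ctri a b c := fun x hx y hy =>
    (convex_ctri a b c).segment_subset hx hy
  have fl : ∀ x ∈ ctri a b c, ∀ y ∈ ctri a b c, ‖y - x‖ ≤ h →
      |flux p x y - flux P x y| ≤ 2 * E * h := fun x hx y hy hxy =>
    flux_sub_le (hp.mono (hseg x hx y hy)) hP.continuous
      (fun z hz => hE z (hseg x hx y hy hz)) hxy
  have hg : ∀ x y z : Plane, ‖y - x‖ ≤ h → ‖z - y‖ ≤ h → ‖x - z‖ ≤ h →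
      |inner ℝ (centroid3 x y z - z) q| ≤ h * ‖q‖ := by
    intro x y z _ hyz hzx
    refine (abs_real_inner_le_norm _ _).trans (mul_le_mul_of_nonneg_right ?_ (norm_nonneg _))
    have : centroid3 x y z - z = (1 / 3 : ℝ) • ((x - z) - (z - y)) := by
      apply plane_ext <;> simp [centroid3] <;> ring
    rw [this, norm_smul, Real.norm_of_nonneg (by norm_num)]
    have := norm_sub_le (x - z) (z - y)
    linarith
  have g1 := hg a b c hab hbc hca
  have g2 := hg b c a hbc hca hab
  have g3 := hg c a b hca hab hbc
  have ec : centroid3 b c a = centroid3 a b c := by simp [centroid3]; abel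
  have ec' : centroid3 c a b = centroid3 a b c := by simp [centroid3]; abel
  rw [ec] at g2
  rw [ec'] at g3
  -- Three edges, each with flux error `2 E h` against a vector of length at most `h`, and the
  -- factor `1 / 2` in `rtPairing`.
  have b2 : |rtPairing p a b c q - rtPairing P a b c q| ≤ 3 * E * h ^ 2 * ‖q‖ := by
    have m1 := abs_mul_le_of (fl a hva b hvb hab) g1
    have m2 := abs_mul_le_of (fl b hvb c hvc hbc) g2
    have m3 := abs_mul_le_of (fl c hvc a hva hca) g3
    rw [rtPairing, rtPairing]
    rw [abs_le] at m1 m2 m3 ⊢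
    constructor <;> linarith [m1.1, m1.2, m2.1, m2.2, m3.1, m3.2]
  rw [abs_le] at *
  constructor <;> linarith [b1.1, b1.2, b2.1, b2.2]

/-! ### Continuous piecewise linear functions -/

namespace Triangulation

variable {Ω : Set Plane} (T : Triangulation Ω)

/-- `q t` is the constant value of the curl of `w` on each triangle `t`. -/
def IsCurl (w : Plane → ℝ) (q : Finset Plane → Plane) : Prop :=
  ∀ t ∈ T.triangles, (∀ x ∈ interior (hull t), curl w x = q t) ∧
    ∀ x ∈ hull t, ∀ y ∈ hull t, w y - w x = q t 0 * (y 1 - x 1) - q t 1 * (y 0 - x 0)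

lemma exists_isCurl {w : Plane → ℝ} (hw : T.IsContinuousP1 w) : ∃ q, T.IsCurl w q := by
  choose! f hf using hw.2
  refine ⟨fun t => !₂[(f t).linear (EuclideanSpace.single 1 1),
    -(f t).linear (EuclideanSpace.single 0 1)], fun t ht => ⟨fun x hx => ?_, fun x hx y hy => ?_⟩⟩
  · have hd : HasFDerivAt (f t) (LinearMap.toContinuousLinearMap (f t).linear) x := by
      have e : (f t : Plane → ℝ) = fun y =>
          LinearMap.toContinuousLinearMap (f t).linear y + f t 0 := by
        ext1 y
        have := (f t).map_vadd 0 y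
        simpa using this
      have h1 := (LinearMap.toContinuousLinearMap (f t).linear).hasFDerivAt (x := x)
      have h2 := h1.add_const (f t 0)
      rw [e]
      exact h2
    have he : w =ᶠ[𝓝 x] f t := by
      filter_upwards [mem_interior_iff_mem_nhds.1 hx] with y hy using hf t ht hy
    rw [curl, (hd.congr_of_eventuallyEq he).fderiv]
    rfl
  · rw [hf t ht hx, hf t ht hy]
    have h1 : f t y - f t x = (f t).linear (y - x) := by
      have := (f t).linearMap_vsub y x
      simpa using this.symm
    have e1 : y - x = (y 0 - x 0) • EuclideanSpace.single 0 1 +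
        (y 1 - x 1) • EuclideanSpace.single 1 1 := by
      apply plane_ext <;> simp
    rw [h1, e1, map_add, map_smul, map_smul]
    simp
    ring

lemma IsCurl.abs_sub_le {w : Plane → ℝ} {q : Finset Plane → Plane} (hq : T.IsCurl w q)
    {t : Finset Plane} (ht : t ∈ T.triangles) {x y : Plane} (hx : x ∈ hull t) (hy : y ∈ hull t) :
    |w y - w x| ≤ ‖q t‖ * ‖y - x‖ := by
  rw [(hq t ht).2 x hx y hy]
  have := abs_cross_le (q t) (y - x)
  simpa [cross] using this

lemma ae_eq_biUnion (hΩ : interior (closure Ω) = Ω) :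
    Ω =ᵐ[volume] ⋃ t ∈ T.triangles, interior (hull t) := by
  refine (ae_eq_set).2 ⟨measure_mono_null (t := ⋃ t ∈ T.triangles, hull t \ interior (hull t)) ?_ ?_,
    ?_⟩
  · rintro x ⟨hx, hx'⟩
    have h1 := subset_closure hx
    rw [T.closure_eq] at h1
    simp only [mem_iUnion, exists_prop] at h1 hx' ⊢
    obtain ⟨t, ht, hxt⟩ := h1
    exact ⟨t, ht, hxt, fun h => hx' ⟨t, ht, h⟩⟩
  · refine (measure_biUnion_null_iff T.triangles.countable_toSet).2 fun t ht => ?_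
    obtain ⟨a, b, c, rfl, hD⟩ := T.exists_ccw ht
    rw [hull_triple hD, interior_ctri hD]
    exact (ae_eq_set.1 (ctri_ae_eq_otri hD)).1
  · have : (⋃ t ∈ T.triangles, interior (hull t)) ⊆ Ω :=
      iUnion₂_subset fun t ht => T.interior_hull_subset hΩ ht
    rw [sdiff_eq_empty.2 this, measure_empty]

lemma setIntegral_eq_sum (hΩ : interior (closure Ω) = Ω) (f : Plane → ℝ)
    (hf : ∀ t ∈ T.triangles, IntegrableOn f (interior (hull t))) :
    ∫ x in Ω, f x = ∑ t ∈ T.triangles, ∫ x in interior (hull t), f x := by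
  rw [setIntegral_congr_set (T.ae_eq_biUnion hΩ)]
  exact integral_biUnion_finset _ (fun t _ => isOpen_interior.measurableSet)
    T.pairwiseDisjoint_interior hf

lemma volume_interior_lt_top (t : Finset Plane) : volume (interior (hull t)) < ⊤ :=
  (measure_mono interior_subset).trans_lt (isCompact_hull t).measure_lt_top

lemma IsCurl.normL2_sq {w : Plane → ℝ} {q : Finset Plane → Plane} (hq : T.IsCurl w q)
    (hΩ : interior (closure Ω) = Ω) :
    normL2 Ω (curl w) ^ 2 = ∑ t ∈ T.triangles, area t * ‖q t‖ ^ 2 := by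
  have he : ∀ t ∈ T.triangles, EqOn (fun x => ‖curl w x‖ ^ 2) (fun _ => ‖q t‖ ^ 2)
      (interior (hull t)) := fun t ht x hx => by simp only [(hq t ht).1 x hx]
  rw [normL2, Real.sq_sqrt (by positivity), T.setIntegral_eq_sum hΩ]
  · refine Finset.sum_congr rfl fun t ht => ?_
    rw [setIntegral_congr_fun isOpen_interior.measurableSet (he t ht), setIntegral_const,
      T.volume_interior_hull ht, smul_eq_mul]
  · intro t ht
    rw [integrableOn_congr_fun (he t ht) isOpen_interior.measurableSet]
    exact integrableOn_const (volume_interior_lt_top t).ne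

/-- A majorant of the norm of the curl, defined everywhere. -/
def curlBound (q : Finset Plane → Plane) (z : Plane) : ℝ :=
  √(∑ t ∈ T.triangles, indicator (hull t) (fun _ => ‖q t‖ ^ 2) z)

lemma curlBound_sq (q : Finset Plane → Plane) (z : Plane) :
    T.curlBound q z ^ 2 = ∑ t ∈ T.triangles, indicator (hull t) (fun _ => ‖q t‖ ^ 2) z :=
  Real.sq_sqrt (Finset.sum_nonneg fun t _ => indicator_nonneg (fun _ _ => by positivity) _)

lemma le_curlBound (q : Finset Plane → Plane) {t : Finset Plane} (ht : t ∈ T.triangles)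
    {z : Plane} (hz : z ∈ hull t) : ‖q t‖ ≤ T.curlBound q z := by
  apply Real.le_sqrt_of_sq_le
  have := Finset.single_le_sum (f := fun t => indicator (hull t) (fun _ => ‖q t‖ ^ 2) z)
    (fun t _ => indicator_nonneg (fun _ _ => by positivity) _) ht
  simpa [indicator_of_mem hz] using this

lemma measurable_curlBound (q : Finset Plane → Plane) : Measurable (T.curlBound q) := by
  apply Measurable.sqrt
  exact Finset.measurable_fun_sum _ fun t _ =>
    measurable_const.indicator (isCompact_hull t).isClosed.measurableSet

lemma curlBound_sq_le (q : Finset Plane → Plane) (z : Plane) :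
    T.curlBound q z ^ 2 ≤ ∑ t ∈ T.triangles, ‖q t‖ ^ 2 := by
  rw [curlBound_sq]
  exact Finset.sum_le_sum fun t _ => indicator_le_self' (fun _ _ => by positivity) z

lemma curlBound_nonneg (q : Finset Plane → Plane) (z : Plane) : 0 ≤ T.curlBound q z :=
  Real.sqrt_nonneg _

lemma curlBound_le (q : Finset Plane → Plane) (z : Plane) :
    T.curlBound q z ≤ √(∑ t ∈ T.triangles, ‖q t‖ ^ 2) :=
  Real.le_sqrt_of_sq_le (T.curlBound_sq_le q z)

lemma integrable_curlBound_sq (q : Finset Plane → Plane) :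
    Integrable fun z => T.curlBound q z ^ 2 := by
  simp only [curlBound_sq]
  refine integrable_finsetSum _ fun t _ => ?_
  rw [integrable_indicator_iff (isCompact_hull t).isClosed.measurableSet]
  exact integrableOn_const (isCompact_hull t).measure_lt_top.ne

lemma integral_curlBound_sq (q : Finset Plane → Plane) :
    ∫ z, T.curlBound q z ^ 2 = ∑ t ∈ T.triangles, area t * ‖q t‖ ^ 2 := by
  simp only [curlBound_sq]
  rw [integral_finsetSum]
  · refine Finset.sum_congr rfl fun t _ => ?_
    rw [integral_indicator (isCompact_hull t).isClosed.measurableSet, setIntegral_const,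
      smul_eq_mul, area]
  · intro t _
    rw [integrable_indicator_iff (isCompact_hull t).isClosed.measurableSet]
    exact integrableOn_const (isCompact_hull t).measure_lt_top.ne

/-- Each triangle meets the line in a compact interval of parameters, possibly a point or empty.
Away from the finitely many end points, any triangle containing the current point contains a piece
of the segment around it, on which `w` is affine; segments running along edges need no separate
treatment. -/
lemma exists_hasDerivAt_off_finite {w : Plane → ℝ} {q : Finset Plane → Plane}
    (hq : T.IsCurl w q) {x y : Plane} (hxy : segment ℝ x y ⊆ closure Ω) :
    ∃ F : Set ℝ, F.Finite ∧ ∀ s ∈ Ioo (0 : ℝ) 1 \ F, ∃ d,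
      HasDerivAt (fun s : ℝ => w (x + s • (y - x))) d s ∧
        |d| ≤ ‖y - x‖ * T.curlBound q (x + s • (y - x)) := by
  set l : ℝ → Plane := fun s => x + s • (y - x) with hl
  have hlc : Continuous l := by fun_prop
  set J : Finset Plane → Set ℝ := fun t => Icc 0 1 ∩ l ⁻¹' hull t with hJ
  have hJc : ∀ t, Convex ℝ (J t) := fun t => by
    refine (convex_Icc _ _).inter ?_
    have : l = AffineMap.lineMap x y := by
      ext1 s; rw [AffineMap.lineMap_apply_module', hl, add_comm]
    rw [this]
    exact (convex_convexHull ℝ _).affine_preimage _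
  have hJk : ∀ t, IsCompact (J t) := fun t =>
    isCompact_Icc.inter_right ((isCompact_hull t).isClosed.preimage hlc)
  refine ⟨⋃ t ∈ T.triangles, {sInf (J t), sSup (J t)}, ?_, ?_⟩
  · exact T.triangles.finite_toSet.biUnion fun t _ => by simp
  · rintro s ⟨⟨hs0, hs1⟩, hsF⟩
    have hsc : l s ∈ closure Ω := hxy (by rw [segment_eq_image']; exact ⟨s, ⟨hs0.le, hs1.le⟩, rfl⟩)
    rw [T.closure_eq] at hsc
    simp only [mem_iUnion, exists_prop] at hsc hsF
    obtain ⟨t, ht, hst⟩ := hsc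
    have hsJ : s ∈ J t := ⟨⟨hs0.le, hs1.le⟩, hst⟩
    have hI := eq_Icc_of_connected_compact ⟨⟨s, hsJ⟩, (hJc t).isPreconnected⟩ (hJk t)
    have hne1 : s ≠ sInf (J t) := fun h => hsF ⟨t, ht, by simp [h.symm]⟩
    have hne2 : s ≠ sSup (J t) := fun h => hsF ⟨t, ht, by simp [h.symm]⟩
    have hmem := hI ▸ hsJ
    have hnhds : J t ∈ 𝓝 s := by
      rw [hI]
      exact Icc_mem_nhds (lt_of_le_of_ne hmem.1 hne1.symm) (lt_of_le_of_ne hmem.2 hne2)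
    refine ⟨q t 0 * (y 1 - x 1) - q t 1 * (y 0 - x 0), ?_, ?_⟩
    · have he : (fun s : ℝ => w (l s)) =ᶠ[𝓝 s] fun s' =>
          w (l s) + (s' - s) * (q t 0 * (y 1 - x 1) - q t 1 * (y 0 - x 0)) := by
        filter_upwards [hnhds] with s' hs'
        have := (hq t ht).2 _ hst _ hs'.2
        have e1 : l s' 1 - l s 1 = (s' - s) * (y 1 - x 1) := by simp [hl]; ring
        have e0 : l s' 0 - l s 0 = (s' - s) * (y 0 - x 0) := by simp [hl]; ring
        rw [e1, e0] at this
        linear_combination this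
      have hd := (((hasDerivAt_id s).sub_const s).mul_const
        (q t 0 * (y 1 - x 1) - q t 1 * (y 0 - x 0))).const_add (w (l s))
      rw [one_mul] at hd
      exact hd.congr_of_eventuallyEq he
    · have h1 := abs_cross_le (q t) (y - x)
      have h2 := T.le_curlBound q ht hst
      have h3 : |q t 0 * (y 1 - x 1) - q t 1 * (y 0 - x 0)| ≤ ‖q t‖ * ‖y - x‖ := by
        simpa [cross] using h1
      calc _ ≤ _ := h3
        _ ≤ T.curlBound q (l s) * ‖y - x‖ := by gcongr
        _ = _ := mul_comm _ _

lemma intervalIntegrable_curlBound (q : Finset Plane → Plane) (x y : Plane) :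
    IntervalIntegrable (fun s : ℝ => T.curlBound q (x + s • (y - x))) volume 0 1 := by
  rw [intervalIntegrable_iff, uIoc_of_le zero_le_one]
  refine Integrable.of_bound (C := √(∑ t ∈ T.triangles, ‖q t‖ ^ 2)) ?_ (.of_forall fun s => ?_)
  · exact ((T.measurable_curlBound q).comp (by fun_prop)).aestronglyMeasurable
  · rw [Real.norm_of_nonneg (T.curlBound_nonneg q _)]; exact T.curlBound_le q _

lemma abs_sub_le_integral {w : Plane → ℝ} (hw : ContinuousOn w (closure Ω))
    {q : Finset Plane → Plane} (hq : T.IsCurl w q) {x y : Plane}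
    (hxy : segment ℝ x y ⊆ closure Ω) :
    |w y - w x| ≤ ‖y - x‖ * ∫ s in (0 : ℝ)..1, T.curlBound q (x + s • (y - x)) := by
  obtain ⟨F, hF, hd⟩ := T.exists_hasDerivAt_off_finite hq hxy
  have hc : ContinuousOn (fun s : ℝ => w (x + s • (y - x))) (Icc 0 1) :=
    hw.comp (by fun_prop) fun s hs => hxy (by rw [segment_eq_image']; exact ⟨s, hs, rfl⟩)
  set f : ℝ → ℝ := fun s => w (x + s • (y - x)) with hf
  have hG := (T.intervalIntegrable_curlBound q x y).const_mul ‖y - x‖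
  have hae : ∀ᵐ s : ℝ, s ∈ Ioc (0 : ℝ) 1 →
      ‖deriv f s‖ ≤ ‖y - x‖ * T.curlBound q (x + s • (y - x)) := by
    have h1 : ∀ᵐ s : ℝ, s ∉ insert 1 F :=
      (measure_eq_zero_iff_ae_notMem).1 ((hF.insert 1).measure_zero volume)
    filter_upwards [h1] with s hs hs'
    obtain ⟨d, hd1, hd2⟩ := hd s ⟨⟨hs'.1, lt_of_le_of_ne hs'.2 fun h => hs (by simp [h])⟩,
      fun h => hs (by simp [h])⟩
    rw [hd1.deriv]; exact hd2
  have hi : IntervalIntegrable (deriv f) volume 0 1 := by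
    rw [intervalIntegrable_iff, uIoc_of_le zero_le_one]
    rw [intervalIntegrable_iff, uIoc_of_le zero_le_one] at hG
    refine Integrable.mono' hG (measurable_deriv f).aestronglyMeasurable ?_
    rw [ae_restrict_iff' measurableSet_Ioc]
    exact hae
  have key := integral_eq_of_hasDerivAt_off_countable f (deriv f) (a := 0) (b := 1)
    hF.countable (by rwa [uIcc_of_le zero_le_one]) (fun s hs => by
      simp only [min_eq_left zero_le_one, max_eq_right zero_le_one] at hs
      obtain ⟨d, hd1, _⟩ := hd s hs
      rw [hd1.deriv]; exact hd1) hi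
  have h2 := intervalIntegral.norm_integral_le_of_norm_le zero_le_one hae hG
  rw [key, intervalIntegral.integral_const_mul] at h2
  simpa [hf] using h2

end Triangulation

/-! ### The discrete Sobolev inequality -/

/-- The Cauchy-Schwarz inequality recovered from its additive form, at the optimal parameter `l = B
/ I`. -/
lemma sq_le_of_forall_pos {I A B : ℝ} (hI : 0 ≤ I) (hA : 0 ≤ A) (hB : 0 < B)
    (h : ∀ l > 0, 2 * I ≤ l * A + B / l) : I ^ 2 ≤ A * B := by
  rcases hI.eq_or_lt with rfl | hI
  · simp; positivity
  · have := h (B / I) (by positivity)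
    rw [div_div_cancel₀ hB.ne'] at this
    have h2 : I ≤ B / I * A := by linarith
    calc I ^ 2 = I * I := pow_two I
      _ ≤ I * (B / I * A) := by gcongr
      _ = A * B := by field_simp

lemma isFiniteMeasure_unitSq : IsFiniteMeasure (volume.restrict unitSq) :=
  ⟨by
    rw [Measure.restrict_apply_univ]
    exact (measure_mono (Set.prod_mono Ioo_subset_Icc_self Ioo_subset_Icc_self)).trans_lt
      (isCompact_Icc.prod isCompact_Icc).measure_lt_top⟩

lemma setIntegral_unitSq_eq {F : ℝ × ℝ → ℝ} (hF : IntegrableOn F unitSq) :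
    ∫ p in unitSq, F p = ∫ t in (0 : ℝ)..1, ∫ s in (0 : ℝ)..1, F (s, t) := by
  have hv : (volume : Measure (ℝ × ℝ)).restrict unitSq =
      (volume.restrict (Ioo (0 : ℝ) 1)).prod (volume.restrict (Ioo (0 : ℝ) 1)) := by
    rw [Measure.prod_restrict, ← Measure.volume_eq_prod, unitSq]
  rw [IntegrableOn, hv] at hF
  rw [hv, integral_prod_symm F hF, intervalIntegral.integral_of_le zero_le_one,
    integral_Ioc_eq_integral_Ioo]
  congr 1; ext t
  rw [intervalIntegral.integral_of_le zero_le_one, integral_Ioc_eq_integral_Ioo]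

lemma intervalIntegrable_inner {F : ℝ × ℝ → ℝ} (hF : IntegrableOn F unitSq) :
    IntervalIntegrable (fun t => ∫ s in (0 : ℝ)..1, F (s, t)) volume 0 1 := by
  have hv : (volume : Measure (ℝ × ℝ)).restrict unitSq =
      (volume.restrict (Ioo (0 : ℝ) 1)).prod (volume.restrict (Ioo (0 : ℝ) 1)) := by
    rw [Measure.prod_restrict, ← Measure.volume_eq_prod, unitSq]
  rw [IntegrableOn, hv] at hF
  rw [intervalIntegrable_iff, uIoc_of_le zero_le_one, integrableOn_Ioc_iff_integrableOn_Ioo]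
  have := hF.integral_prod_right
  refine this.congr (.of_forall fun t => ?_)
  simp only []
  rw [intervalIntegral.integral_of_le zero_le_one, integral_Ioc_eq_integral_Ioo]

namespace Triangulation

variable {Ω : Set Plane} (T : Triangulation Ω)

lemma integrableOn_curlBound_cone (q : Finset Plane → Plane) (x a b : Plane) :
    IntegrableOn (fun p => T.curlBound q (cone x a b p)) unitSq := by
  have := isFiniteMeasure_unitSq
  refine Integrable.of_bound (C := √(∑ t ∈ T.triangles, ‖q t‖ ^ 2)) ?_ (.of_forall fun s => ?_)
  · exact ((T.measurable_curlBound q).comp (continuous_cone x a b).measurable).aestronglyMeasurable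
  · rw [Real.norm_of_nonneg (T.curlBound_nonneg q _)]; exact T.curlBound_le q _

lemma integrableOn_curlBound_cone_sq (q : Finset Plane → Plane) (x a b : Plane) :
    IntegrableOn (fun p => T.curlBound q (cone x a b p) ^ 2) unitSq := by
  have := isFiniteMeasure_unitSq
  refine Integrable.of_bound (C := ∑ t ∈ T.triangles, ‖q t‖ ^ 2) ?_ (.of_forall fun s => ?_)
  · exact (((T.measurable_curlBound q).comp
      (continuous_cone x a b).measurable).pow_const 2).aestronglyMeasurable
  · rw [Real.norm_of_nonneg (by positivity)]; exact T.curlBound_sq_le q _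

/-- The increments of `w` along the segments from `x` to the points of the edge `a b` are averaged
over that edge. The resulting integral over the square has no Jacobian factor, so its integrand is
singular relative to area at the apex. -/
lemma abs_sub_average_le {w : Plane → ℝ} (hw : ContinuousOn w (closure Ω))
    {q : Finset Plane → Plane} (hq : T.IsCurl w q) {x a b : Plane} (hD : 0 < cr x a b)
    (hsub : ctri x a b ⊆ closure Ω) {R : ℝ} (hR : ∀ y ∈ ctri x a b, ‖y - x‖ ≤ R) :
    |w x - ∫ t in (0 : ℝ)..1, w (a + t • (b - a))| ≤
      R * ∫ p in unitSq, T.curlBound q (cone x a b p) := by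
  have hx : x ∈ ctri x a b := by
    rw [← convexHull_triple_eq hD]; exact subset_convexHull ℝ _ (by simp)
  have hR0 : 0 ≤ R := (norm_nonneg _).trans (hR x hx)
  have hab : ∀ t ∈ Icc (0 : ℝ) 1, a + t • (b - a) ∈ ctri x a b := by
    intro t ht
    rw [← convexHull_triple_eq hD]
    refine (convex_convexHull ℝ _).segment_subset (subset_convexHull ℝ _ (by simp : a ∈ _))
      (subset_convexHull ℝ _ (by simp : b ∈ _)) ?_
    rw [segment_eq_image']; exact ⟨t, ht, rfl⟩
  have hwi : IntervalIntegrable (fun t : ℝ => w (a + t • (b - a))) volume 0 1 := by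
    apply ContinuousOn.intervalIntegrable
    rw [uIcc_of_le zero_le_one]
    exact hw.comp (by fun_prop) fun t ht => hsub (hab t ht)
  have hint := T.integrableOn_curlBound_cone q x a b
  have e : ∫ t in (0 : ℝ)..1, (w (a + t • (b - a)) - w x) =
      (∫ t in (0 : ℝ)..1, w (a + t • (b - a))) - w x := by
    rw [intervalIntegral.integral_sub hwi (by simp)]; simp
  rw [abs_sub_comm, ← e, setIntegral_unitSq_eq hint, ← intervalIntegral.integral_const_mul,
    ← Real.norm_eq_abs]
  refine intervalIntegral.norm_integral_le_of_norm_le zero_le_one (.of_forall fun t ht => ?_)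
    ((intervalIntegrable_inner hint).const_mul R)
  have ht' : t ∈ Icc (0 : ℝ) 1 := ⟨ht.1.le, ht.2⟩
  have h1 := T.abs_sub_le_integral hw hq (x := x) (y := a + t • (b - a))
    (((convex_ctri x a b).segment_subset hx (hab t ht')).trans hsub)
  have e2 : ∀ s : ℝ, x + s • (a + t • (b - a) - x) = cone x a b (s, t) := by
    intro s; apply plane_ext <;> simp [cone] <;> ring
  simp only [e2] at h1
  have h2 : 0 ≤ ∫ s in (0 : ℝ)..1, T.curlBound q (cone x a b (s, t)) :=
    intervalIntegral.integral_nonneg zero_le_one fun s _ => T.curlBound_nonneg q _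
  exact h1.trans (mul_le_mul_of_nonneg_right (hR _ (hab t ht')) h2)

/-- Cauchy-Schwarz with the weight `s + h²`. The part with weight `s` is the area element, hence
controlled by the `L²` norm; the part with weight `h²` is paid for by an inverse estimate. The
reciprocal weight integrates to the logarithm. -/
lemma integral_curlBound_cone_sq_le {w : Plane → ℝ} {q : Finset Plane → Plane}
    (hq : T.IsCurl w q) (hΩ : interior (closure Ω) = Ω) {h γ : ℝ} (hm : T.IsMeshSize h)
    (hγ : 0 < γ) (hqu : T.QuasiUniform h γ) {x a b : Plane} (hD : 0 < cr x a b) :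
    (∫ p in unitSq, T.curlBound q (cone x a b p)) ^ 2 ≤
      (1 / cr x a b + 1 / (3 * γ ^ 2)) * normL2 Ω (curl w) ^ 2 *
        Real.log ((1 + h ^ 2) / h ^ 2) := by
  have hh := T.meshSize_pos hm
  set ε := h ^ 2 with hε
  have hε0 : 0 < ε := by positivity
  set X := normL2 Ω (curl w) ^ 2 with hX
  have hX0 : 0 ≤ X := by positivity
  have hXs := hq.normL2_sq T hΩ
  set G : ℝ × ℝ → ℝ := fun p => T.curlBound q (cone x a b p) with hG
  have hGi := T.integrableOn_curlBound_cone q x a b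
  have hGi2 := T.integrableOn_curlBound_cone_sq q x a b
  have hGs := (integrableOn_otri hD (fun z => T.curlBound q z ^ 2)).1
    (T.integrable_curlBound_sq q).integrableOn
  have hlog : ∫ s in (0 : ℝ)..1, 1 / (s + ε) = Real.log ((1 + ε) / ε) := by
    have := intervalIntegral.integral_comp_add_right (a := 0) (b := 1) (fun s : ℝ => 1 / s) ε
    rw [this, integral_one_div_of_pos (by linarith) (by linarith), zero_add]
  have hlog0 : 0 < Real.log ((1 + ε) / ε) := by
    apply Real.log_pos
    rw [one_lt_div hε0]; linarith
  have hA1 : ∫ p in unitSq, p.1 * cr x a b * G p ^ 2 ≤ X := by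
    rw [← setIntegral_otri hD (fun z => T.curlBound q z ^ 2), hX, hXs, ← T.integral_curlBound_sq q]
    exact setIntegral_le_integral (T.integrable_curlBound_sq q) (.of_forall fun z => by positivity)
  have hA2 : ∫ p in unitSq, G p ^ 2 ≤ X / (3 * γ ^ 2 * ε) := by
    have h1 : ∑ t ∈ T.triangles, ‖q t‖ ^ 2 ≤ X / (3 * γ ^ 2 * ε) := by
      rw [le_div_iff₀ (by positivity), hX, hXs, Finset.sum_mul]
      refine Finset.sum_le_sum fun t ht => ?_
      rw [mul_comm]
      exact mul_le_mul_of_nonneg_right (T.area_lower hm hγ hqu ht) (by positivity)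
    have h2 : ∫ p in unitSq, G p ^ 2 ≤ ∫ p in unitSq, (∑ t ∈ T.triangles, ‖q t‖ ^ 2) * 1 := by
      have := isFiniteMeasure_unitSq
      exact setIntegral_mono hGi2 (integrable_const _) fun p => by
        simpa using T.curlBound_sq_le q _
    rw [setIntegral_unitSq_mul (fun _ => ∑ t ∈ T.triangles, ‖q t‖ ^ 2) (fun _ => 1)] at h2
    simp at h2
    exact h2.trans h1
  have hI0 : 0 ≤ ∫ p in unitSq, G p := integral_nonneg fun p => T.curlBound_nonneg q _
  refine sq_le_of_forall_pos hI0 (by positivity) hlog0 fun l hl => ?_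
  have hi1 : IntegrableOn (fun p : ℝ × ℝ => 1 / (p.1 + ε) * 1) unitSq := by
    have hc : ContinuousOn (fun p : ℝ × ℝ => 1 / (p.1 + ε) * 1) (Icc 0 1 ×ˢ Icc 0 1) := by
      refine ContinuousOn.mul (ContinuousOn.div continuousOn_const (by fun_prop) ?_)
        continuousOn_const
      rintro p ⟨⟨h1, _⟩, _⟩
      positivity
    exact (hc.integrableOn_compact (isCompact_Icc.prod isCompact_Icc)).mono_set
      (Set.prod_mono Ioo_subset_Icc_self Ioo_subset_Icc_self)
  have j1 : IntegrableOn (fun p => l / cr x a b * (p.1 * cr x a b * G p ^ 2)) unitSq :=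
    hGs.const_mul _
  have j2 : IntegrableOn (fun p => l * ε * G p ^ 2) unitSq := hGi2.const_mul _
  have j3 : IntegrableOn (fun p : ℝ × ℝ => 1 / l * (1 / (p.1 + ε) * 1)) unitSq := hi1.const_mul _
  have j12 : IntegrableOn (fun p => l / cr x a b * (p.1 * cr x a b * G p ^ 2) +
      l * ε * G p ^ 2) unitSq := j1.add j2
  have key : ∫ p in unitSq, 2 * G p ≤ ∫ p in unitSq, (l / cr x a b * (p.1 * cr x a b * G p ^ 2) +
      l * ε * G p ^ 2 + 1 / l * (1 / (p.1 + ε) * 1)) := by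
    -- Pointwise this is `2 G ≤ l (s + ε) G² + 1 / (l (s + ε))`, a completed square.
    refine setIntegral_mono_on (hGi.const_mul 2) (j12.add j3) measurableSet_unitSq fun p hp => ?_
    have hp1 : 0 < p.1 := hp.1.1
    have e : l / cr x a b * (p.1 * cr x a b * G p ^ 2) + l * ε * G p ^ 2 +
        1 / l * (1 / (p.1 + ε) * 1) - 2 * G p =
        (l * (p.1 + ε) * G p - 1) ^ 2 / (l * (p.1 + ε)) := by
      field_simp; ring
    have : 0 ≤ (l * (p.1 + ε) * G p - 1) ^ 2 / (l * (p.1 + ε)) := by positivity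
    linarith
  rw [integral_const_mul, integral_add j12 j3, integral_add j1 j2, integral_const_mul,
    integral_const_mul, integral_const_mul,
    setIntegral_unitSq_mul (fun s => 1 / (s + ε)) (fun _ => 1), hlog] at key
  simp only [intervalIntegral.integral_const, sub_zero, smul_eq_mul, mul_one] at key
  refine key.trans ?_
  have b1 := mul_le_mul_of_nonneg_left hA1 (show 0 ≤ l / cr x a b by positivity)
  have b2 := mul_le_mul_of_nonneg_left hA2 (show 0 ≤ l * ε by positivity)
  have e1 : l / cr x a b * X + l * ε * (X / (3 * γ ^ 2 * ε)) =
      l * ((1 / cr x a b + 1 / (3 * γ ^ 2)) * X) := by field_simp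
  have e2 : 1 / l * Real.log ((1 + ε) / ε) = Real.log ((1 + ε) / ε) / l := by ring
  rw [e2]
  linarith

end Triangulation

lemma ctri_subset_of_mem {x a b c : Plane} (hD : 0 < cr a b c) (hx : x ∈ ctri a b c)
    (hD' : 0 < cr x a b) : ctri x a b ⊆ ctri a b c := by
  rw [← convexHull_triple_eq hD']
  rw [← convexHull_triple_eq hD] at hx ⊢
  apply convexHull_min _ (convex_convexHull ℝ _)
  rintro z (rfl | rfl | rfl)
  · exact hx
  · exact subset_convexHull ℝ _ (by simp)
  · exact subset_convexHull ℝ _ (by simp)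

namespace Triangulation

variable {Ω : Set Plane} (T : Triangulation Ω)

/-- The oscillation of a piecewise linear function over a fixed triangle in `closure Ω`. -/
lemma oscillation_triangle_le {w : Plane → ℝ} (hw : ContinuousOn w (closure Ω))
    {q : Finset Plane → Plane} (hq : T.IsCurl w q) (hΩ : interior (closure Ω) = Ω) {h γ : ℝ}
    (hm : T.IsMeshSize h) (hγ : 0 < γ) (hqu : T.QuasiUniform h γ) {a b c : Plane}
    (hD : 0 < cr a b c) (hsub : ctri a b c ⊆ closure Ω) {R : ℝ}
    (hR : ∀ x ∈ ctri a b c, ∀ y ∈ ctri a b c, ‖y - x‖ ≤ R) {x y : Plane}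
    (hx : x ∈ ctri a b c) (hy : y ∈ ctri a b c) :
    |w x - w y| ≤ 4 * R * √(3 / cr a b c + 1 / (3 * γ ^ 2)) *
      √(Real.log ((1 + h ^ 2) / h ^ 2)) * normL2 Ω (curl w) := by
  set D := cr a b c with hDdef
  set E := R * √(3 / D + 1 / (3 * γ ^ 2)) * √(Real.log ((1 + h ^ 2) / h ^ 2)) *
    normL2 Ω (curl w) with hE
  have hR0 : 0 ≤ R := (norm_nonneg _).trans (hR x hx x hx)
  have hlog0 : 0 ≤ Real.log ((1 + h ^ 2) / h ^ 2) := by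
    have := T.meshSize_pos hm
    apply Real.log_nonneg
    rw [one_le_div (by positivity)]; linarith
  -- Points whose barycentric weight opposite the side `a b` is at least `1 / 3` see that side under
  -- a triangle of comparable area, so they are close in value to the average over the side.
  have side : ∀ a b c : Plane, cr a b c = D → (∀ x ∈ ctri a b c, ∀ y ∈ ctri a b c, ‖y - x‖ ≤ R) →
      ctri a b c ⊆ closure Ω → ∀ z ∈ ctri a b c, D ≤ 3 * cr a b z →
      |w z - ∫ t in (0 : ℝ)..1, w (a + t • (b - a))| ≤ E := by
    intro a b c habc hR hsub z hz hDz
    have hDz' : 0 < cr z a b := by rw [← cr_rotate z a b]; linarith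
    have hs := ctri_subset_of_mem (by rw [habc]; exact hD) hz hDz'
    refine (T.abs_sub_average_le hw hq hDz' (hs.trans hsub)
      (fun y hy => hR z hz y (hs hy))).trans ?_
    rw [hE, mul_assoc, mul_assoc]
    refine mul_le_mul_of_nonneg_left ?_ hR0
    refine abs_le_of_sq_le_sq' ?_ (by unfold normL2; positivity) |>.2
    refine (T.integral_curlBound_cone_sq_le hq hΩ hm hγ hqu hDz').trans ?_
    rw [mul_pow, mul_pow, Real.sq_sqrt (by positivity), Real.sq_sqrt hlog0]
    have : 1 / cr z a b ≤ 3 / D := by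
      rw [div_le_div_iff₀ hDz' hD, ← cr_rotate z a b]; linarith
    calc _ ≤ (3 / D + 1 / (3 * γ ^ 2)) * normL2 Ω (curl w) ^ 2 *
          Real.log ((1 + h ^ 2) / h ^ 2) := by gcongr
      _ = _ := by ring
  set g := centroid3 a b c with hg
  have c1 : 3 * cr a b g = D := by simp [hg, hDdef, centroid3, cr]; ring
  have c2 : 3 * cr b c g = D := by simp [hg, hDdef, centroid3, cr]; ring
  have c3 : 3 * cr c a g = D := by simp [hg, hDdef, centroid3, cr]; ring
  have hgm : g ∈ ctri a b c := ⟨by linarith, by linarith, by linarith⟩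
  have r1 := ctri_rotate a b c
  have r2 := ctri_rotate b c a
  have s1 := side a b c rfl hR hsub
  have s2 := side b c a (cr_rotate a b c) (by rwa [r1]) (by rwa [r1])
  have s3 := side c a b ((cr_rotate b c a).trans (cr_rotate a b c)) (by rwa [r2, r1])
    (by rwa [r2, r1])
  rw [r1] at s2
  rw [r2, r1] at s3
  -- Some barycentric coordinate of `z` is at least `1 / 3`. The centroid qualifies for all three
  -- sides, so it is compared with `z` through the average over the corresponding side.
  have main : ∀ z ∈ ctri a b c, |w z - w g| ≤ 2 * E := by
    intro z hz
    have hs := cr_sum a b c z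
    have comb : ∀ m : ℝ, |w z - m| ≤ E → |w g - m| ≤ E → |w z - w g| ≤ 2 * E := by
      intro m h1 h2
      rw [abs_le] at *
      constructor <;> linarith
    by_cases h1 : D ≤ 3 * cr a b z
    · exact comb _ (s1 z hz h1) (s1 g hgm c1.ge)
    by_cases h2 : D ≤ 3 * cr b c z
    · exact comb _ (s2 z hz h2) (s2 g hgm c2.ge)
    have h3 : D ≤ 3 * cr c a z := by linarith
    exact comb _ (s3 z hz h3) (s3 g hgm c3.ge)
  have m1 := main x hx
  have m2 := main y hy
  have : 4 * R * √(3 / D + 1 / (3 * γ ^ 2)) *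
      √(Real.log ((1 + h ^ 2) / h ^ 2)) * normL2 Ω (curl w) = 4 * E := by rw [hE]; ring
  rw [this]
  rw [abs_le] at *
  constructor <;> linarith

end Triangulation

/-- The image of the connected set `closure Ω` under `w` is an interval containing `w x` and `w y`.
It is covered by the images of the sets `K i`, of diameter at most `e i`, so comparing lengths
replaces a chaining argument. -/
lemma abs_sub_le_sum_of_cover {Ω : Set Plane} (hc : IsConnected Ω) {w : Plane → ℝ}
    (hw : ContinuousOn w (closure Ω)) {ι : Type*} (s : Finset ι) (K : ι → Set Plane) (e : ι → ℝ)
    (hcov : closure Ω ⊆ ⋃ i ∈ s, K i) (he : ∀ i ∈ s, 0 ≤ e i)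
    (hosc : ∀ i ∈ s, ∀ x ∈ K i, ∀ y ∈ K i, |w x - w y| ≤ e i) {x y : Plane}
    (hx : x ∈ closure Ω) (hy : y ∈ closure Ω) : |w x - w y| ≤ ∑ i ∈ s, e i := by
  have hsub : uIcc (w x) (w y) ⊆ ⋃ i ∈ s, w '' K i := by
    have h1 := (hc.closure.isPreconnected.image w hw).ordConnected.uIcc_subset
      (mem_image_of_mem w hx) (mem_image_of_mem w hy)
    refine h1.trans ?_
    rintro _ ⟨z, hz, rfl⟩
    have := hcov hz
    simp only [mem_iUnion, exists_prop] at this ⊢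
    obtain ⟨i, hi, hzi⟩ := this
    exact ⟨i, hi, z, hzi, rfl⟩
  have h2 : volume (uIcc (w x) (w y)) ≤ ∑ i ∈ s, ENNReal.ofReal (e i) := by
    refine (measure_mono hsub).trans ((measure_biUnion_finset_le _ _).trans ?_)
    refine Finset.sum_le_sum fun i hi => (Real.volume_le_diam _).trans ?_
    refine Metric.ediam_le ?_
    rintro _ ⟨a, ha, rfl⟩ _ ⟨b, hb, rfl⟩
    rw [edist_dist, Real.dist_eq]
    exact ENNReal.ofReal_le_ofReal (hosc i hi a ha b hb)
  rw [Real.volume_interval, ← ENNReal.ofReal_sum_of_nonneg he, ENNReal.ofReal_le_ofReal_iff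
    (Finset.sum_nonneg he)] at h2
  rwa [abs_sub_comm]

/-- The discrete Sobolev inequality. -/
theorem discrete_sobolev {Ω : Set Plane} (hΩ : interior (closure Ω) = Ω) (hconn : IsConnected Ω)
    (T₀ : Triangulation Ω) {γ : ℝ} (hγ : 0 < γ) : ∃ C : ℝ, 0 ≤ C ∧ ∀ (T : Triangulation Ω) (h : ℝ),
      T.IsMeshSize h → T.QuasiUniform h γ → ∀ w, T.IsContinuousP1 w →
        ∀ x ∈ closure Ω, ∀ y ∈ closure Ω, |w x - w y| ≤
          C * √(Real.log ((1 + h ^ 2) / h ^ 2)) * normL2 Ω (curl w) := by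
  -- The cones are taken in the triangles of the fixed `T₀`, of size independent of the mesh; the
  -- mesh `T` enters only through the curl bound.
  set e : Finset Plane → ℝ := fun t =>
    4 * Metric.diam (hull t) * √(3 / (2 * area t) + 1 / (3 * γ ^ 2)) with he
  have he0 : ∀ t, 0 ≤ e t := fun t => by
    have := Metric.diam_nonneg (s := hull t)
    positivity
  refine ⟨∑ t ∈ T₀.triangles, e t, Finset.sum_nonneg fun t _ => he0 t,
    fun T h hm hqu w hw x hx y hy => ?_⟩
  obtain ⟨q, hq⟩ := T.exists_isCurl hw
  rw [Finset.sum_mul, Finset.sum_mul]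
  refine abs_sub_le_sum_of_cover hconn hw.1 T₀.triangles hull _ T₀.closure_eq.subset
    (fun t _ => ?_) (fun t ht x hx y hy => ?_) hx hy
  · have := he0 t
    unfold normL2
    positivity
  · obtain ⟨a, b, c, rfl, hD⟩ := T₀.exists_ccw ht
    have hs := T₀.hull_subset_closure ht
    have e1 : 2 * area {a, b, c} = cr a b c := by rw [Triangulation.area_triple hD]; ring
    simp only [he, e1]
    have hR : ∀ x ∈ hull {a, b, c}, ∀ y ∈ hull {a, b, c}, ‖y - x‖ ≤ Metric.diam (hull {a, b, c}) :=
      fun x hx y hy => by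
        rw [← dist_eq_norm]
        exact Metric.dist_le_diam_of_mem (Triangulation.isCompact_hull _).isBounded hy hx
    rw [hull_triple hD] at *
    exact T.oscillation_triangle_le hw.1 hq hΩ hm hγ hqu hD hs hR hx hy

/-! ### Sums over edges -/

namespace Triangulation

variable {Ω : Set Plane} (T : Triangulation Ω)

/-- The flags on interior edges. -/
def interiorFlags : Finset (Plane × Plane × Plane) :=
  T.flags.filter fun f => ∃ c, (f.2.1, f.1, c) ∈ T.flags

/-- The flags on boundary edges. -/
def boundaryFlags : Finset (Plane × Plane × Plane) :=
  T.flags.filter fun f => ¬ ∃ c, (f.2.1, f.1, c) ∈ T.flags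

/-- The flag on the other side of an interior edge. -/
def opp (f : Plane × Plane × Plane) : Plane × Plane × Plane :=
  if h : ∃ c, (f.2.1, f.1, c) ∈ T.flags then (f.2.1, f.1, h.choose) else f

lemma opp_eq {u v c c' : Plane} (h' : (v, u, c') ∈ T.flags) : T.opp (u, v, c) = (v, u, c') := by
  have h : ∃ d, (v, u, d) ∈ T.flags := ⟨c', h'⟩
  have : T.opp (u, v, c) = (v, u, h.choose) := dif_pos h
  rw [this, T.flag_opposite_unique h.choose_spec h']

lemma exists_opp {u v c : Plane} (hf : (u, v, c) ∈ T.interiorFlags) :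
    ∃ c', (v, u, c') ∈ T.flags ∧ T.opp (u, v, c) = (v, u, c') := by
  obtain ⟨c', h'⟩ := (Finset.mem_filter.1 hf).2
  exact ⟨c', h', T.opp_eq h'⟩

lemma opp_mem {f : Plane × Plane × Plane} (hf : f ∈ T.interiorFlags) :
    T.opp f ∈ T.interiorFlags := by
  obtain ⟨u, v, c⟩ := f
  obtain ⟨c', h', e⟩ := T.exists_opp hf
  rw [e]
  exact Finset.mem_filter.2 ⟨h', c, (Finset.mem_filter.1 hf).1⟩

lemma opp_opp {f : Plane × Plane × Plane} (hf : f ∈ T.interiorFlags) : T.opp (T.opp f) = f := by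
  obtain ⟨u, v, c⟩ := f
  obtain ⟨c', h', e⟩ := T.exists_opp hf
  rw [e, T.opp_eq (Finset.mem_filter.1 hf).1]

/-- The increment of `w` is odd under `opp`, so averaging the sum with its reindexing leaves only
coefficient differences. -/
lemma sum_interiorFlags (w : Plane → ℝ) (A : Plane × Plane × Plane → ℝ) :
    ∑ f ∈ T.interiorFlags, (w f.2.1 - w f.1) * A f =
      (1 / 2) * ∑ f ∈ T.interiorFlags, (w f.2.1 - w f.1) * (A f - A (T.opp f)) := by
  have h : ∑ f ∈ T.interiorFlags, (w f.2.1 - w f.1) * A f =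
      ∑ f ∈ T.interiorFlags, -((w f.2.1 - w f.1) * A (T.opp f)) := by
    refine Finset.sum_nbij' T.opp T.opp (fun f hf => T.opp_mem hf) (fun f hf => T.opp_mem hf)
      (fun f hf => T.opp_opp hf) (fun f hf => T.opp_opp hf) fun f hf => ?_
    rw [T.opp_opp hf]
    obtain ⟨u, v, c⟩ := f
    obtain ⟨c', h', e⟩ := T.exists_opp hf
    rw [e]; ring
  have h2 : ∑ f ∈ T.interiorFlags, (w f.2.1 - w f.1) * (A f - A (T.opp f)) =
      ∑ f ∈ T.interiorFlags, (w f.2.1 - w f.1) * A f +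
      ∑ f ∈ T.interiorFlags, -((w f.2.1 - w f.1) * A (T.opp f)) := by
    rw [← Finset.sum_add_distrib]
    exact Finset.sum_congr rfl fun f _ => by ring
  rw [h2, ← h]; ring

lemma sum_flags_eq (F : Plane × Plane × Plane → ℝ) :
    ∑ f ∈ T.flags, F f = ∑ f ∈ T.interiorFlags, F f + ∑ f ∈ T.boundaryFlags, F f :=
  (Finset.sum_filter_add_sum_filter_not _ _ _).symm

lemma boundaryEdge_of_flag {u v c : Plane} (hf : (u, v, c) ∈ T.boundaryFlags) :
    ({u, v} : Finset Plane) ∈ T.boundaryEdges := by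
  obtain ⟨h, h'⟩ := Finset.mem_filter.1 hf
  rw [T.mem_boundaryEdges_iff h]
  exact fun c' hc' => h' ⟨c', hc'⟩

lemma interiorEdge_of_flag {u v c : Plane} (hf : (u, v, c) ∈ T.interiorFlags) :
    ({u, v} : Finset Plane) ∈ T.interiorEdges := by
  obtain ⟨h, h'⟩ := Finset.mem_filter.1 hf
  rwa [T.mem_interiorEdges_iff h]

lemma boundaryFlag_mem {f : Plane × Plane × Plane} (hf : f ∈ T.boundaryFlags) :
    f.1 ∈ T.boundaryVertices ∧ f.2.1 ∈ T.boundaryVertices := by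
  have := T.boundaryEdge_of_flag hf
  exact ⟨Finset.mem_biUnion.2 ⟨_, this, by simp⟩, Finset.mem_biUnion.2 ⟨_, this, by simp⟩⟩

/-- Summation by parts along the boundary, grouped by vertices instead of following boundary curves.
Vertices with several incoming and outgoing edges are thereby allowed. -/
lemma sum_boundaryFlags (w : Plane → ℝ) (A : Plane × Plane × Plane → ℝ) :
    ∑ f ∈ T.boundaryFlags, (w f.2.1 - w f.1) * A f =
      ∑ x ∈ T.boundaryVertices, w x * (∑ f ∈ T.boundaryFlags.filter (fun f => f.2.1 = x), A f -
        ∑ f ∈ T.boundaryFlags.filter (fun f => f.1 = x), A f) := by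
  have h1 := Finset.sum_fiberwise_of_maps_to (s := T.boundaryFlags) (t := T.boundaryVertices)
    (g := fun f => f.2.1) (fun f hf => (T.boundaryFlag_mem hf).2) (fun f => w f.2.1 * A f)
  have h2 := Finset.sum_fiberwise_of_maps_to (s := T.boundaryFlags) (t := T.boundaryVertices)
    (g := fun f => f.1) (fun f hf => (T.boundaryFlag_mem hf).1) (fun f => w f.1 * A f)
  simp only [sub_mul, Finset.sum_sub_distrib, mul_sub]
  rw [← h1, ← h2]
  congr 1
  · refine Finset.sum_congr rfl fun x _ => ?_
    rw [Finset.mul_sum]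
    exact Finset.sum_congr rfl fun f hf => by rw [(Finset.mem_filter.1 hf).2]
  · refine Finset.sum_congr rfl fun x _ => ?_
    rw [Finset.mul_sum]
    exact Finset.sum_congr rfl fun f hf => by rw [(Finset.mem_filter.1 hf).2]

/-- Within a triangle, each edge ending at `x` is followed by one starting at `x`. The interior
flags are balanced too, by reversal, so the boundary flags must be. -/
lemma card_in_flags_eq_out (x : Plane) :
    (T.flags.filter fun f => f.2.1 = x).card = (T.flags.filter fun f => f.1 = x).card := by
  refine Finset.card_nbij' (fun f => (f.2.1, f.2.2, f.1)) (fun f => (f.2.2, f.1, f.2.1)) ?_ ?_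
    (fun _ _ => rfl) (fun _ _ => rfl)
  · intro f hf
    obtain ⟨h1, h2⟩ := Finset.mem_filter.1 hf
    exact Finset.mem_filter.2 ⟨T.flag_rotate h1, h2⟩
  · intro f hf
    obtain ⟨h1, h2⟩ := Finset.mem_filter.1 hf
    exact Finset.mem_filter.2 ⟨T.flag_rotate (T.flag_rotate h1), h2⟩

lemma card_in_interiorFlags_eq_out (x : Plane) : (T.interiorFlags.filter fun f => f.2.1 = x).card =
    (T.interiorFlags.filter fun f => f.1 = x).card := by
  have e1 : ∀ f ∈ T.interiorFlags, (T.opp f).1 = f.2.1 ∧ (T.opp f).2.1 = f.1 := by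
    rintro ⟨u, v, c⟩ hf
    obtain ⟨c', h', e⟩ := T.exists_opp hf
    rw [e]; exact ⟨rfl, rfl⟩
  refine Finset.card_nbij' T.opp T.opp ?_ ?_
    (fun f hf => T.opp_opp (Finset.mem_filter.1 hf).1)
    (fun f hf => T.opp_opp (Finset.mem_filter.1 hf).1)
  · intro f hf
    obtain ⟨h1, h2⟩ := Finset.mem_filter.1 hf
    exact Finset.mem_filter.2 ⟨T.opp_mem h1, (e1 f h1).1.trans h2⟩
  · intro f hf
    obtain ⟨h1, h2⟩ := Finset.mem_filter.1 hf
    exact Finset.mem_filter.2 ⟨T.opp_mem h1, (e1 f h1).2.trans h2⟩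

/-- At each vertex as many boundary edges end as start. -/
lemma card_in_boundaryFlags_eq_out (x : Plane) :
    (T.boundaryFlags.filter fun f => f.2.1 = x).card =
      (T.boundaryFlags.filter fun f => f.1 = x).card := by
  have split : ∀ (P : Plane × Plane × Plane → Prop) [DecidablePred P], (T.flags.filter P).card =
      (T.interiorFlags.filter P).card + (T.boundaryFlags.filter P).card := by
    intro P _
    rw [interiorFlags, boundaryFlags, Finset.filter_comm, Finset.filter_comm (p := fun f => ¬ _),
      Finset.card_filter_add_card_filter_not]
  have h1 := T.card_in_flags_eq_out x
  rw [split, split, T.card_in_interiorFlags_eq_out x] at h1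
  exact Nat.add_left_cancel h1

/-- A flag is determined by its unoriented edge together with its triangle, so the flags inject into
the pairs on the right. -/
lemma sum_area_flags_le {E : Finset (Finset Plane)} {S : Finset (Plane × Plane × Plane)}
    (hS : S ⊆ T.flags) (hE : ∀ f ∈ S, ({f.1, f.2.1} : Finset Plane) ∈ E) :
    ∑ f ∈ S, area (flagTri f) ≤ ∑ e ∈ E, ∑ t ∈ T.adjacent e, area t := by
  rw [Finset.sum_sigma']
  set i : Plane × Plane × Plane → (_ : Finset Plane) × Finset Plane :=
    fun f => ⟨{f.1, f.2.1}, flagTri f⟩ with hi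
  have hinj : Set.InjOn i S := by
    rintro ⟨u, v, c⟩ hf ⟨u', v', c'⟩ hf' h
    have hF := hS hf
    have hF' := hS hf'
    simp only [hi, Sigma.mk.injEq, heq_eq_eq, flagTri] at h
    obtain ⟨h1, h2⟩ := h
    have h3 : (u = u' ∧ v = v') ∨ (u = v' ∧ v = u') := by
      have h4 : ({u, v} : Set Plane) = {u', v'} := by
        have := congrArg (fun s : Finset Plane => (s : Set Plane)) h1
        simpa using this
      rwa [Set.pair_eq_pair_iff] at h4
    rcases h3 with ⟨rfl, rfl⟩ | ⟨rfl, rfl⟩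
    · rw [T.flag_opposite_unique hF hF']
    · exact absurd h2 (T.adjacent_of_opposite hF hF').2.1
  have e : ∑ f ∈ S, area (flagTri f) = ∑ x ∈ S.image i, area x.2 := by
    rw [Finset.sum_image hinj]
  rw [e]
  refine Finset.sum_le_sum_of_subset_of_nonneg ?_ fun x _ _ => measureReal_nonneg
  intro x hx
  obtain ⟨f, hf, rfl⟩ := Finset.mem_image.1 hx
  refine Finset.mem_sigma.2 ⟨hE f hf, T.mem_adjacent.2 ⟨T.flagTri_mem (hS hf), ?_⟩⟩
  exact Finset.insert_subset_insert _ (Finset.singleton_subset_iff.2 (by simp))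

end Triangulation

/-- Since every pair is assumed close, any bijection between the two sets will do. -/
lemma abs_sum_sub_sum_le {ι : Type*} {S S' : Finset ι} (hc : S.card = S'.card) {A : ι → ℝ} {η : ℝ}
    (h : ∀ f ∈ S, ∀ g ∈ S', |A f - A g| ≤ η) :
    |∑ f ∈ S, A f - ∑ g ∈ S', A g| ≤ S.card * η := by
  let e := Finset.equivOfCardEq hc
  have h1 : ∑ g ∈ S', A g = ∑ f : S, A (e f) := by
    rw [← Finset.sum_coe_sort S' A]; exact (Equiv.sum_comp e fun g : S' => A g).symm
  have h2 : ∑ f ∈ S, A f - ∑ g ∈ S', A g = ∑ f : S, (A f - A (e f)) := by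
    rw [h1, ← Finset.sum_coe_sort S A, Finset.sum_sub_distrib]
  calc _ ≤ ∑ f : S, |A f - A (e f)| := h2 ▸ Finset.abs_sum_le_sum_abs _ _
    _ ≤ ∑ _f : S, η := Finset.sum_le_sum fun f _ => h f f.2 (e f) (e f).2
    _ = _ := by simp

/-! ### Comparison of coefficients of neighbouring triangles -/

/-- The constant in the comparison of coefficients for triangles with area at least `κ h² / 2`. -/
def coefConst (κ : ℝ) : ℝ := (4 / κ + 3 / κ ^ 2) * (1 + (7 + 5 / κ) / κ ^ 2)

lemma coefConst_nonneg {κ : ℝ} (hκ : 0 < κ) : 0 ≤ coefConst κ := by unfold coefConst; positivity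

/-- Once one edge vector and the three side lengths nearly agree, `edge_sub_le` gives the second
edge vector and closing the triangle gives the third. The Lipschitz bound `abs_edgeCoef_sub_le` then
applies. -/
lemma edgeCoef_close {κ : ℝ} (hκ : 0 < κ) {B B' : Fin 2 → Fin 2 → ℝ} {N h ε β : ℝ}
    (hh : 0 < h) (hB : ∀ i j, |B i j| ≤ N) (hB' : ∀ i j, |B' i j| ≤ N)
    (hβ : ∀ i j, |B i j - B' i j| ≤ β) {d₁ d₂ d₃ e₁ e₂ e₃ : Plane}
    (hd0 : d₁ + d₂ + d₃ = 0) (he0 : e₁ + e₂ + e₃ = 0)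
    (hd : κ * h ^ 2 ≤ cross d₂ d₃) (he : κ * h ^ 2 ≤ cross e₂ e₃)
    (nd1 : ‖d₁‖ ≤ h) (nd2 : ‖d₂‖ ≤ h) (nd3 : ‖d₃‖ ≤ h)
    (ne1 : ‖e₁‖ ≤ h) (ne2 : ‖e₂‖ ≤ h) (ne3 : ‖e₃‖ ≤ h) (h1 : ‖d₁ - e₁‖ ≤ ε)
    (h2 : |‖d₂‖ - ‖e₂‖| ≤ ε) (h3 : |‖d₃‖ - ‖e₃‖| ≤ ε) :
    |edgeCoef B d₂ d₃ - edgeCoef B' e₂ e₃| ≤ coefConst κ * (N * h * ε + β * h ^ 2) := by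
  have hd3 : d₃ = -(d₁ + d₂) := by rw [eq_neg_iff_add_eq_zero, add_comm]; exact hd0
  have he3 : e₃ = -(e₁ + e₂) := by rw [eq_neg_iff_add_eq_zero, add_comm]; exact he0
  have hε : 0 ≤ ε := (norm_nonneg _).trans h1
  have hN : 0 ≤ N := (abs_nonneg _).trans (hB 0 0)
  have hβ0 : 0 ≤ β := (abs_nonneg _).trans (hβ 0 0)
  have k1 : cross d₁ d₂ = cross d₂ d₃ := by rw [hd3]; simp [cross]; ring
  have k2 : cross e₁ e₂ = cross e₂ e₃ := by rw [he3]; simp [cross]; ring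
  have n1 : ‖d₁ + d₂‖ = ‖d₃‖ := by rw [hd3, norm_neg]
  have n2 : ‖e₁ + e₂‖ = ‖e₃‖ := by rw [he3, norm_neg]
  have c2 := edge_sub_le hκ hh (k1 ▸ hd) (k2 ▸ he) nd1 nd2 (n1 ▸ nd3) ne1 ne2 (n2 ▸ ne3) h1 h2
    (by rwa [n1, n2])
  set C := (7 + 5 / κ) / κ ^ 2 with hC
  have hC0 : 0 ≤ C := by rw [hC]; positivity
  have c3 : ‖d₃ - e₃‖ ≤ (1 + C) * ε := by
    have : d₃ - e₃ = -((d₁ - e₁) + (d₂ - e₂)) := by rw [hd3, he3]; abel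
    rw [this, norm_neg]
    refine (norm_add_le _ _).trans ?_
    linarith
  refine (abs_edgeCoef_sub_le hκ hh hB hB' hβ hd he nd2 nd3 ne2 ne3
    (c2.trans (by linarith : C * ε ≤ (1 + C) * ε)) c3).trans ?_
  rw [coefConst, mul_assoc (4 / κ + 3 / κ ^ 2)]
  refine mul_le_mul_of_nonneg_left ?_ (by positivity)
  have : 0 ≤ C * (β * h ^ 2) := by positivity
  calc _ = (1 + C) * (N * h * ε) + β * h ^ 2 := by ring
    _ ≤ (1 + C) * (N * h * ε) + (β * h ^ 2 + C * (β * h ^ 2)) := by linarith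
    _ = _ := by rw [← hC]; ring

namespace Triangulation

variable {Ω : Set Plane} (T : Triangulation Ω)

lemma norm_edge_le {h : ℝ} (hm : T.IsMeshSize h) {u v c : Plane} (hf : (u, v, c) ∈ T.flags) :
    ‖v - u‖ ≤ h ∧ ‖c - v‖ ≤ h ∧ ‖u - c‖ ≤ h := by
  have ht := (T.mem_flags.1 hf).1
  have := fun x y hx hy => T.dist_le_meshSize hm ht (mem_hull_of_mem (x := x) hx)
    (mem_hull_of_mem (x := y) hy)
  exact ⟨this _ _ (by simp) (by simp), this _ _ (by simp) (by simp), this _ _ (by simp) (by simp)⟩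

lemma abs_flagCoef_le {h γ : ℝ} (hm : T.IsMeshSize h) (hγ : 0 < γ) (hq : T.QuasiUniform h γ)
    {B : Fin 2 → Fin 2 → ℝ} {N : ℝ} (hB : ∀ i j, |B i j| ≤ N) {u v c : Plane}
    (hf : (u, v, c) ∈ T.flags) : |flagCoef B u v c| ≤ 1 / (6 * γ ^ 2) * N * h ^ 2 := by
  obtain ⟨_, h2, h3⟩ := T.norm_edge_le hm hf
  exact abs_edgeCoef_le (by positivity) (T.meshSize_pos hm) hB
    (by rw [cross_eq_cr]; exact T.cr_lower hm hγ hq hf) h2 h3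

lemma flagCoef_interior_close {h γ : ℝ} (hm : T.IsMeshSize h) (hγ : 0 < γ)
    (hq : T.QuasiUniform h γ) {B B' : Fin 2 → Fin 2 → ℝ} {N ε β : ℝ} (hB : ∀ i j, |B i j| ≤ N)
    (hB' : ∀ i j, |B' i j| ≤ N) (hβ : ∀ i j, |B i j - B' i j| ≤ β) {u v c c' : Plane}
    (hf : (u, v, c) ∈ T.flags) (hf' : (v, u, c') ∈ T.flags)
    (hp : ApproxParallelogram ε u v c c') :
    |flagCoef B u v c - flagCoef B' v u c'| ≤
      coefConst (6 * γ ^ 2) * (N * h * ε + β * h ^ 2) := by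
  obtain ⟨h1, h2, h3⟩ := T.norm_edge_le hm hf
  obtain ⟨k1, k2, k3⟩ := T.norm_edge_le hm hf'
  obtain ⟨p1, p2⟩ := hp
  have hε : 0 ≤ ε := (abs_nonneg _).trans p1
  -- The second triangle is reflected through a point. After this the common edge is the same vector
  -- `v - u` in both triangles, and opposite sides of the quadrilateral correspond.
  have e' : flagCoef B' v u c' = edgeCoef B' (u - c') (c' - v) := by
    rw [flagCoef, ← edgeCoef_neg, neg_sub, neg_sub]
  rw [e', flagCoef]
  refine edgeCoef_close (by positivity) (T.meshSize_pos hm) hB hB' hβ (d₁ := v - u) (e₁ := v - u)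
    (by abel) (by abel) ?_ ?_ h1 h2 h3 h1 ?_ ?_ (by simpa using hε) ?_ ?_
  · rw [cross_eq_cr]; exact T.cr_lower hm hγ hq hf
  · have : cross (u - c') (c' - v) = cr v u c' := by simp [cross, cr]; ring
    rw [this]; exact T.cr_lower hm hγ hq hf'
  · rwa [norm_sub_rev]
  · rwa [norm_sub_rev]
  · rwa [norm_sub_rev, ← dist_eq_norm, ← dist_eq_norm]
  · rwa [← dist_eq_norm, norm_sub_rev, ← dist_eq_norm]

lemma flagCoef_boundary_close {h γ : ℝ} (hm : T.IsMeshSize h) (hγ : 0 < γ)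
    (hq : T.QuasiUniform h γ) {B B' : Fin 2 → Fin 2 → ℝ} {N ε δ β : ℝ} (hB : ∀ i j, |B i j| ≤ N)
    (hB' : ∀ i j, |B' i j| ≤ N) (hβ : ∀ i j, |B i j - B' i j| ≤ β) {x y c z d : Plane}
    (hf : (y, x, c) ∈ T.flags) (hf' : (x, z, d) ∈ T.flags)
    (hp : ApproxBoundaryParallelogram ε δ x y c z d) :
    |flagCoef B y x c - flagCoef B' x z d| ≤
      coefConst (6 * γ ^ 2) * (N * h * (ε + h * δ) + β * h ^ 2) := by
  obtain ⟨h1, h2, h3⟩ := T.norm_edge_le hm hf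
  obtain ⟨k1, k2, k3⟩ := T.norm_edge_le hm hf'
  obtain ⟨p1, p2, p3, p4⟩ := hp
  have hh := T.meshSize_pos hm
  have hδ : 0 ≤ h * δ := mul_nonneg hh.le ((norm_nonneg _).trans p4)
  have ht : ∀ a b : Plane, a ≠ b → b - a = dist a b • unitTangent a b := by
    intro a b hab
    rw [unitTangent, smul_smul, mul_inv_cancel₀ (dist_ne_zero.2 hab), one_smul]
  have nt : ∀ a b : Plane, a ≠ b → ‖unitTangent a b‖ = 1 := by
    intro a b hab
    rw [unitTangent, norm_smul, norm_inv, Real.norm_of_nonneg dist_nonneg, ← dist_eq_norm,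
      dist_comm b a, inv_mul_cancel₀ (dist_ne_zero.2 hab)]
  have n1 := (T.mem_flags.1 hf).2.ne.1
  have n2 := (T.mem_flags.1 hf').2.ne.1
  refine edgeCoef_close (by positivity) hh hB hB' hβ (d₁ := x - y) (e₁ := z - x)
    (by abel) (by abel) ?_ ?_ h1 h2 h3 k1 k2 k3 ?_ ?_ ?_
  · rw [cross_eq_cr]; exact T.cr_lower hm hγ hq hf
  · rw [cross_eq_cr]; exact T.cr_lower hm hγ hq hf'
  · have e : x - y - (z - x) = (dist y x - dist x z) • unitTangent y x +
        dist x z • (unitTangent y x - unitTangent x z) := by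
      rw [ht y x n1, ht x z n2, sub_smul, smul_sub]; abel
    rw [e]
    refine (norm_add_le _ _).trans (add_le_add ?_ ?_)
    · rw [norm_smul, nt y x n1, mul_one]; exact p1
    · rw [norm_smul, Real.norm_of_nonneg dist_nonneg]
      refine mul_le_mul ?_ p4 (norm_nonneg _) hh.le
      rwa [dist_comm, dist_eq_norm]
  · rw [← dist_eq_norm, ← dist_eq_norm, dist_comm c, dist_comm d]; linarith
  · rw [← dist_eq_norm, ← dist_eq_norm, dist_comm y, dist_comm x]; linarith

end Triangulation

/-! ### Elementwise approximation of the vector field -/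

namespace Triangulation

variable {Ω : Set Plane} (T : Triangulation Ω)

lemma nonempty_interior_hull {t : Finset Plane} (ht : t ∈ T.triangles) :
    (interior (hull t)).Nonempty := by
  obtain ⟨a, b, c, rfl, hD⟩ := T.exists_ccw ht
  by_contra hne
  rw [Set.not_nonempty_iff_eq_empty] at hne
  have h1 := T.volume_interior_hull ht
  have h2 := area_triple hD
  rw [hne] at h1
  have h3 : area {a, b, c} = 0 := by
    rw [← h1]; simp
  have h4 : 0 < cr a b c := hD
  linarith

lemma convex_hull (t : Finset Plane) : Convex ℝ (hull t) := convex_convexHull ℝ _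

lemma hull_subset_closure_interior {t : Finset Plane} (ht : t ∈ T.triangles) :
    hull t ⊆ closure (interior (hull t)) := by
  rw [(convex_hull t).closure_interior_eq_closure_of_nonempty_interior
    (T.nonempty_interior_hull ht)]
  exact subset_closure

/-- On a mesh, a field of class `W^{2,∞}` is approximated on the triangles by affine fields, whose
linear parts nearly agree on triangles sharing a vertex. -/
lemma exists_elementwise_affine (hopen : IsOpen Ω) (hbdd : Bornology.IsBounded Ω)
    (hlip : HasLipschitzBoundary Ω) {h : ℝ} (hm : T.IsMeshSize h) {p : Plane → Plane}
    {G : Fin 2 → Fin 2 → Plane → ℝ} {H : Fin 2 → Fin 2 → Fin 2 → Plane → ℝ}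
    (hp : IsW2Infty Ω p G H) :
    ∃ (B : Finset Plane → Fin 2 → Fin 2 → ℝ) (k : Finset Plane → Fin 2 → ℝ),
      (∀ t i j, |B t i j| ≤ normW1Infty Ω G H) ∧
      (∀ t ∈ T.triangles, ∀ y ∈ hull t, ∀ i,
        |p y i - (k t i + B t i 0 * y 0 + B t i 1 * y 1)| ≤ 4 * normW1Infty Ω G H * h ^ 2) ∧
      ∀ t ∈ T.triangles, ∀ t' ∈ T.triangles, ∀ x ∈ t, x ∈ t' → ∀ i j,
        |B t i j - B t' i j| ≤ 6 * normW1Infty Ω G H * h := by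
  have hΩ := interior_closure_of_lipschitz hopen hlip
  have hh := T.meshSize_pos hm
  obtain ⟨g, hg, hgs⟩ := hp.exists_jacobian hopen hbdd
  set N := normW1Infty Ω G H with hN
  have hN0 : 0 ≤ N := normW1Infty_nonneg Ω G H
  choose! z hz using fun t (ht : t ∈ T.triangles) => T.nonempty_interior_hull ht
  have hseg : ∀ t ∈ T.triangles, ∀ a ∈ interior (hull t), ∀ b ∈ interior (hull t),
      segment ℝ a b ⊆ Ω := fun t ht a ha b hb =>
    ((convex_hull t).interior.segment_subset ha hb).trans (T.interior_hull_subset hΩ ht)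
  refine ⟨fun t i j => g i j (z t), fun t i => p (z t) i - g i 0 (z t) * z t 0 - g i 1 (z t) * z t 1,
    fun t i j => hg i j _, fun t ht y hy i => ?_, fun t ht t' ht' x hx hx' i j => ?_⟩
  · have hc : ContinuousOn (fun y : Plane => |p y i - ((p (z t) i - g i 0 (z t) * z t 0 -
        g i 1 (z t) * z t 1) + g i 0 (z t) * y 0 + g i 1 (z t) * y 1)|) (hull t) := by
      have h1 : ContinuousOn (fun y => p y i) (hull t) :=
        (EuclideanSpace.proj (𝕜 := ℝ) i).continuous.comp_continuousOn
          (hp.continuousOn.mono (T.hull_subset_closure ht))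
      exact (h1.sub (by fun_prop)).abs
    -- The Taylor bound is available for interior points of the triangle, where segments stay in
    -- `Ω`. By continuity of `p` it extends to the closed triangle, including the edges on which
    -- fluxes are taken.
    refine ContinuousWithinAt.closure_le (T.hull_subset_closure_interior ht hy)
      ((hc y hy).mono interior_subset) continuousWithinAt_const fun a ha => ?_
    have h1 := (hgs _ _ (hseg t ht _ (hz t ht) _ ha)).2 i
    have h2 : ‖a - z t‖ ≤ h :=
      T.dist_le_meshSize hm ht (interior_subset ha) (interior_subset (hz t ht))
    have h3 : 4 * N * ‖a - z t‖ ^ 2 ≤ 4 * N * h ^ 2 := by gcongr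
    refine le_trans (le_of_eq ?_) (h1.trans h3)
    congr 1; ring
  · have hxc := T.hull_subset_closure ht (mem_hull_of_mem hx)
    obtain ⟨η, hη, hpath⟩ := exists_short_path hopen hlip hxc hh
    have near : ∀ s ∈ T.triangles, x ∈ s → ∃ a ∈ interior (hull s), a ∈ Metric.ball x η := by
      intro s hs hxs
      obtain ⟨a, ha, ha'⟩ := Metric.mem_closure_iff.1
        (T.hull_subset_closure_interior hs (mem_hull_of_mem hxs)) η hη
      exact ⟨a, ha, by rwa [Metric.mem_ball, dist_comm]⟩
    obtain ⟨a, ha, hax⟩ := near t ht hx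
    obtain ⟨b, hb, hbx⟩ := near t' ht' hx'
    obtain ⟨c, d, h1, h2, h3, hlen⟩ := hpath a ⟨T.interior_hull_subset hΩ ht ha, hax⟩ b
      ⟨T.interior_hull_subset hΩ ht' hb, hbx⟩
    have e0 := (hgs _ _ (hseg t ht _ (hz t ht) _ ha)).1 i j
    have e1 := (hgs _ _ h1).1 i j
    have e2 := (hgs _ _ h2).1 i j
    have e3 := (hgs _ _ h3).1 i j
    have e4 := (hgs _ _ (hseg t' ht' _ hb _ (hz t' ht'))).1 i j
    have l0 : ‖a - z t‖ ≤ h :=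
      T.dist_le_meshSize hm ht (interior_subset ha) (interior_subset (hz t ht))
    have l4 : ‖z t' - b‖ ≤ h :=
      T.dist_le_meshSize hm ht' (interior_subset (hz t' ht')) (interior_subset hb)
    -- The path from `z t` to `z t'` passes through `a`, `c`, `d`, `b`. Its two end links and its
    -- middle part, found near the common vertex with `δ = h`, each have length at most `h`.
    have hsum : 2 * N * (‖a - z t‖ + (‖c - a‖ + ‖d - c‖ + ‖b - d‖) + ‖z t' - b‖) ≤
        2 * N * (h + h + h) := by gcongr
    rw [abs_le] at *
    constructor <;> linarith [e0.1, e0.2, e1.1, e1.2, e2.1, e2.2, e3.1, e3.2, e4.1, e4.2]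

/-- The integral of the interpolation error against a discrete curl is, up to higher order terms, a
sum over the edges of the triangles. -/
lemma abs_innerL2_sub_sum_flags_le (hΩ : interior (closure Ω) = Ω) {h E : ℝ}
    (hm : T.IsMeshSize h) {p r : Plane → Plane} (hp : ContinuousOn p (closure Ω))
    {B : Finset Plane → Fin 2 → Fin 2 → ℝ} {k : Finset Plane → Fin 2 → ℝ}
    (hB : ∀ t ∈ T.triangles, ∀ y ∈ hull t, ∀ i,
      |p y i - (k t i + B t i 0 * y 0 + B t i 1 * y 1)| ≤ E) (hr : T.IsRTInterpolant p r)
    {w : Plane → ℝ} {q : Finset Plane → Plane} (hq : T.IsCurl w q) :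
    |innerL2 Ω (fun x => p x - r x) (curl w) - ∑ f ∈ T.flags, (w f.2.1 - w f.1) *
      flagCoef (B (flagTri f)) f.1 f.2.1 f.2.2| ≤ 4 * E * h ^ 2 * ∑ t ∈ T.triangles, ‖q t‖ := by
  set F : Plane × Plane × Plane → ℝ := fun f => (w f.2.1 - w f.1) *
    flagCoef (B (flagTri f)) f.1 f.2.1 f.2.2 with hF
  have hpt : ∀ t ∈ T.triangles, ContinuousOn p (hull t) := fun t ht =>
    hp.mono (T.hull_subset_closure ht)
  have hint : ∀ t ∈ T.triangles, IntegrableOn (fun x => inner ℝ (p x - r x) (curl w x))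
      (interior (hull t)) := by
    intro t ht
    obtain ⟨a, m, hra, -⟩ := hr t ht
    have h1 : IntegrableOn (fun x => inner ℝ (p x - (a + m • x)) (q t)) (interior (hull t)) := by
      refine IntegrableOn.mono_set (ContinuousOn.integrableOn_compact (isCompact_hull t) ?_)
        interior_subset
      exact ((hpt t ht).sub (by fun_prop)).inner continuousOn_const
    refine h1.congr_fun (fun x hx => ?_) isOpen_interior.measurableSet
    simp only [hra x hx, (hq t ht).1 x hx]
  rw [innerL2, T.setIntegral_eq_sum hΩ _ hint,
    ← Finset.sum_fiberwise_of_maps_to (fun f hf => T.flagTri_mem hf) F, ← Finset.sum_sub_distrib,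
    Finset.mul_sum]
  refine (Finset.abs_sum_le_sum_abs _ _).trans (Finset.sum_le_sum fun t ht => ?_)
  obtain ⟨v, m, hrv, hflux⟩ := hr t ht
  have hpt' := hpt t ht
  have hBt := hB t ht
  obtain ⟨hq1, hq2⟩ := hq t ht
  have hI : ∫ x in interior (hull t), inner ℝ (p x - r x) (curl w x) =
      ∫ x in interior (hull t), inner ℝ (p x - r x) (q t) :=
    setIntegral_congr_fun isOpen_interior.measurableSet fun x hx => by simp only [hq1 x hx]
  rw [hI]
  obtain ⟨a, b, c, rfl, hD⟩ := T.exists_ccw ht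
  have hf := T.mem_flags.2 ⟨ht, hD⟩
  obtain ⟨n1, n2, n3⟩ := hD.ne
  obtain ⟨l1, l2, l3⟩ := T.norm_edge_le hm hf
  rw [T.sum_flags_filter hf]
  have e2 : flagTri (b, c, a) = {a, b, c} := by ext; simp [flagTri]; tauto
  have e3 : flagTri (c, a, b) = {a, b, c} := by ext; simp [flagTri]; tauto
  have e1 : flagTri (a, b, c) = {a, b, c} := rfl
  simp only [hF, e1, e2, e3]
  have ha : a ∈ hull {a, b, c} := mem_hull_of_mem (by simp)
  have hb : b ∈ hull {a, b, c} := mem_hull_of_mem (by simp)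
  have hc : c ∈ hull {a, b, c} := mem_hull_of_mem (by simp)
  rw [hq2 a ha b hb, hq2 b hb c hc, hq2 c hc a ha]
  rw [hull_triple hD] at hpt' hBt hrv ⊢
  rw [interior_ctri hD] at hrv ⊢
  set P : Plane → Plane := fun y => !₂[k {a, b, c} 0 + B {a, b, c} 0 0 * y 0 + B {a, b, c} 0 1 * y 1,
    k {a, b, c} 1 + B {a, b, c} 1 0 * y 0 + B {a, b, c} 1 1 * y 1] with hPdef
  have hP : IsAffineField P (k {a, b, c}) (B {a, b, c}) := by
    intro y i; fin_cases i <;> simp [hPdef]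
  exact element_estimate hD l1 l2 l3 hpt' hP (fun y hy i => by rw [hP y i]; exact hBt y hy i) hrv
    (hflux a (by simp) b (by simp) n1) (hflux b (by simp) c (by simp) n2)
    (hflux c (by simp) a (by simp) n3) (q {a, b, c})

end Triangulation

/-! ### Powers of the mesh size -/

lemma hpow_nonneg {h : ℝ} (hh : 0 < h) (a : ℝ≥0∞) : 0 ≤ hpow h a := by
  rw [hpow]; split_ifs <;> positivity

lemma hpow_one_add {h : ℝ} (hh : 0 < h) (a : ℝ≥0∞) : hpow h (1 + a) = h * hpow h a := by
  rw [hpow, hpow]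
  by_cases ha : a = ⊤
  · simp [ha]
  · rw [if_neg (by simp [ha]), if_neg ha, ENNReal.toReal_add (by simp) ha, Real.rpow_add hh]
    simp

lemma hpow_le_rpow_rho {h : ℝ} (hh : 0 < h) (h1 : h ≤ 1) (α σ : ℝ≥0∞) :
    hpow h α ≤ h ^ rho α σ := by
  rw [hpow]
  split_ifs with ha
  · positivity
  · exact Real.rpow_le_rpow_of_exponent_ge hh h1
      (ENNReal.toReal_mono ha ((min_le_right _ _).trans (min_le_left _ _)))

lemma sqrt_hpow_le_rpow_rho {h : ℝ} (hh : 0 < h) (h1 : h ≤ 1) (α σ : ℝ≥0∞) :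
    √(hpow h σ) ≤ h ^ rho α σ := by
  rw [hpow]
  split_ifs with ha
  · rw [Real.sqrt_zero]; positivity
  · rw [Real.sqrt_eq_rpow, ← Real.rpow_mul hh.le]
    refine Real.rpow_le_rpow_of_exponent_ge hh h1 ?_
    have := ENNReal.toReal_mono (ENNReal.div_ne_top ha two_ne_zero)
      ((min_le_right (1 : ℝ≥0∞) _).trans (min_le_right α (σ / 2)))
    rw [ENNReal.toReal_div] at this
    rw [rho]
    refine this.trans (le_of_eq ?_)
    simp; ring

lemma le_rpow_rho {h : ℝ} (hh : 0 < h) (h1 : h ≤ 1) (α σ : ℝ≥0∞) : h ≤ h ^ rho α σ := by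
  nth_rw 1 [← Real.rpow_one h]
  refine Real.rpow_le_rpow_of_exponent_ge hh h1 ?_
  have := ENNReal.toReal_mono ENNReal.one_ne_top (min_le_left (1 : ℝ≥0∞) (min α (σ / 2)))
  simpa [rho] using this

lemma abs_log_le_abs_log {h h₀ : ℝ} (hh : 0 < h) (hle : h ≤ h₀) (h1 : h₀ < 1) :
    |Real.log h₀| ≤ |Real.log h| := by
  have a1 := Real.log_nonpos (hh.le.trans hle) h1.le
  have a2 := Real.log_le_log hh hle
  rw [abs_of_nonpos a1, abs_of_nonpos (a2.trans a1)]; linarith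

/-- The logarithm is at most `log 2 + 2 |log h|`, and `|log h| ≥ |log h₀| > 0` absorbs the constant.
-/
lemma sqrt_log_le {h h₀ : ℝ} (hh : 0 < h) (hle : h ≤ h₀) (h1 : h₀ < 1) :
    √(Real.log ((1 + h ^ 2) / h ^ 2)) ≤
      √(Real.log 2 / |Real.log h₀| + 2) * |Real.log h| ^ (1 / 2 : ℝ) := by
  have hl0 : 0 < |Real.log h₀| := abs_pos.2 (Real.log_neg (hh.trans_le hle) h1).ne
  have hl := abs_log_le_abs_log hh hle h1
  rw [← Real.sqrt_eq_rpow, ← Real.sqrt_mul (by positivity)]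
  apply Real.sqrt_le_sqrt
  have a2 : Real.log h ≤ 0 := Real.log_nonpos hh.le (hle.trans h1.le)
  have a3 : Real.log (1 + h ^ 2) ≤ Real.log 2 := Real.log_le_log (by positivity) (by nlinarith)
  have a4 : Real.log 2 ≤ Real.log 2 / |Real.log h₀| * |Real.log h| := by
    rw [div_mul_eq_mul_div, le_div_iff₀ hl0]
    exact mul_le_mul_of_nonneg_left hl (Real.log_nonneg one_le_two)
  rw [Real.log_div (by positivity) (by positivity), Real.log_pow, add_mul]
  push_cast
  rw [abs_of_nonpos a2] at a4 ⊢
  linarith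

/-- Lets the terms without a logarithm be absorbed; here `h₀ < 1` keeps `|log h|` away from zero. -/
lemma one_le_sqrt_log {h h₀ : ℝ} (hh : 0 < h) (hle : h ≤ h₀) (h1 : h₀ < 1) :
    1 ≤ (√|Real.log h₀|)⁻¹ * |Real.log h| ^ (1 / 2 : ℝ) := by
  have hl0 : 0 < |Real.log h₀| := abs_pos.2 (Real.log_neg (hh.trans_le hle) h1).ne
  have hl := abs_log_le_abs_log hh hle h1
  have : 0 < √|Real.log h₀| := Real.sqrt_pos.2 hl0
  rw [← Real.sqrt_eq_rpow, inv_mul_eq_div, le_div_iff₀ this, one_mul]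
  exact Real.sqrt_le_sqrt hl

/-! ### Estimates of the sums over interior and boundary edges -/

namespace Triangulation

variable {Ω : Set Plane} (T : Triangulation Ω)

lemma sum_area (hΩ : interior (closure Ω) = Ω) :
    ∑ t ∈ T.triangles, area t = volume.real Ω := by
  have h := T.setIntegral_eq_sum hΩ (fun _ => (1 : ℝ)) fun t _ =>
    integrableOn_const (volume_interior_lt_top t).ne
  simp only [setIntegral_const, smul_eq_mul, mul_one] at h
  rw [h]
  exact Finset.sum_congr rfl fun t ht => (T.volume_interior_hull ht).symm

/-- Cauchy-Schwarz with areas as weights, which are bounded below by `3 γ² h²`. The `√3` appears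
because each triangle has three flags. For a small set of flags its total area remains as a gain. -/
lemma sum_norm_flags_le {h γ : ℝ} (hm : T.IsMeshSize h) (hγ : 0 < γ) (hqu : T.QuasiUniform h γ)
    (hΩ : interior (closure Ω) = Ω) {w : Plane → ℝ} {q : Finset Plane → Plane}
    (hq : T.IsCurl w q) {S : Finset (Plane × Plane × Plane)} (hS : S ⊆ T.flags) :
    ∑ f ∈ S, ‖q (flagTri f)‖ ≤
      √(∑ f ∈ S, area (flagTri f)) * (√3 * normL2 Ω (curl w)) / (3 * γ ^ 2 * h ^ 2) := by
  have hh := T.meshSize_pos hm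
  have ha : ∀ s : Finset Plane, 0 ≤ area s := fun s => measureReal_nonneg
  rw [le_div_iff₀ (by positivity)]
  have h1 : (∑ f ∈ S, ‖q (flagTri f)‖) * (3 * γ ^ 2 * h ^ 2) ≤
      ∑ f ∈ S, √(area (flagTri f)) * (√(area (flagTri f)) * ‖q (flagTri f)‖) := by
    rw [Finset.sum_mul]
    refine Finset.sum_le_sum fun f hf => ?_
    rw [← mul_assoc (√_), Real.mul_self_sqrt (ha _), mul_comm]
    exact mul_le_mul_of_nonneg_right (T.area_lower hm hγ hqu (T.flagTri_mem (hS hf)))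
      (norm_nonneg _)
  refine h1.trans ((Real.sum_mul_le_sqrt_mul_sqrt _ _ _).trans ?_)
  simp only [mul_pow, Real.sq_sqrt (ha _)]
  refine mul_le_mul_of_nonneg_left ?_ (Real.sqrt_nonneg _)
  rw [Real.sqrt_le_left (by unfold normL2; positivity), mul_pow, Real.sq_sqrt (by norm_num),
    hq.normL2_sq T hΩ, ← T.sum_flags_tri fun t => area t * ‖q t‖ ^ 2]
  exact Finset.sum_le_sum_of_subset_of_nonneg hS fun f _ _ => mul_nonneg (ha _) (sq_nonneg _)

lemma abs_sum_interiorFlags_le {h : ℝ} (hm : T.IsMeshSize h) {w : Plane → ℝ}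
    {q : Finset Plane → Plane} (hq : T.IsCurl w q) {A : Plane × Plane × Plane → ℝ} {η a : ℝ}
    (hη : 0 ≤ η) (hA : ∀ f ∈ T.flags, |A f| ≤ a) {E : Finset (Finset Plane)}
    (hE : ∀ f ∈ T.interiorFlags, ({f.1, f.2.1} : Finset Plane) ∉ E → |A f - A (T.opp f)| ≤ η) :
    |∑ f ∈ T.interiorFlags, (w f.2.1 - w f.1) * A f| ≤
      h / 2 * (η * ∑ f ∈ T.flags, ‖q (flagTri f)‖ + 2 * a *
        ∑ f ∈ T.interiorFlags.filter (fun f => ({f.1, f.2.1} : Finset Plane) ∈ E),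
          ‖q (flagTri f)‖) := by
  have hh := T.meshSize_pos hm
  have hsub : T.interiorFlags ⊆ T.flags := Finset.filter_subset _ _
  have hδ : ∀ f ∈ T.flags, |w f.2.1 - w f.1| ≤ h * ‖q (flagTri f)‖ := by
    rintro ⟨u, v, c⟩ hf
    have h1 := hq.abs_sub_le T (T.flagTri_mem hf) (x := u) (y := v)
      (mem_hull_of_mem (by simp [flagTri])) (mem_hull_of_mem (by simp [flagTri]))
    rw [mul_comm]
    exact h1.trans (mul_le_mul_of_nonneg_left (T.norm_edge_le hm hf).1 (norm_nonneg _))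
  rw [sum_interiorFlags, abs_mul, abs_of_pos (by norm_num : (0 : ℝ) < 1 / 2)]
  have h1 : ∑ f ∈ T.interiorFlags, |(w f.2.1 - w f.1) * (A f - A (T.opp f))| ≤
      ∑ f ∈ T.interiorFlags, (h * (η * ‖q (flagTri f)‖) +
        if ({f.1, f.2.1} : Finset Plane) ∈ E then h * (2 * a * ‖q (flagTri f)‖) else 0) := by
    refine Finset.sum_le_sum fun f hf => ?_
    have b1 := hδ f (hsub hf)
    rw [abs_mul]
    split_ifs with hfE
    · have b2 : |A f - A (T.opp f)| ≤ 2 * a := by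
        have c1 := hA f (hsub hf)
        have c2 := hA _ (hsub (T.opp_mem hf))
        rw [abs_le] at *
        constructor <;> linarith
      have b3 : 0 ≤ h * (η * ‖q (flagTri f)‖) := by positivity
      have := mul_le_mul b1 b2 (abs_nonneg _) (by positivity)
      linarith
    · have := mul_le_mul b1 (hE f hf hfE) (abs_nonneg _) (by positivity)
      linarith
  rw [Finset.sum_add_distrib, ← Finset.sum_filter, ← Finset.mul_sum, ← Finset.mul_sum,
    ← Finset.mul_sum, ← Finset.mul_sum] at h1
  have h2 : h * (η * ∑ f ∈ T.interiorFlags, ‖q (flagTri f)‖) ≤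
      h * (η * ∑ f ∈ T.flags, ‖q (flagTri f)‖) := by
    gcongr
  have h3 := Finset.abs_sum_le_sum_abs (fun f => (w f.2.1 - w f.1) * (A f - A (T.opp f)))
    T.interiorFlags
  linarith

/-- After summation by parts, incoming and outgoing flags at a vertex are equal in number, at most
`4 / γ²`. They are paired with difference `η`, or with the trivial `2 * a` at the at most `κ`
exceptional vertices. -/
lemma abs_sum_boundaryFlags_le {h γ : ℝ} (hm : T.IsMeshSize h) (hγ : 0 < γ)
    (hqu : T.QuasiUniform h γ) {w : Plane → ℝ} {W : ℝ} {A : Plane × Plane × Plane → ℝ} {η a : ℝ}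
    (hη : 0 ≤ η) (ha : 0 ≤ a) (hA : ∀ f ∈ T.flags, |A f| ≤ a)
    (hw : ∀ x ∈ T.boundaryVertices, |w x| ≤ W) (hW : 0 ≤ W) {P : Finset Plane} {κ : ℕ}
    (hPκ : P.card ≤ κ) (hP : ∀ f ∈ T.boundaryFlags, ∀ g ∈ T.boundaryFlags, f.2.1 = g.1 →
      g.1 ∉ P → |A f - A g| ≤ η) :
    |∑ f ∈ T.boundaryFlags, (w f.2.1 - w f.1) * A f| ≤
      W * (4 / γ ^ 2) * (T.boundaryVertices.card * η + κ * (2 * a)) := by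
  rw [sum_boundaryFlags]
  have hsub : T.boundaryFlags ⊆ T.flags := Finset.filter_subset _ _
  have hcard : ∀ x, ((T.boundaryFlags.filter fun f => f.2.1 = x).card : ℝ) ≤ 4 / γ ^ 2 :=
    fun x => (Nat.cast_le.2 (Finset.card_le_card (Finset.filter_subset_filter _ hsub))).trans
      (T.card_flags_at_vertex hm hγ hqu x)
  have hx : ∀ x, ∀ η', 0 ≤ η' → (∀ f ∈ T.boundaryFlags.filter (fun f => f.2.1 = x),
      ∀ g ∈ T.boundaryFlags.filter (fun f => f.1 = x), |A f - A g| ≤ η') →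
      |∑ f ∈ T.boundaryFlags.filter (fun f => f.2.1 = x), A f -
        ∑ f ∈ T.boundaryFlags.filter (fun f => f.1 = x), A f| ≤ 4 / γ ^ 2 * η' :=
    fun x η' hη' hfg => (abs_sum_sub_sum_le (T.card_in_boundaryFlags_eq_out x) hfg).trans
      (mul_le_mul_of_nonneg_right (hcard x) hη')
  calc _ ≤ ∑ x ∈ T.boundaryVertices, W * (4 / γ ^ 2 * (η + if x ∈ P then 2 * a else 0)) := by
        refine (Finset.abs_sum_le_sum_abs _ _).trans (Finset.sum_le_sum fun x hxb => ?_)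
        rw [abs_mul]
        refine mul_le_mul (hw x hxb) ?_ (abs_nonneg _) hW
        refine hx x _ (by split_ifs <;> positivity) fun f hf g hg => ?_
        obtain ⟨hf1, hf2⟩ := Finset.mem_filter.1 hf
        obtain ⟨hg1, hg2⟩ := Finset.mem_filter.1 hg
        split_ifs with hxP
        · have c1 := hA f (hsub hf1)
          have c2 := hA g (hsub hg1)
          rw [abs_le] at *
          constructor <;> linarith
        · rw [add_zero]
          exact hP f hf1 g hg1 (hf2.trans hg2.symm) (hg2 ▸ hxP)
    _ = W * (4 / γ ^ 2) * (T.boundaryVertices.card * η +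
          (T.boundaryVertices.filter (· ∈ P)).card * (2 * a)) := by
        rw [← Finset.mul_sum, ← Finset.mul_sum, Finset.sum_add_distrib, ← Finset.sum_filter]
        simp [mul_assoc]
    _ ≤ _ := by
        have : ((T.boundaryVertices.filter (· ∈ P)).card : ℝ) ≤ κ := by
          refine Nat.cast_le.2 ((Finset.card_le_card fun x hx => ?_).trans hPκ)
          exact (Finset.mem_filter.1 hx).2
        gcongr

end Triangulation

/-! ### Coefficient differences under the mesh condition and the explicit estimate -/

namespace Triangulation

variable {Ω : Set Plane} (T : Triangulation Ω)

lemma abs_flagCoef_sub_opp_le {h γ N M a : ℝ} {α : ℝ≥0∞} (hm : T.IsMeshSize h) (hγ : 0 < γ)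
    (hqu : T.QuasiUniform h γ) {B : Finset Plane → Fin 2 → Fin 2 → ℝ} (hB : ∀ t i j, |B t i j| ≤ N)
    (hBc : ∀ t ∈ T.triangles, ∀ t' ∈ T.triangles, ∀ x ∈ t, x ∈ t' → ∀ i j,
      |B t i j - B t' i j| ≤ 6 * N * h) (hα : hpow h α ≤ a) (ha : h ≤ a)
    {E : Finset (Finset Plane)}
    (hE : ∀ a b c d : Plane, {a, b} ∈ T.interiorEdges \ E → {a, b, c} ∈ T.triangles →
      {a, b, d} ∈ T.triangles → c ≠ d → ApproxParallelogram (M * hpow h (1 + α)) a b c d)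
    {f : Plane × Plane × Plane} (hf : f ∈ T.interiorFlags)
    (hfE : ({f.1, f.2.1} : Finset Plane) ∉ E) :
    |flagCoef (B (flagTri f)) f.1 f.2.1 f.2.2 - flagCoef (B (flagTri (T.opp f))) (T.opp f).1
      (T.opp f).2.1 (T.opp f).2.2| ≤ coefConst (6 * γ ^ 2) * (N * h ^ 2 * ((|M| + 6) * a)) := by
  have hh := T.meshSize_pos hm
  have hN : 0 ≤ N := (abs_nonneg _).trans (hB ∅ 0 0)
  obtain ⟨u, v, c⟩ := f
  obtain ⟨c', h', e⟩ := T.exists_opp hf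
  have h0 := (Finset.mem_filter.1 hf).1
  obtain ⟨-, -, hcc⟩ := T.adjacent_of_opposite h0 h'
  have ht := (T.mem_flags.1 h0).1
  have ht' := (T.mem_flags.1 h').1
  have hswap : ({u, v, c'} : Finset Plane) = {v, u, c'} := by ext; simp; tauto
  have hpar := hE u v c c' (Finset.mem_sdiff.2 ⟨T.interiorEdge_of_flag hf, hfE⟩) ht
    (hswap ▸ ht') hcc
  rw [e]
  refine (T.flagCoef_interior_close hm hγ hqu (hB _) (hB _)
    (hBc _ ht _ ht' u (by simp) (by simp)) h0 h' hpar).trans ?_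
  refine mul_le_mul_of_nonneg_left ?_ (coefConst_nonneg (by positivity))
  rw [hpow_one_add hh]
  have h1 : M * hpow h α ≤ |M| * a :=
    mul_le_mul (le_abs_self M) hα (hpow_nonneg hh α) (abs_nonneg M)
  calc _ = N * h ^ 2 * (M * hpow h α + 6 * h) := by ring
    _ ≤ N * h ^ 2 * (|M| * a + 6 * a) := by gcongr
    _ = _ := by ring

lemma abs_flagCoef_sub_boundary_le {h γ N M a : ℝ} {α : ℝ≥0∞} (hm : T.IsMeshSize h) (hγ : 0 < γ)
    (hqu : T.QuasiUniform h γ) {B : Finset Plane → Fin 2 → Fin 2 → ℝ} (hB : ∀ t i j, |B t i j| ≤ N)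
    (hBc : ∀ t ∈ T.triangles, ∀ t' ∈ T.triangles, ∀ x ∈ t, x ∈ t' → ∀ i j,
      |B t i j - B t' i j| ≤ 6 * N * h) (hα : hpow h α ≤ a) (ha : h ≤ a) {P : Finset Plane}
    (hP : ∀ x ∈ T.boundaryVertices \ P, ∀ y c z d : Plane,
      {y, x} ∈ T.boundaryEdges → {x, z} ∈ T.boundaryEdges →
      {y, x, c} ∈ T.triangles → {x, z, d} ∈ T.triangles → Ccw y x c → Ccw x z d →
      ApproxBoundaryParallelogram (M * hpow h (1 + α)) (M * hpow h α) x y c z d)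
    {f g : Plane × Plane × Plane} (hf : f ∈ T.boundaryFlags) (hg : g ∈ T.boundaryFlags)
    (hfg : f.2.1 = g.1) (hgP : g.1 ∉ P) :
    |flagCoef (B (flagTri f)) f.1 f.2.1 f.2.2 - flagCoef (B (flagTri g)) g.1 g.2.1 g.2.2| ≤
      coefConst (6 * γ ^ 2) * (N * h ^ 2 * ((2 * |M| + 6) * a)) := by
  have hh := T.meshSize_pos hm
  have hN : 0 ≤ N := (abs_nonneg _).trans (hB ∅ 0 0)
  have hb := (T.boundaryFlag_mem hg).1
  obtain ⟨y, x, c⟩ := f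
  obtain ⟨x', z, d⟩ := g
  obtain rfl : x = x' := hfg
  have hf0 := (Finset.mem_filter.1 hf).1
  have hg0 := (Finset.mem_filter.1 hg).1
  obtain ⟨ht, hD⟩ := T.mem_flags.1 hf0
  obtain ⟨ht', hD'⟩ := T.mem_flags.1 hg0
  have hpar := hP x (Finset.mem_sdiff.2 ⟨hb, hgP⟩) y c z d (T.boundaryEdge_of_flag hf)
    (T.boundaryEdge_of_flag hg) ht ht' hD hD'
  refine (T.flagCoef_boundary_close hm hγ hqu (hB _) (hB _)
    (hBc _ ht _ ht' x (by simp) (by simp)) hf0 hg0 hpar).trans ?_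
  refine mul_le_mul_of_nonneg_left ?_ (coefConst_nonneg (by positivity))
  rw [hpow_one_add hh]
  have h1 : M * hpow h α ≤ |M| * a :=
    mul_le_mul (le_abs_self M) hα (hpow_nonneg hh α) (abs_nonneg M)
  calc _ = N * h ^ 2 * (2 * (M * hpow h α) + 6 * h) := by ring
    _ ≤ N * h ^ 2 * (2 * (|M| * a) + 6 * a) := by gcongr
    _ = _ := by ring

/-- The superconvergence estimate, with explicit constants, in terms of a bound `W` for the
oscillation of the discrete stream function. -/
theorem abs_innerL2_le (hopen : IsOpen Ω) (hbdd : Bornology.IsBounded Ω)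
    (hlip : HasLipschitzBoundary Ω) {h γ M K W : ℝ} {α σ : ℝ≥0∞} {κ : ℕ} (hm : T.IsMeshSize h)
    (h1 : h ≤ 1) (hγ : 0 < γ) (hqu : T.QuasiUniform h γ) (has : T.AlphaSigma h α σ M κ)
    {p : Plane → Plane} {G : Fin 2 → Fin 2 → Plane → ℝ} {H : Fin 2 → Fin 2 → Fin 2 → Plane → ℝ}
    (hp : IsW2Infty Ω p G H) {r : Plane → Plane} (hr : T.IsRTInterpolant p r) {w : Plane → ℝ}
    (hw : T.IsContinuousP1 w) (hW : 0 ≤ W) {x₀ : Plane}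
    (hwW : ∀ x ∈ closure Ω, |w x - w x₀| ≤ W) {S : Finset Plane} (hK : (S.card : ℝ) ≤ K / h)
    (hS : frontier Ω ⊆ ⋃ s ∈ S, Metric.closedBall s h) :
    |innerL2 Ω (fun x => p x - r x) (curl w)| ≤ normW1Infty Ω G H * (h * h ^ rho α σ) *
      (((16 + coefConst (6 * γ ^ 2) * (|M| + 6) / 2) *
          (√(3 * volume.real Ω) * √3 / (3 * γ ^ 2)) +
        1 / (6 * γ ^ 2) * (√|M| * √3 / (3 * γ ^ 2))) * normL2 Ω (curl w) +
      4 / γ ^ 2 * (K * (16 / γ ^ 2) * (coefConst (6 * γ ^ 2) * (2 * |M| + 6)) +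
        κ * (2 * (1 / (6 * γ ^ 2)))) * W) := by
  have hΩ := interior_closure_of_lipschitz hopen hlip
  have hh := T.meshSize_pos hm
  obtain ⟨q, hq⟩ := T.exists_isCurl hw
  obtain ⟨B, k, hB, hBk, hBc⟩ := T.exists_elementwise_affine hopen hbdd hlip hm hp
  obtain ⟨⟨E, -, hE, hEa⟩, P, -, hPκ, hP⟩ := has
  have hN : 0 ≤ normW1Infty Ω G H := normW1Infty_nonneg Ω G H
  have hY : 0 ≤ normL2 Ω (curl w) := Real.sqrt_nonneg _
  have hR1 := hpow_le_rpow_rho hh h1 α σ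
  have hR2 := sqrt_hpow_le_rpow_rho hh h1 α σ
  have hR3 := le_rpow_rho hh h1 α σ
  have hC3 := coefConst_nonneg (κ := 6 * γ ^ 2) (by positivity)
  have hel := T.abs_innerL2_sub_sum_flags_le hΩ hm hp.continuousOn hBk hr hq
  have hsplit := T.sum_flags_eq fun f => (w f.2.1 - w f.1) *
    flagCoef (B (flagTri f)) f.1 f.2.1 f.2.2
  have hA : ∀ f ∈ T.flags, |flagCoef (B (flagTri f)) f.1 f.2.1 f.2.2| ≤
      1 / (6 * γ ^ 2) * normW1Infty Ω G H * h ^ 2 :=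
    fun f hf => T.abs_flagCoef_le hm hγ hqu (hB _) hf
  have hint := T.abs_sum_interiorFlags_le hm hq (by positivity) hA (E := E) fun f hf hfE =>
    T.abs_flagCoef_sub_opp_le hm hγ hqu hB hBc hR1 hR3 hE hf hfE
  -- Only increments of `w` occur, so `w` may be normalized to vanish at `x₀`; the boundary sum then
  -- involves its oscillation.
  have hbd := T.abs_sum_boundaryFlags_le hm hγ hqu (w := fun x => w x - w x₀) (by positivity)
    (by positivity) hA (fun x hx => hwW x
      (frontier_subset_closure (T.boundaryVertices_subset_frontier hopen hx))) hW hPκ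
    fun f hf g hg hfg hgP => T.abs_flagCoef_sub_boundary_le hm hγ hqu hB hBc hR1 hR3 hP hf hg hfg hgP
  simp only [sub_sub_sub_cancel_right] at hbd
  have hbv := T.card_boundaryVertices hm hγ hqu hopen hK hS
  have hs1 := T.sum_norm_flags_le hm hγ hqu hΩ hq (Finset.Subset.refl _)
  rw [T.sum_flags_tri area, T.sum_area hΩ] at hs1
  have hs2 := T.sum_norm_flags_le hm hγ hqu hΩ hq (S := T.interiorFlags.filter
    (fun f => ({f.1, f.2.1} : Finset Plane) ∈ E))
    ((Finset.filter_subset _ _).trans (Finset.filter_subset _ _))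
  have hEa' : √(∑ f ∈ T.interiorFlags.filter (fun f => ({f.1, f.2.1} : Finset Plane) ∈ E),
      area (flagTri f)) ≤ √|M| * h ^ rho α σ := by
    refine le_trans ?_ (mul_le_mul_of_nonneg_left hR2 (Real.sqrt_nonneg _))
    rw [← Real.sqrt_mul (abs_nonneg M)]
    refine Real.sqrt_le_sqrt ?_
    refine (T.sum_area_flags_le ((Finset.filter_subset _ _).trans (Finset.filter_subset _ _))
      fun f hf => (Finset.mem_filter.1 hf).2).trans (hEa.trans ?_)
    exact mul_le_mul_of_nonneg_right (le_abs_self M) (hpow_nonneg hh σ)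
  have hst := T.sum_flags_tri fun t => ‖q t‖
  have hst0 : 0 ≤ ∑ t ∈ T.triangles, ‖q t‖ := by positivity
  have hK0 : 0 ≤ K := by
    have : 0 ≤ K / h := (Nat.cast_nonneg _).trans hK
    by_contra hneg
    exact absurd this (not_le.2 (div_neg_of_neg_of_pos (not_le.1 hneg) hh))
  generalize h ^ rho α σ = R at *
  generalize normW1Infty Ω G H = N at *
  generalize normL2 Ω (curl w) = Y at *
  generalize coefConst (6 * γ ^ 2) = C at *
  generalize ∑ t ∈ T.triangles, ‖q t‖ = st at *
  generalize ∑ f ∈ T.flags, ‖q (flagTri f)‖ = sf at *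
  generalize √(3 * volume.real Ω) = V at *
  generalize ∑ f ∈ T.interiorFlags with {f.1, f.2.1} ∈ E, ‖q (flagTri f)‖ = se at *
  generalize (T.boundaryVertices.card : ℝ) = nb at *
  have hR0 : 0 ≤ R := hh.le.trans hR3
  have b1 : h ^ 2 * sf ≤ V * √3 / (3 * γ ^ 2) * Y := by
    refine (mul_le_mul_of_nonneg_left hs1 (sq_nonneg h)).trans (le_of_eq ?_)
    field_simp
  have b2 : h ^ 2 * se ≤ R * (√|M| * √3 / (3 * γ ^ 2)) * Y := by
    refine (mul_le_mul_of_nonneg_left (hs2.trans (div_le_div_of_nonneg_right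
      (mul_le_mul_of_nonneg_right hEa' (by positivity)) (by positivity))) (sq_nonneg h)).trans
      (le_of_eq ?_)
    field_simp
  have b3 : h * nb ≤ K * (16 / γ ^ 2) := by
    refine (mul_le_mul_of_nonneg_left hbv hh.le).trans (le_of_eq ?_)
    field_simp
  -- Contribution of the Taylor remainder, of order `h²` and so within `h * R` because `h ≤ R`.
  have t0 : 4 * (4 * N * h ^ 2) * h ^ 2 * st ≤
      N * (h * R) * (16 * (V * √3 / (3 * γ ^ 2)) * Y) := by
    have : st ≤ sf := by linarith
    calc _ = 16 * N * h * h * (h ^ 2 * st) := by ring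
      _ ≤ 16 * N * h * R * (h ^ 2 * sf) := by gcongr
      _ ≤ 16 * N * h * R * (V * √3 / (3 * γ ^ 2) * Y) := by gcongr
      _ = _ := by ring
  -- Interior edges: regular ones gain `R` in the coefficient, exceptional ones through the square
  -- root of their total area.
  have t1 : h / 2 * (C * (N * h ^ 2 * ((|M| + 6) * R)) * sf +
      2 * (1 / (6 * γ ^ 2) * N * h ^ 2) * se) ≤ N * (h * R) * ((C * (|M| + 6) / 2 *
          (V * √3 / (3 * γ ^ 2)) + 1 / (6 * γ ^ 2) * (√|M| * √3 / (3 * γ ^ 2))) * Y) := by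
    calc _ = N * (h * R) * (C * (|M| + 6) / 2) * (h ^ 2 * sf) +
          N * h * (1 / (6 * γ ^ 2)) * (h ^ 2 * se) := by ring
      _ ≤ N * (h * R) * (C * (|M| + 6) / 2) * (V * √3 / (3 * γ ^ 2) * Y) +
          N * h * (1 / (6 * γ ^ 2)) * (R * (√|M| * √3 / (3 * γ ^ 2)) * Y) := by gcongr
      _ = _ := by ring
  -- Boundary vertices: `O(1 / h)` regular ones with coefficient differences of order `h² R`, and at
  -- most `κ` exceptional ones with `h² ≤ h R`.
  have t2 : W * (4 / γ ^ 2) * (nb * (C * (N * h ^ 2 * ((2 * |M| + 6) * R))) +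
      κ * (2 * (1 / (6 * γ ^ 2) * N * h ^ 2))) ≤ N * (h * R) *
      (4 / γ ^ 2 * (K * (16 / γ ^ 2) * (C * (2 * |M| + 6)) + κ * (2 * (1 / (6 * γ ^ 2)))) * W) := by
    calc _ = W * (4 / γ ^ 2) * (N * h * R * (C * (2 * |M| + 6)) * (h * nb) +
          N * h * h * (κ * (2 * (1 / (6 * γ ^ 2))))) := by ring
      _ ≤ W * (4 / γ ^ 2) * (N * h * R * (C * (2 * |M| + 6)) * (K * (16 / γ ^ 2)) +
          N * h * R * (κ * (2 * (1 / (6 * γ ^ 2))))) := by gcongr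
      _ = _ := by ring
  have htri : |innerL2 Ω (fun x => p x - r x) (curl w)| ≤ 4 * (4 * N * h ^ 2) * h ^ 2 * st +
      h / 2 * (C * (N * h ^ 2 * ((|M| + 6) * R)) * sf + 2 * (1 / (6 * γ ^ 2) * N * h ^ 2) * se) +
      W * (4 / γ ^ 2) * (nb * (C * (N * h ^ 2 * ((2 * |M| + 6) * R))) +
        κ * (2 * (1 / (6 * γ ^ 2) * N * h ^ 2))) := by
    rw [hsplit] at hel
    rw [abs_le] at hel hint hbd ⊢
    constructor <;> linarith [hel.1, hel.2, hint.1, hint.2, hbd.1, hbd.2]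
  refine htri.trans ((add_le_add (add_le_add t0 t1) t2).trans (le_of_eq ?_))
  ring

end Triangulation

end

end MixedFEM

/-! ### The main estimate -/

open MixedFEM
/-- For a bounded Lipschitz domain `Ω`, the constant `C` depends only on `Ω`, on `α`, `σ`, on the
constants in the mesh conditions, and on the bound `h₀ < 1` for the mesh size. -/
theorem lemma3p5 (Ω : Set Plane) (hopen : IsOpen Ω) (hconn : IsConnected Ω)
    (hbdd : Bornology.IsBounded Ω) (hlip : HasLipschitzBoundary Ω)
    (α σ : ℝ≥0∞) (γ M h₀ : ℝ) (κ : ℕ) (hγ : 0 < γ) (hh₀ : h₀ < 1) :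
    ∃ C : ℝ, ∀ (T : Triangulation Ω) (h : ℝ), T.IsMeshSize h → h ≤ h₀ →
      T.QuasiUniform h γ → T.AlphaSigma h α σ M κ →
      ∀ (p : Plane → Plane) (G : Fin 2 → Fin 2 → Plane → ℝ)
        (H : Fin 2 → Fin 2 → Fin 2 → Plane → ℝ), IsW2Infty Ω p G H →
      ∀ r : Plane → Plane, T.IsRTInterpolant p r →
      ∀ w : Plane → ℝ, T.IsContinuousP1 w →
        |innerL2 Ω (fun x => p x - r x) (curl w)| ≤
          C * h ^ (1 + rho α σ) * |Real.log h| ^ (1 / 2 : ℝ) * normW1Infty Ω G H *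
            normL2 Ω (curl w) := by
  -- Without triangulations the claim is vacuous. Otherwise one is fixed as part of the data of `Ω`,
  -- and supplies the Sobolev constant and the covering constant of the frontier.
  by_cases hT : Nonempty (Triangulation Ω)
  swap
  · exact ⟨0, fun T => (hT ⟨T⟩).elim⟩
  obtain ⟨T₀⟩ := hT
  have hΩ := interior_closure_of_lipschitz hopen hlip
  obtain ⟨x₀, hx₀⟩ := hconn.nonempty
  obtain ⟨CS, hCS, hsob⟩ := discrete_sobolev hΩ hconn T₀ hγ
  obtain ⟨K, hK, hcover⟩ := T₀.frontier_cover hopen hΩ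
  set D₁ : ℝ := (16 + coefConst (6 * γ ^ 2) * (|M| + 6) / 2) *
    (√(3 * volume.real Ω) * √3 / (3 * γ ^ 2)) +
      1 / (6 * γ ^ 2) * (√|M| * √3 / (3 * γ ^ 2)) with hD₁
  set D₂ : ℝ := 4 / γ ^ 2 * (K * (16 / γ ^ 2) * (coefConst (6 * γ ^ 2) * (2 * |M| + 6)) +
    κ * (2 * (1 / (6 * γ ^ 2)))) with hD₂
  have hC := coefConst_nonneg (κ := 6 * γ ^ 2) (by positivity)
  have hD₁0 : 0 ≤ D₁ := by positivity
  have hD₂0 : 0 ≤ D₂ := by positivity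
  -- `D₁` comes from the terms without logarithm, and `D₂` multiplies the oscillation bound from the
  -- discrete Sobolev inequality.
  refine ⟨D₁ * (√|Real.log h₀|)⁻¹ + D₂ * (CS * √(Real.log 2 / |Real.log h₀| + 2)), ?_⟩
  intro T h hm hle hqu has p G H hp r hr w hw
  have hh := T.meshSize_pos hm
  have h1 : h ≤ 1 := hle.trans hh₀.le
  obtain ⟨S, hScard, hS⟩ := hcover h hh h1
  have key := T.abs_innerL2_le hopen hbdd hlip hm h1 hγ hqu has hp hr hw
    (W := CS * √(Real.log ((1 + h ^ 2) / h ^ 2)) * normL2 Ω (curl w))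
    (mul_nonneg (by positivity) (Real.sqrt_nonneg _)) (x₀ := x₀)
    (fun x hx => hsob T h hm hqu w hw x hx x₀ (subset_closure hx₀)) hScard hS
  rw [← hD₁, ← hD₂] at key
  have l1 := one_le_sqrt_log hh hle hh₀
  have l2 := sqrt_log_le hh hle hh₀
  have hN : 0 ≤ normW1Infty Ω G H := normW1Infty_nonneg Ω G H
  have hY : 0 ≤ normL2 Ω (curl w) := Real.sqrt_nonneg _
  rw [Real.rpow_add hh, Real.rpow_one]
  set L := |Real.log h| ^ (1 / 2 : ℝ)
  set R := h ^ rho α σ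
  have hR : 0 ≤ R := by positivity
  calc _ ≤ _ := key
    _ = normW1Infty Ω G H * (h * R) * normL2 Ω (curl w) *
        (D₁ * 1 + D₂ * (CS * √(Real.log ((1 + h ^ 2) / h ^ 2)))) := by ring
    _ ≤ normW1Infty Ω G H * (h * R) * normL2 Ω (curl w) *
        (D₁ * ((√|Real.log h₀|)⁻¹ * L) +
          D₂ * (CS * (√(Real.log 2 / |Real.log h₀| + 2) * L))) := by gcongr
    _ = _ := by ring
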